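/- Let $N\ge 1$ and let $\mathscr M$ be the class of Lebesgue measurable subsets of $\mathbb R^N$. Let $J:\mathscr M\to[0,+\infty]$ be a generalized perimeter, that is: $J(E)<\infty$ for every $C^2$-set $E$ that is bounded or has bounded complement; $J(\emptyset)=J(\mathbb R^N)=0$; $J(E)=J(E')$ if $|E\triangle E'|=0$; $J$ is lower semicontinuous in $L^1_{loc}$; $J(E\cap E')+J(E\cup E')\le J(E)+J(E')$ for all $E,E'\in\mathscr M$; $J(z+E)=J(E)$ for all $E\in\mathscr M$, $z\in\mathbb R^N$. For a $C^2$-set $E$ that is bounded or has bounded complement and $x\in\partial E$ set $$\kappa^+(x,E)=\inf\Big\{\liminf_n \tfrac{J(E\cup W_n)-J(E)}{|W_n\setminus E|}\Big\},\qquad \kappa^-(x,E)=\sup\Big\{\limsup_n \tfrac{J(E)-J(E\setminus W_n)}{|W_n\cap E|}\Big\},$$ over all sequences of measurable sets $W_n$ with $\overline{W_n}\to\{x\}$ in the Hausdorff distance and $|W_n\setminus E|>0$, respectively $|W_n\cap E|>0$. Assume that always $\kappa^+(x,E)=\kappa^-(x,E)=:\kappa(x,E)\in\mathbb R$ and that *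 (C) if $E_n\to E$ in $C^2$ (i.e. $E_n=\Phi_n(E)$ with $C^2$-diffeomorphisms $\Phi_n$ of $\mathbb R^N$ such that $\Phi_n-\mathrm{Id}\to0$ uniformly with first and second derivatives) and $\partial E_n\ni x_n\to x\in\partial E$, then $\kappa(x_n,E_n)\to\kappa(x,E)$; * (D) there is $K>0$ with $\kappa(x,B_\rho)\ge -K$ and $-\kappa(x,B_\rho^c)\ge -K$ for all $\rho>0$, $x\in\partial B_\rho$. Let $\psi:\mathbb R^N\to[0,\infty)$ be an anisotropy (continuous, convex, even, positively $1$-homogeneous, with $c_\psi^{-1}|p|\le\psi(p)\le c_\psi|p|$ for some $c_\psi>0$), let $\psi^\circ(v)=\sup_{\psi(\xi)\le1}\xi\cdot v$, $\mathrm{dist}^\psi_E(x)=\inf_{y\in E}\psi^\circ(x-y)$ (with $\inf\emptyset=+\infty$) and $\mathrm{sd}^\psi_E=\mathrm{dist}^\psi_E-\mathrm{dist}^\psi_{E^c}$. Let $G:\mathbb R\to\mathbb R$ be continuous and non-decreasing, with $G(0)=0$ and $G\not\equiv0$, let $-a=\lim_{s\to-\infty}G(s)$, $b=\lim_{s\to+\infty}G(s)$,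 and let $g$ be a selection of the inverse of $G$ on $(-a,b)$, with $g(0)=0$, extended by $g(s)=-\infty$ for $s\le -a$, $s\neq 0$, and $g(s)=+\infty$ for $s\ge b$, $s\ne0$. Let $\mathtt f:\mathbb R\to\mathbb R$ be continuous and bounded, and set $f(kh)=\frac1h\int_{kh}^{(k+1)h}\mathtt f(s)\,ds$. For $h>0$, $t\ge0$ and a bounded $E\in\mathscr M$, let $T_{h,t}E$ be the minimal minimizer (with respect to inclusion up to null sets) over $F\in\mathscr M$ of $$J(F)+\int_{E\triangle F}\Big|g\Big(\frac{\mathrm{sd}^\psi_E}{h}\Big)\Big|\,dx-f([t/h]h)\,|F|$$ (with value $+\infty$ if $|F|=\infty$). For unbounded $E$ with bounded complement, let $T_{h,t}E$ be the complement of the maximal minimizer of the same problem with $E^c$, $F\mapsto J(F^c)$, $s\mapsto -g(-s)$, $-f$ in place of $E$, $J$, $g$, $f$. The sets $T_{h,t}E$ are represented by their points of density one. For functions set $T_{h,t}u(x)=\sup\{s\in\mathbb R: x\in T_{h,t}\{u\ge s\}\}$. Given a continuous $u_0:\mathbb R^N\to\mathbb R$ that is constant outside a compact set, define $u_h(\cdot,t)=u_0$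 for $t\in[0,h)$ and $u_h(\cdot,t)=T_{h,t-h}u_h(\cdot,t-h)$ for $t\ge h$. **Proposition.** Let $T>0$. 1. The functions $u_h$, $h>0$, are bounded on $\mathbb R^N\times[0,T]$ uniformly in $h$. 2. For every $\varepsilon>0$ there are $\delta>0$ and $h_0>0$ such that $|u_h(x,t)-u_h(y,s)|\le\varepsilon$ for all $0<h\le h_0$, $x,y\in\mathbb R^N$ and $t,s\in[0,T]$ with $|x-y|\le\delta$, $|t-s|\le\delta$. 3. Every sequence $h_n\to0^+$ has a subsequence along which $u_{h_n}$ converges uniformly on $\mathbb R^N\times[0,T]$ to a uniformly continuous function $u$ which is bounded and, for some compact $K\subset\mathbb R^N$, constant on $(\mathbb R^N\setminus K)\times[0,T]$. -/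

import Mathlib

open Set Filter Topology MeasureTheory
open scoped ENNReal

/-- The Euclidean space `ℝ^N`. -/
abbrev RN (N : ℕ) : Type := EuclideanSpace ℝ (Fin N)

noncomputable section

namespace MinMov

variable {N : ℕ}

/-! ### Anisotropies and signed distances -/

/-- An anisotropy: continuous, convex, even, positively 1-homogeneous and comparable with the
Euclidean norm (in particular nonnegative). -/
structure IsAnisotropy (ψ : RN N → ℝ) : Prop where
  continuous : Continuous ψ
  convex : ConvexOn ℝ univ ψ
  even : ∀ p, ψ (-p) = ψ p
  homogeneous : ∀ (r : ℝ) (p : RN N), 0 < r → ψ (r • p) = r * ψ p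
  bounds : ∃ c : ℝ, 0 < c ∧ ∀ p, c⁻¹ * ‖p‖ ≤ ψ p ∧ ψ p ≤ c * ‖p‖

/-- The polar function `ψ°(v) = sup {ξ · v : ψ ξ ≤ 1}`. -/
def polar (ψ : RN N → ℝ) (v : RN N) : ℝ :=
  sSup ((fun ξ : RN N => inner ℝ ξ v) '' {ξ | ψ ξ ≤ 1})

/-- The `ψ`-distance from `E`, with values in `[0, ∞]`; it is `+∞` if `E = ∅`. -/
def psiDist (ψ : RN N → ℝ) (E : Set (RN N)) (x : RN N) : EReal :=
  ⨅ y ∈ E, ((polar ψ (x - y) : ℝ) : EReal)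

/-- The signed `ψ`-distance; it is `+∞` for `E = ∅` and `-∞` for `E = ℝ^N`. -/
def signedDist (ψ : RN N → ℝ) (E : Set (RN N)) (x : RN N) : EReal :=
  psiDist ψ E x - psiDist ψ Eᶜ x

/-! ### Sets of class `C²` -/

/-- `E` is of class `C²`: near each boundary point it is the sublevel set of a `C²` function with
nonvanishing differential, where it does not matter which points of the (Lebesgue null) zero level
belong to `E`. -/
def IsC2Set (E : Set (RN N)) : Prop :=
  ∀ x ∈ frontier E, ∃ φ : RN N → ℝ, ContDiffAt ℝ 2 φ x ∧ fderiv ℝ φ x ≠ 0 ∧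
    ∀ᶠ y in 𝓝 x, (φ y < 0 → y ∈ E) ∧ (0 < φ y → y ∉ E)

/-- The sets of class `C²` which are bounded or have bounded complement. For `N ≥ 2` these are
exactly the sets of class `C²` with compact boundary. -/
def IsAdmissibleC2 (E : Set (RN N)) : Prop :=
  IsC2Set E ∧ (Bornology.IsBounded E ∨ Bornology.IsBounded Eᶜ)

/-- `E_n → E` in `C²`: `E_n = Φ_n(E)` for `C²` diffeomorphisms `Φ_n` of `ℝ^N` converging to the
identity uniformly, together with their first and second derivatives. -/
def TendstoC2 (En : ℕ → Set (RN N)) (E : Set (RN N)) : Prop :=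
  ∃ Φ : ℕ → (RN N ≃ RN N),
    (∀ n, ContDiff ℝ 2 (Φ n) ∧ ContDiff ℝ 2 (Φ n).symm ∧ En n = Φ n '' E) ∧
    ∀ i : ℕ, i ≤ 2 → ∀ ε : ℝ, 0 < ε → ∀ᶠ n in atTop, ∀ y : RN N,
      ‖iteratedFDeriv ℝ i (fun z => Φ n z - z) y‖ ≤ ε

/-! ### Generalized perimeters and their curvatures -/

/-- Generalized perimeters. `NullMeasurableSet` is Lebesgue measurability; the values of `J` on
non-measurable sets are irrelevant. -/
structure IsGeneralizedPerimeter (J : Set (RN N) → ℝ≥0∞) : Prop where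
  finite_C2 : ∀ E, IsAdmissibleC2 E → J E < ⊤
  empty : J ∅ = 0
  univ : J univ = 0
  congr_ae : ∀ E F, NullMeasurableSet E volume → NullMeasurableSet F volume →
    volume (symmDiff E F) = 0 → J E = J F
  lsc : ∀ (En : ℕ → Set (RN N)) (E : Set (RN N)),
    (∀ n, NullMeasurableSet (En n) volume) → NullMeasurableSet E volume →
    (∀ K : Set (RN N), IsCompact K →
      Tendsto (fun n => volume (symmDiff (En n) E ∩ K)) atTop (𝓝 0)) →
    J E ≤ liminf (fun n => J (En n)) atTop
  submodular : ∀ E F, NullMeasurableSet E volume → NullMeasurableSet F volume →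
    J (E ∩ F) + J (E ∪ F) ≤ J E + J F
  translation : ∀ (E : Set (RN N)) (z : RN N), NullMeasurableSet E volume →
    J ((fun y => z + y) '' E) = J E

/-- Sequences of measurable sets whose closures converge to `{x}` in the Hausdorff distance. -/
def ShrinksTo (W : ℕ → Set (RN N)) (x : RN N) : Prop :=
  (∀ n, NullMeasurableSet (W n) volume) ∧
    Tendsto (fun n => Metric.hausdorffEDist (closure (W n)) {x}) atTop (𝓝 0)

/-- The upper (outer) curvature `κ⁺(x, E)`. -/
def curvPlus (J : Set (RN N) → ℝ≥0∞) (x : RN N) (E : Set (RN N)) : EReal :=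
  ⨅ (W : ℕ → Set (RN N)) (_ : ShrinksTo W x ∧ ∀ n, 0 < volume (W n \ E)),
    liminf (fun n => ((J (E ∪ W n) : EReal) - (J E : EReal)) / (volume (W n \ E) : EReal)) atTop

/-- The lower (inner) curvature `κ⁻(x, E)`. -/
def curvMinus (J : Set (RN N) → ℝ≥0∞) (x : RN N) (E : Set (RN N)) : EReal :=
  ⨆ (W : ℕ → Set (RN N)) (_ : ShrinksTo W x ∧ ∀ n, 0 < volume (W n ∩ E)),
    limsup (fun n => ((J E : EReal) - (J (E \ W n) : EReal)) / (volume (W n ∩ E) : EReal)) atTop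

/-- The curvature of every admissible `C²` set exists (as a real number) at each boundary point,
and it is `κ x E`. -/
def IsCurvatureOf (J : Set (RN N) → ℝ≥0∞) (κ : RN N → Set (RN N) → ℝ) : Prop :=
  ∀ E, IsAdmissibleC2 E → ∀ x ∈ frontier E,
    curvPlus J x E = (κ x E : EReal) ∧ curvMinus J x E = (κ x E : EReal)

/-- Continuity of the curvature with respect to `C²` convergence of sets. -/
def CurvatureContinuous (κ : RN N → Set (RN N) → ℝ) : Prop :=
  ∀ (En : ℕ → Set (RN N)) (E : Set (RN N)) (xn : ℕ → RN N) (x : RN N),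
    (∀ n, IsAdmissibleC2 (En n)) → IsAdmissibleC2 E → TendstoC2 En E →
    (∀ n, xn n ∈ frontier (En n)) → x ∈ frontier E → Tendsto xn atTop (𝓝 x) →
    Tendsto (fun n => κ (xn n) (En n)) atTop (𝓝 (κ x E))

/-- Uniform bound on the curvature of balls and of their complements. -/
def CurvatureBallBound (κ : RN N → Set (RN N) → ℝ) : Prop :=
  ∃ K : ℝ, 0 < K ∧ ∀ ρ : ℝ, 0 < ρ → ∀ x ∈ Metric.sphere (0 : RN N) ρ,
    -K ≤ κ x (Metric.ball 0 ρ) ∧ -K ≤ -κ x (Metric.ball 0 ρ)ᶜ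

/-! ### The nonlinearity -/

/-- `g` is a selection of the inverse of `G` on `(-a, b)`, where `-a` and `b` are the limits of `G`
at `-∞` and `+∞`, extended by `-∞` below and by `+∞` above, with `g 0 = 0`. -/
def IsInverseSelection (G : ℝ → ℝ) (g : EReal → EReal) : Prop :=
  ∃ a b : EReal,
    Tendsto (fun s => (G s : EReal)) atBot (𝓝 (-a)) ∧
    Tendsto (fun s => (G s : EReal)) atTop (𝓝 b) ∧
    g 0 = 0 ∧
    (∀ y : ℝ, -a < (y : EReal) → (y : EReal) < b → ∃ s : ℝ, g y = s ∧ G s = y) ∧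
    (∀ y : EReal, y ≠ 0 → y ≤ -a → g y = ⊥) ∧
    (∀ y : EReal, y ≠ 0 → b ≤ y → g y = ⊤)

/-! ### The incremental problem -/

/-- The functional `J(F) + ∫_{E ∆ F} |g(sd_E / h)| - c |F|`. For bounded `E` the integral is of
higher order than `|F|`, so the value is `+∞` when `|F| = ∞`. -/
def energy (J : Set (RN N) → ℝ≥0∞) (ψ : RN N → ℝ) (g : EReal → EReal) (h c : ℝ)
    (E F : Set (RN N)) : EReal :=
  open Classical in
  if volume F = ⊤ then ⊤ else
    ((J F + ∫⁻ x in symmDiff E F, (g (signedDist ψ E x / (h : EReal))).abs : ℝ≥0∞) : EReal)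
      - ((c * (volume F).toReal : ℝ) : EReal)

/-- `F` minimizes the functional among all measurable sets. -/
def IsMinimizer (J : Set (RN N) → ℝ≥0∞) (ψ : RN N → ℝ) (g : EReal → EReal) (h c : ℝ)
    (E F : Set (RN N)) : Prop :=
  NullMeasurableSet F volume ∧
    ∀ F', NullMeasurableSet F' volume → energy J ψ g h c E F ≤ energy J ψ g h c E F'

/-- `F` is the minimal minimizer (with respect to inclusion up to null sets). -/
def IsMinimalMinimizer (J : Set (RN N) → ℝ≥0∞) (ψ : RN N → ℝ) (g : EReal → EReal) (h c : ℝ)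
    (E F : Set (RN N)) : Prop :=
  IsMinimizer J ψ g h c E F ∧ ∀ F', IsMinimizer J ψ g h c E F' → volume (F \ F') = 0

/-- `F` is the maximal minimizer (with respect to inclusion up to null sets). -/
def IsMaximalMinimizer (J : Set (RN N) → ℝ≥0∞) (ψ : RN N → ℝ) (g : EReal → EReal) (h c : ℝ)
    (E F : Set (RN N)) : Prop :=
  IsMinimizer J ψ g h c E F ∧ ∀ F', IsMinimizer J ψ g h c E F' → volume (F' \ F) = 0

/-- The points of density one of `E`. -/
def densityOne (E : Set (RN N)) : Set (RN N) :=
  {x | Tendsto (fun r : ℝ => volume (E ∩ Metric.ball x r) / volume (Metric.ball x r))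
    (𝓝[>] 0) (𝓝 1)}

/-- One step for bounded sets: the minimal minimizer, represented by its points of density one
(it is unique up to null sets, so the representative does not depend on any choice). -/
def stepBounded (J : Set (RN N) → ℝ≥0∞) (ψ : RN N → ℝ) (g : EReal → EReal) (h c : ℝ)
    (E : Set (RN N)) : Set (RN N) :=
  {x | ∃ F, IsMinimalMinimizer J ψ g h c E F ∧ x ∈ densityOne F}

/-- One step for sets with bounded complement: the complement of the maximal minimizer of the
problem with datum `Eᶜ`, perimeter `F ↦ J(Fᶜ)`, nonlinearity `s ↦ -g(-s)` and forcing `-c`. -/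
def stepUnbounded (J : Set (RN N) → ℝ≥0∞) (ψ : RN N → ℝ) (g : EReal → EReal) (h c : ℝ)
    (E : Set (RN N)) : Set (RN N) :=
  {x | ∃ F, IsMaximalMinimizer (fun A => J Aᶜ) ψ (fun s => -g (-s)) h (-c) Eᶜ F ∧
    x ∈ densityOne Fᶜ}

/-- The averaged forcing: the mean of `f` over `(kh, (k+1)h)`. -/
def meanForcing (f : ℝ → ℝ) (h : ℝ) (k : ℕ) : ℝ :=
  h⁻¹ * ∫ s in (k * h)..((k + 1) * h), f s

/-- The set operator `T_{h,t}`. -/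
def setStep (J : Set (RN N) → ℝ≥0∞) (ψ : RN N → ℝ) (g : EReal → EReal) (f : ℝ → ℝ) (h t : ℝ)
    (E : Set (RN N)) : Set (RN N) :=
  open Classical in
  if Bornology.IsBounded E then stepBounded J ψ g h (meanForcing f h ⌊t / h⌋₊) E
  else stepUnbounded J ψ g h (meanForcing f h ⌊t / h⌋₊) E

/-- The operator `T_{h,t}` on functions: `T u(x) = sup {s : x ∈ T {u ≥ s}}`. -/
def funStep (J : Set (RN N) → ℝ≥0∞) (ψ : RN N → ℝ) (g : EReal → EReal) (f : ℝ → ℝ) (h t : ℝ)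
    (u : RN N → ℝ) (x : RN N) : ℝ :=
  sSup {s : ℝ | x ∈ setStep J ψ g f h t {y | s ≤ u y}}

/-- The iterates: `U_0 = u_0`, `U_{k+1} = T_{h,kh} U_k`. -/
def iterate (J : Set (RN N) → ℝ≥0∞) (ψ : RN N → ℝ) (g : EReal → EReal) (f : ℝ → ℝ)
    (u₀ : RN N → ℝ) (h : ℝ) : ℕ → RN N → ℝ
  | 0 => u₀
  | k + 1 => funStep J ψ g f h (k * h) (iterate J ψ g f u₀ h k)

/-- The discrete solution `u_h(x, t)`, for `t ≥ 0`. -/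
def discreteSol (J : Set (RN N) → ℝ≥0∞) (ψ : RN N → ℝ) (g : EReal → EReal) (f : ℝ → ℝ)
    (u₀ : RN N → ℝ) (h : ℝ) (x : RN N) (t : ℝ) : ℝ :=
  iterate J ψ g f u₀ h ⌊t / h⌋₊ x

/-- `u_h(·, t) = u_0` for `t ∈ [0, h)`. -/
theorem discreteSol_of_lt (J : Set (RN N) → ℝ≥0∞) (ψ : RN N → ℝ) (g : EReal → EReal) (f : ℝ → ℝ)
    (u₀ : RN N → ℝ) (h t : ℝ) (hh : 0 < h) (ht : t < h) (x : RN N) :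
    discreteSol J ψ g f u₀ h x t = u₀ x := by
  have : ⌊t / h⌋₊ = 0 := Nat.floor_eq_zero.2 ((div_lt_one hh).2 ht)
  rw [discreteSol, this, iterate]

/-- `u_h(·, t) = T_{h,t-h} u_h(·, t-h)` for `t ≥ h`. -/
theorem discreteSol_of_le (J : Set (RN N) → ℝ≥0∞) (ψ : RN N → ℝ) (g : EReal → EReal) (f : ℝ → ℝ)
    (u₀ : RN N → ℝ) (h t : ℝ) (hh : 0 < h) (ht : h ≤ t) (x : RN N) :
    discreteSol J ψ g f u₀ h x t =
      funStep J ψ g f h (t - h) (fun y => discreteSol J ψ g f u₀ h y (t - h)) x := by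
  have h1 : (t - h) / h = t / h - 1 := by field_simp
  have h2 : 1 ≤ t / h := (one_le_div hh).2 ht
  have h3 : ⌊t / h⌋₊ = ⌊(t - h) / h⌋₊ + 1 := by
    rw [h1, ← Nat.floor_add_one (by linarith)]; congr 1; ring
  simp only [discreteSol]
  rw [h3, iterate]
  simp only [funStep, setStep]
  rw [mul_div_assoc, div_self hh.ne', mul_one, Nat.floor_natCast]

end MinMov

end

/-! The step operators on sets are monotone, commute with translations, fix the empty set and the
whole space, and move sets with finite speed. All estimates on `u_h` follow from these facts,
applied to superlevel sets.

Put v = g(sd_E / h) - c. For bounded E the incremental energy equals, up to an additive constant,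
J(F) + μ(F) + ν(Fᶜ), where μ and ν have densities v⁺ and v⁻ (`IsNormLike.exists_energy_eq`). No
infinities are subtracted in this form, and complementing F amounts to replacing J by J(·ᶜ) and v by
-v. So bounded data and data with bounded complement lead to the same problem, and `setStep` always
selects its minimal minimizer (`IsNormLike.isStepOp_setStep`). Submodularity, with lower
semicontinuity along monotone sequences, yields existence, extremal minimizers and comparison; J
need not have any compactness.

The speed bounds come from sliding. A minimizer is translated until only a small lens of it lies
outside a ball B, near one boundary point. If the potential on the lens exceeds what the curvature
of B allows, cutting off the lens lowers the energy (`IsMin.volume_sdiff_eq_zero`). The bound K in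
(D) does not depend on the radius, so a bounded set grows by at most Ch per step
(`FlowData.growth`). With the roles of ball and minimizer exchanged, a ball of radius at least r₀
loses at most C(r₀)h (`FlowData.shrink`). Complementation gives the dual statements.

For functions, monotonicity and translation invariance preserve the sup bound and the modulus of
continuity in space, and finite speed keeps `u_h` constant outside a fixed ball up to time T
(`FlowData.evolution_admissible`). Bounds on a ball persist on slowly shrinking balls, which turns
the modulus in space into one in time (`FlowData.evolution_time`). As `u_h` jumps in time,
equicontinuity is only asymptotic, and the limit comes from a variant of Ascoli's theorem
(`exists_subseq_tendstoUniformlyOn`). -/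

noncomputable section

namespace MinMov

variable {N : ℕ}

/-! ### The functional `F ↦ J(F) + μ(F) + ν(Fᶜ)` -/

/-- The functional `J(F) + μ(F) + ν(Fᶜ)`. -/
def functional (J : Set (RN N) → ℝ≥0∞) (μ ν : Measure (RN N)) (F : Set (RN N)) : ℝ≥0∞ :=
  J F + μ F + ν Fᶜ

/-- `F` minimizes the functional, with a finite minimum. -/
structure IsMin (J : Set (RN N) → ℝ≥0∞) (μ ν : Measure (RN N)) (F : Set (RN N)) : Prop where
  meas : NullMeasurableSet F volume
  le : ∀ F', NullMeasurableSet F' volume → functional J μ ν F ≤ functional J μ ν F'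
  ne_top : functional J μ ν F ≠ ⊤

theorem functional_compl (J : Set (RN N) → ℝ≥0∞) (μ ν : Measure (RN N)) (F : Set (RN N)) :
    functional (fun A => J Aᶜ) ν μ Fᶜ = functional J μ ν F := by
  simp only [functional, compl_compl]; ring

theorem IsMin.compl {J : Set (RN N) → ℝ≥0∞} {μ ν : Measure (RN N)} {F : Set (RN N)}
    (h : IsMin J μ ν F) : IsMin (fun A => J Aᶜ) ν μ Fᶜ where
  meas := h.meas.compl
  le F' hF' := by
    rw [functional_compl, ← compl_compl F', functional_compl]
    exact h.le _ hF'.compl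
  ne_top := by rw [functional_compl]; exact h.ne_top

theorem IsC2Set.compl {E : Set (RN N)} (h : IsC2Set E) : IsC2Set Eᶜ := by
  intro x hx
  rw [frontier_compl] at hx
  obtain ⟨φ, h1, h2, h3⟩ := h x hx
  refine ⟨fun y => -φ y, h1.neg, ?_, ?_⟩
  · rw [fderiv_fun_neg]; simpa using h2
  · filter_upwards [h3] with y hy
    refine ⟨fun h => hy.2 (by linarith), fun h => ?_⟩
    simpa using hy.1 (by linarith)

theorem IsAdmissibleC2.compl {E : Set (RN N)} (h : IsAdmissibleC2 E) : IsAdmissibleC2 Eᶜ :=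
  ⟨h.1.compl, by rw [compl_compl]; exact h.2.symm⟩

theorem symmDiff_compl_compl (A B : Set (RN N)) : symmDiff Aᶜ Bᶜ = symmDiff A B := by
  ext x; simp only [mem_symmDiff, mem_compl_iff]; tauto

theorem image_add_compl (z : RN N) (E : Set (RN N)) :
    (fun y => z + y) '' Eᶜ = ((fun y => z + y) '' E)ᶜ := by
  simp [Set.image_add_left]

theorem IsGeneralizedPerimeter.dual {J : Set (RN N) → ℝ≥0∞} (hJ : IsGeneralizedPerimeter J) :
    IsGeneralizedPerimeter (fun A => J Aᶜ) where
  finite_C2 E hE := hJ.finite_C2 _ hE.compl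
  empty := by simpa using hJ.univ
  univ := by simpa using hJ.empty
  congr_ae E F hE hF h := hJ.congr_ae _ _ hE.compl hF.compl (by rwa [symmDiff_compl_compl])
  lsc En E hEn hE h := hJ.lsc _ _ (fun n => (hEn n).compl) hE.compl
    (fun K hK => by simpa only [symmDiff_compl_compl] using h K hK)
  submodular E F hE hF := by
    have := hJ.submodular Eᶜ Fᶜ hE.compl hF.compl
    rw [compl_inter, compl_union, add_comm]; exact this
  translation E z hE := by
    rw [← image_add_compl]; exact hJ.translation _ z hE.compl

section Functional

variable {J : Set (RN N) → ℝ≥0∞} {μ ν μ' ν' : Measure (RN N)}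

theorem functional_congr (hJ : IsGeneralizedPerimeter J) (hμ : μ ≪ volume) (hν : ν ≪ volume)
    {F F' : Set (RN N)} (hF : NullMeasurableSet F volume) (hF' : NullMeasurableSet F' volume)
    (h : F =ᵐ[volume] F') : functional J μ ν F = functional J μ ν F' := by
  unfold functional
  rw [hJ.congr_ae F F' hF hF' (measure_symmDiff_eq_zero_iff.2 h), measure_congr (hμ.ae_eq h),
    measure_congr (hν.ae_eq h.compl)]

theorem IsMin.congr (hJ : IsGeneralizedPerimeter J) (hμ : μ ≪ volume) (hν : ν ≪ volume)
    {F F' : Set (RN N)} (hF : IsMin J μ ν F) (hF' : NullMeasurableSet F' volume)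
    (h : F =ᵐ[volume] F') : IsMin J μ ν F' := by
  have := functional_congr hJ hμ hν hF.meas hF' h
  exact ⟨hF', this ▸ hF.le, this ▸ hF.ne_top⟩

/-- Submodularity of the functional, jointly with its monotonicity in the data. -/
theorem functional_inter_add_union_le (hJ : IsGeneralizedPerimeter J)
    (hμ : μ ≪ volume) (hν' : ν' ≪ volume) (hμμ : μ' ≤ μ) (hνν : ν ≤ ν') {F F' : Set (RN N)}
    (hF : NullMeasurableSet F volume) (hF' : NullMeasurableSet F' volume) :
    functional J μ ν (F ∩ F') + functional J μ' ν' (F ∪ F') ≤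
      functional J μ ν F + functional J μ' ν' F' := by
  have h1 := hJ.submodular F F' hF hF'
  have h2 : μ (F ∩ F') + μ' (F ∪ F') ≤ μ F + μ' F' := by
    have a1 := measure_inter_add_sdiff₀ (μ := μ) F (hF'.mono_ac hμ)
    have a2 : μ' (F ∪ F') ≤ μ' F' + μ' (F \ F') := by
      rw [union_comm, ← union_sdiff_self]; exact measure_union_le _ _
    calc _ ≤ μ (F ∩ F') + (μ' F' + μ (F \ F')) := by gcongr; exact a2.trans (by gcongr)
      _ = _ := by rw [← a1]; ring
  have h3 : ν (F ∩ F')ᶜ + ν' (F ∪ F')ᶜ ≤ ν Fᶜ + ν' F'ᶜ := by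
    have a1 := measure_inter_add_sdiff₀ (μ := ν') F'ᶜ (hF.compl.mono_ac hν')
    have a2 : ν (F ∩ F')ᶜ ≤ ν Fᶜ + ν (F'ᶜ \ Fᶜ) := by
      rw [compl_inter, ← union_sdiff_self]; exact measure_union_le _ _
    calc _ ≤ (ν Fᶜ + ν' (F'ᶜ \ Fᶜ)) + ν' (F'ᶜ ∩ Fᶜ) := by
          gcongr
          · exact a2.trans (by gcongr)
          · rw [compl_union, inter_comm]
      _ = _ := by rw [← a1]; ring
  unfold functional
  calc _ = (J (F ∩ F') + J (F ∪ F')) + (μ (F ∩ F') + μ' (F ∪ F')) +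
        (ν (F ∩ F')ᶜ + ν' (F ∪ F')ᶜ) := by ring
    _ ≤ (J F + J F') + (μ F + μ' F') + (ν Fᶜ + ν' F'ᶜ) := by gcongr
    _ = _ := by ring

/-- In the submodularity inequality neither term on the left can be below the corresponding minimum;
since the minima are finite they cancel, and both terms are minimal. -/
theorem IsMin.inter_union (hJ : IsGeneralizedPerimeter J) (hμ : μ ≪ volume) (hν' : ν' ≪ volume)
    (hμμ : μ' ≤ μ) (hνν : ν ≤ ν') {F F' : Set (RN N)} (hF : IsMin J μ ν F)
    (hF' : IsMin J μ' ν' F') : IsMin J μ ν (F ∩ F') ∧ IsMin J μ' ν' (F ∪ F') := by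
  have h := functional_inter_add_union_le hJ hμ hν' hμμ hνν hF.meas hF'.meas
  have hi := hF.meas.inter hF'.meas
  have hu := hF.meas.union hF'.meas
  have h1 : functional J μ ν (F ∩ F') ≤ functional J μ ν F := by
    have := h.trans' (add_le_add_right (hF'.le _ hu) _)
    exact (ENNReal.add_le_add_iff_right hF'.ne_top).1 this
  have h2 : functional J μ' ν' (F ∪ F') ≤ functional J μ' ν' F' := by
    have := h.trans' (add_le_add_left (hF.le _ hi) _)
    exact (ENNReal.add_le_add_iff_left hF.ne_top).1 this
  exact ⟨⟨hi, fun G hG => h1.trans (hF.le G hG), ne_top_of_le_ne_top hF.ne_top h1⟩,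
    ⟨hu, fun G hG => h2.trans (hF'.le G hG), ne_top_of_le_ne_top hF'.ne_top h2⟩⟩

/-- An increasing sequence converges to its union in L¹_loc, so J is lower semicontinuous along it,
while μ is continuous from below and ν of the complements only decreases. Neither measure has to be
finite. -/
theorem functional_iUnion_le (hJ : IsGeneralizedPerimeter J) {A : ℕ → Set (RN N)}
    (hA : Monotone A) (hm : ∀ j, NullMeasurableSet (A j) volume) {q : ℝ≥0∞}
    (hq : ∀ j, functional J μ ν (A j) ≤ q) : functional J μ ν (⋃ j, A j) ≤ q := by
  rcases eq_or_ne q ⊤ with rfl | hqt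
  · exact le_top
  have hU : NullMeasurableSet (⋃ j, A j) volume := NullMeasurableSet.iUnion hm
  have hl : J (⋃ j, A j) ≤ liminf (fun n => J (A n)) atTop := by
    refine hJ.lsc A _ hm hU fun K hK => ?_
    have h0 : ∀ n, symmDiff (A n) (⋃ j, A j) ∩ K = ((⋃ j, A j) \ A n) ∩ K := fun n => by
      rw [symmDiff_of_le (subset_iUnion A n)]
    have h1 : (⋂ n, ((⋃ j, A j) \ A n) ∩ K) = ∅ := by
      ext x; simp only [mem_iInter, mem_inter_iff, Set.mem_sdiff, mem_iUnion, mem_empty_iff_false,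
        iff_false]
      intro h
      obtain ⟨i, hi⟩ := (h 0).1.1
      exact (h i).1.2 hi
    have := tendsto_measure_iInter_atTop (μ := volume) (s := fun n => ((⋃ j, A j) \ A n) ∩ K)
      (fun n => (hU.diff (hm n)).inter hK.measurableSet.nullMeasurableSet)
      (fun m n hmn => inter_subset_inter_left _ (sdiff_subset_sdiff_right (hA hmn)))
      ⟨0, ne_top_of_le_ne_top hK.measure_lt_top.ne (measure_mono inter_subset_right)⟩
    rw [h1, measure_empty] at this
    simpa only [h0, Function.comp_def] using this
  -- The μ-term is frozen at index i while J passes to the limit; only then i tends to infinity.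
  have key : ∀ i, J (⋃ j, A j) + (μ (A i) + ν (⋃ j, A j)ᶜ) ≤ q := fun i => by
    have hb : ∀ j, i ≤ j → J (A j) + (μ (A i) + ν (⋃ j, A j)ᶜ) ≤ q := fun j hj => by
      refine le_trans ?_ (hq j)
      unfold functional
      rw [add_assoc]
      gcongr
      · exact hA hj
      · exact subset_iUnion A j
    have hc : μ (A i) + ν (⋃ j, A j)ᶜ ≤ q := le_trans le_add_self (hb i le_rfl)
    have : J (⋃ j, A j) ≤ q - (μ (A i) + ν (⋃ j, A j)ᶜ) := by
      refine hl.trans ?_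
      refine liminf_le_of_frequently_le' (Eventually.frequently ?_)
      filter_upwards [eventually_ge_atTop i] with j hj
      exact ENNReal.le_sub_of_add_le_right (ne_top_of_le_ne_top hqt hc) (hb j hj)
    calc _ ≤ (q - (μ (A i) + ν (⋃ j, A j)ᶜ)) + (μ (A i) + ν (⋃ j, A j)ᶜ) := by gcongr
      _ = q := tsub_add_cancel_of_le hc
  have ht : Tendsto (fun i => J (⋃ j, A j) + (μ (A i) + ν (⋃ j, A j)ᶜ)) atTop
      (𝓝 (J (⋃ j, A j) + (μ (⋃ j, A j) + ν (⋃ j, A j)ᶜ))) :=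
    ((tendsto_measure_iUnion_atTop hA).add_const _).const_add _
  have := le_of_tendsto' ht key
  unfold functional
  rwa [add_assoc]

theorem functional_iInter_le (hJ : IsGeneralizedPerimeter J) {A : ℕ → Set (RN N)}
    (hA : Antitone A) (hm : ∀ j, NullMeasurableSet (A j) volume) {q : ℝ≥0∞}
    (hq : ∀ j, functional J μ ν (A j) ≤ q) : functional J μ ν (⋂ j, A j) ≤ q := by
  rw [← functional_compl, compl_iInter]
  refine functional_iUnion_le hJ.dual (fun i j h => compl_subset_compl.2 (hA h))
    (fun j => (hm j).compl) fun j => ?_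
  rw [functional_compl]; exact hq j

/-- Existence of minimizers: the superior limit of a minimizing sequence is a minimizer. -/
theorem exists_isMin (hJ : IsGeneralizedPerimeter J) (hμ : μ ≪ volume) (hν : ν ≪ volume)
    (hfin : ∃ F, NullMeasurableSet F volume ∧ functional J μ ν F < ⊤) : ∃ F, IsMin J μ ν F := by
  set S : Set ℝ≥0∞ := functional J μ ν '' {F | NullMeasurableSet F volume}
  set m := sInf S
  have hm : ∀ F, NullMeasurableSet F volume → m ≤ functional J μ ν F :=
    fun F hF => sInf_le ⟨F, hF, rfl⟩
  have hmt : m ≠ ⊤ := by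
    obtain ⟨F, hF, h⟩ := hfin
    exact ne_top_of_le_ne_top h.ne (hm F hF)
  -- The intersection costs at least m, so submodularity makes the excess over m subadditive under
  -- unions. With excesses 2⁻ⁿ, the union of the tail from n on has excess at most 2 · 2⁻ⁿ.
  have hunion : ∀ F F' a b, NullMeasurableSet F volume → NullMeasurableSet F' volume →
      functional J μ ν F ≤ m + a → functional J μ ν F' ≤ m + b →
      functional J μ ν (F ∪ F') ≤ m + (a + b) := by
    intro F F' a b hF hF' h h'
    have h1 := functional_inter_add_union_le hJ hμ hν le_rfl le_rfl hF hF'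
    have h2 : m + functional J μ ν (F ∪ F') ≤ m + (m + (a + b)) :=
      calc _ ≤ _ := add_le_add_left (hm _ (hF.inter hF')) _
        _ ≤ _ := h1
        _ ≤ (m + a) + (m + b) := add_le_add h h'
        _ = _ := by ring
    exact (ENNReal.add_le_add_iff_left hmt).1 h2
  have hex : ∀ n : ℕ, ∃ F, NullMeasurableSet F volume ∧
      functional J μ ν F ≤ m + (2⁻¹ : ℝ≥0∞) ^ n := fun n => by
    have : m < m + (2⁻¹ : ℝ≥0∞) ^ n := ENNReal.lt_add_right hmt (by simp)
    obtain ⟨_, ⟨F, hF, rfl⟩, h⟩ := sInf_lt_iff.1 this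
    exact ⟨F, hF, h.le⟩
  choose F hF hFm using hex
  have hpart : ∀ n j, NullMeasurableSet (⋃ k ∈ Finset.range (j + 1), F (n + k)) volume ∧
      functional J μ ν (⋃ k ∈ Finset.range (j + 1), F (n + k)) ≤
        m + ∑ k ∈ Finset.range (j + 1), (2⁻¹ : ℝ≥0∞) ^ (n + k) := by
    intro n j
    induction j with
    | zero => simpa using ⟨hF n, hFm n⟩
    | succ j ih =>
      rw [Finset.range_add_one, Finset.set_biUnion_insert, Finset.sum_insert (by simp)]
      exact ⟨(hF _).union ih.1, hunion _ _ _ _ (hF _) ih.1 (hFm _) ih.2⟩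
  set B : ℕ → Set (RN N) := fun n => ⋃ j, ⋃ k ∈ Finset.range (j + 1), F (n + k)
  have hBm : ∀ n, NullMeasurableSet (B n) volume :=
    fun n => NullMeasurableSet.iUnion fun j => (hpart n j).1
  have hB : ∀ n, functional J μ ν (B n) ≤ m + 2 * (2⁻¹ : ℝ≥0∞) ^ n := by
    intro n
    refine functional_iUnion_le hJ ?_ (fun j => (hpart n j).1) fun j => ?_
    · intro i j hij
      refine biUnion_subset_biUnion_left fun k hk => ?_
      exact Finset.mem_range.2 (by have := Finset.mem_range.1 hk; omega)
    · refine (hpart n j).2.trans ?_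
      gcongr
      simp_rw [pow_add, ← Finset.mul_sum]
      rw [mul_comm]
      gcongr
      refine (ENNReal.sum_le_tsum _).trans ?_
      rw [ENNReal.tsum_geometric, ENNReal.one_sub_inv_two, inv_inv]
  have hBmono : Antitone B := by
    intro a b hab x hx
    simp only [B, mem_iUnion, Finset.mem_range] at hx ⊢
    obtain ⟨j, k, hk, hx⟩ := hx
    refine ⟨k + (b - a), k + (b - a), by omega, ?_⟩
    convert hx using 2; omega
  refine ⟨⋂ n, B n, NullMeasurableSet.iInter hBm, fun F' hF' => ?_, ?_⟩
  all_goals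
    have hle : functional J μ ν (⋂ n, B n) ≤ m := by
      have h1 : ∀ n, functional J μ ν (⋂ n, B n) ≤ m + 2 * (2⁻¹ : ℝ≥0∞) ^ n := by
        intro n
        have : (⋂ k, B k) = ⋂ k, B (n + k) := by
          refine subset_antisymm (subset_iInter fun k => iInter_subset _ _)
            (subset_iInter fun k => (iInter_subset _ k).trans (hBmono (by omega)))
        rw [this]
        refine functional_iInter_le hJ (fun a b hab => hBmono (by omega)) (fun k => hBm _)
          fun k => (hB _).trans ?_
        gcongr _ + _ * ?_
        exact pow_le_pow_right_of_le_one' (by simp) (by omega)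
      have h2 : Tendsto (fun n : ℕ => m + 2 * (2⁻¹ : ℝ≥0∞) ^ n) atTop (𝓝 (m + 2 * 0)) :=
        (ENNReal.Tendsto.const_mul
          (ENNReal.tendsto_pow_atTop_nhds_zero_of_lt_one (by simp)) (by simp)).const_add _
      simpa using ge_of_tendsto' h2 h1
  · exact hle.trans (hm F' hF')
  · exact ne_top_of_le_ne_top hmt hle

/-- Existence of a minimal minimizer. -/
theorem exists_isMin_minimal (hJ : IsGeneralizedPerimeter J) (hμ : μ ≪ volume) (hν : ν ≪ volume)
    (hfin : ∃ F, NullMeasurableSet F volume ∧ functional J μ ν F < ⊤) :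
    ∃ F, IsMin J μ ν F ∧ ∀ F', IsMin J μ ν F' → volume (F \ F') = 0 := by
  obtain ⟨F₀, hF₀⟩ := exists_isMin hJ hμ hν hfin
  -- A finite measure with the same null sets as Lebesgue measure serves as a size: a minimizer of
  -- least size is the minimal one.
  set l : Measure (RN N) := (volume : Measure (RN N)).toFinite
  have hl : l ≪ volume := toFinite_absolutelyContinuous _
  have hl' : volume ≪ l := absolutelyContinuous_toFinite _
  set S : Set ℝ≥0∞ := l '' {F | IsMin J μ ν F}
  obtain ⟨u, -, hu, hS⟩ := exists_seq_tendsto_sInf (S := S) ⟨_, F₀, hF₀, rfl⟩ (OrderBot.bddBelow _)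
  choose F hF hFu using hS
  have hpart : ∀ n, IsMin J μ ν (⋂ k ∈ Finset.range (n + 1), F k) := by
    intro n
    induction n with
    | zero => simpa using hF 0
    | succ n ih =>
      rw [Finset.range_add_one, Finset.set_biInter_insert]
      exact ((hF _).inter_union hJ hμ hν le_rfl le_rfl ih).1
  have hsub : ∀ n, (⋂ n, ⋂ k ∈ Finset.range (n + 1), F k) ⊆ F n := fun n =>
    (iInter_subset _ n).trans (biInter_subset_of_mem (by simp))
  have hmin : IsMin J μ ν (⋂ n, ⋂ k ∈ Finset.range (n + 1), F k) := by
    have hle : functional J μ ν (⋂ n, ⋂ k ∈ Finset.range (n + 1), F k) ≤ functional J μ ν F₀ := by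
      refine functional_iInter_le hJ (fun i j hij => ?_) (fun j => (hpart j).meas)
        fun j => (hpart j).le _ hF₀.meas
      refine biInter_subset_biInter_left fun k hk => ?_
      exact Finset.mem_range.2 (by have := Finset.mem_range.1 hk; omega)
    exact ⟨NullMeasurableSet.iInter fun n => (hpart n).meas,
      fun G hG => hle.trans (hF₀.le G hG), ne_top_of_le_ne_top hF₀.ne_top hle⟩
  refine ⟨_, hmin, fun F' hF' => hl' ?_⟩
  set G := ⋂ n, ⋂ k ∈ Finset.range (n + 1), F k
  have h1 := (hmin.inter_union hJ hμ hν le_rfl le_rfl hF').1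
  have h2 : l G ≤ l (G ∩ F') := by
    refine le_trans ?_ (sInf_le (show l (G ∩ F') ∈ S from ⟨_, h1, rfl⟩))
    exact ge_of_tendsto' hu fun n => by rw [← hFu n]; exact measure_mono (hsub n)
  have h3 := measure_inter_add_sdiff₀ (μ := l) G (hF'.meas.mono_ac hl)
  have h4 : l (G ∩ F') + l (G \ F') ≤ l (G ∩ F') + 0 := by rw [h3, add_zero]; exact h2
  exact nonpos_iff_eq_zero.1 ((ENNReal.add_le_add_iff_left (measure_ne_top l _)).1 h4)

/-- Existence of a maximal minimizer. -/
theorem exists_isMin_maximal (hJ : IsGeneralizedPerimeter J) (hμ : μ ≪ volume) (hν : ν ≪ volume)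
    (hfin : ∃ F, NullMeasurableSet F volume ∧ functional J μ ν F < ⊤) :
    ∃ F, IsMin J μ ν F ∧ ∀ F', IsMin J μ ν F' → volume (F' \ F) = 0 := by
  obtain ⟨F, hF, h⟩ := exists_isMin_minimal hJ.dual hν hμ (by
    obtain ⟨F, hF, h⟩ := hfin
    exact ⟨Fᶜ, hF.compl, by rwa [functional_compl]⟩)
  refine ⟨Fᶜ, by simpa using hF.compl, fun F' hF' => ?_⟩
  rw [sdiff_compl, inter_comm, ← sdiff_compl]
  exact h _ hF'.compl

/-- Comparison: a minimal minimizer is contained in every minimizer for smaller data. -/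
theorem IsMin.minimal_subset (hJ : IsGeneralizedPerimeter J) (hμ : μ ≪ volume)
    (hν' : ν' ≪ volume) (hμμ : μ' ≤ μ) (hνν : ν ≤ ν') {F F' : Set (RN N)} (hF : IsMin J μ ν F)
    (hmin : ∀ G, IsMin J μ ν G → volume (F \ G) = 0) (hF' : IsMin J μ' ν' F') :
    volume (F \ F') = 0 := by
  have := hmin _ (hF.inter_union hJ hμ hν' hμμ hνν hF').1
  rwa [sdiff_self_inter] at this

/-- Comparison: a maximal minimizer contains every minimizer for larger data. -/
theorem IsMin.subset_maximal (hJ : IsGeneralizedPerimeter J) (hμ : μ ≪ volume)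
    (hν' : ν' ≪ volume) (hμμ : μ' ≤ μ) (hνν : ν ≤ ν') {F F' : Set (RN N)} (hF : IsMin J μ ν F)
    (hF' : IsMin J μ' ν' F') (hmax : ∀ G, IsMin J μ' ν' G → volume (G \ F') = 0) :
    volume (F \ F') = 0 := by
  have := hmax _ (hF.inter_union hJ hμ hν' hμμ hνν hF').2
  rwa [union_sdiff_right] at this

end Functional

/-! ### Incremental problems with abstract data -/

/-- The measure with density the positive part of `v`. -/
def posMeas (v : RN N → EReal) : Measure (RN N) := volume.withDensity fun x => (v x).toENNReal

/-- The measure with density the negative part of `v`. -/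
def negMeas (v : RN N → EReal) : Measure (RN N) := posMeas fun x => -v x

theorem posMeas_ac (v : RN N → EReal) : posMeas v ≪ volume := withDensity_absolutelyContinuous _ _

theorem negMeas_ac (v : RN N → EReal) : negMeas v ≪ volume := posMeas_ac _

theorem posMeas_apply (v : RN N → EReal) (s : Set (RN N)) :
    posMeas v s = ∫⁻ x in s, (v x).toENNReal := withDensity_apply' _ _

theorem posMeas_mono {v w : RN N → EReal} (h : ∀ x, v x ≤ w x) : posMeas v ≤ posMeas w :=
  withDensity_mono (ae_of_all _ fun x => EReal.toENNReal_le_toENNReal (h x))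

theorem negMeas_anti {v w : RN N → EReal} (h : ∀ x, v x ≤ w x) : negMeas w ≤ negMeas v :=
  posMeas_mono fun x => EReal.neg_le_neg_iff.2 (h x)

theorem negMeas_neg (v : RN N → EReal) : negMeas (fun x => -v x) = posMeas v := by
  simp [negMeas]

theorem le_posMeas {v : RN N → EReal} {s : Set (RN N)} {M : ℝ}
    (hs : NullMeasurableSet s volume) (h : ∀ x ∈ s, (M : EReal) ≤ v x) :
    ENNReal.ofReal M * volume s ≤ posMeas v s := by
  rw [posMeas_apply, ← setLIntegral_const]
  refine lintegral_mono_ae ?_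
  filter_upwards [ae_restrict_mem₀ hs] with x hx
  simpa using EReal.toENNReal_le_toENNReal (h x hx)

theorem posMeas_le {v : RN N → EReal} {s : Set (RN N)} {M : ℝ}
    (hs : NullMeasurableSet s volume) (h : ∀ x ∈ s, v x ≤ (M : EReal)) :
    posMeas v s ≤ ENNReal.ofReal M * volume s := by
  rw [posMeas_apply, ← setLIntegral_const]
  refine lintegral_mono_ae ?_
  filter_upwards [ae_restrict_mem₀ hs] with x hx
  simpa using EReal.toENNReal_le_toENNReal (h x hx)

theorem le_negMeas {v : RN N → EReal} {s : Set (RN N)} {M : ℝ}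
    (hs : NullMeasurableSet s volume) (h : ∀ x ∈ s, v x ≤ ((-M : ℝ) : EReal)) :
    ENNReal.ofReal M * volume s ≤ negMeas v s :=
  le_posMeas hs fun x hx => by
    rw [EReal.le_neg]; simpa using h x hx

theorem negMeas_le {v : RN N → EReal} {s : Set (RN N)} {M : ℝ}
    (hs : NullMeasurableSet s volume) (h : ∀ x ∈ s, ((-M : ℝ) : EReal) ≤ v x) :
    negMeas v s ≤ ENNReal.ofReal M * volume s :=
  posMeas_le hs fun x hx => by
    rw [EReal.neg_le]; simpa using h x hx

/-- A perimeter `J` and potentials `V h c E`, which depend on the time step `h`, the forcing `c` and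
the datum `E`, with the properties used to study the incremental problems. -/
structure FlowData (J : Set (RN N) → ℝ≥0∞) (V : ℝ → ℝ → Set (RN N) → RN N → EReal)
    (Cf K : ℝ) : Prop where
  perim : IsGeneralizedPerimeter J
  K_pos : 0 < K
  Cf_nonneg : 0 ≤ Cf
  curv_ge : ∀ ρ : ℝ, 0 < ρ → ∀ x ∈ Metric.sphere (0 : RN N) ρ,
    ((-K : ℝ) : EReal) ≤ curvPlus J x (Metric.ball 0 ρ)
  curv_le : ∀ ρ : ℝ, 0 < ρ → ∃ C : ℝ, ∀ x ∈ Metric.sphere (0 : RN N) ρ,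
    curvMinus J x (Metric.ball 0 ρ) ≤ (C : EReal)
  anti : ∀ h c E E', 0 < h → E ⊆ E' → ∀ x, V h c E' x ≤ V h c E x
  transl : ∀ h c E z x, V h c ((fun y => z + y) '' E) x = V h c E (x - z)
  far : ∀ M : ℝ, ∃ C : ℝ, 0 < C ∧ ∀ h c E x, 0 < h → |c| ≤ Cf →
    Disjoint (Metric.ball x (C * h)) E → (M : EReal) ≤ V h c E x
  deep : ∀ M : ℝ, ∃ C : ℝ, 0 < C ∧ ∀ h c E x, 0 < h → |c| ≤ Cf →
    Metric.ball x (C * h) ⊆ E → V h c E x ≤ ((-M : ℝ) : EReal)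
  inside : ∀ h c E x, 0 < h → |c| ≤ Cf → x ∈ E → V h c E x ≤ (Cf : EReal)
  outside : ∀ h c E x, 0 < h → |c| ≤ Cf → x ∉ E → ((-Cf : ℝ) : EReal) ≤ V h c E x
  competitor : ∀ h c E, 0 < h → |c| ≤ Cf → Bornology.IsBounded E ∨ Bornology.IsBounded Eᶜ →
    ∃ F, NullMeasurableSet F volume ∧
      functional J (posMeas (V h c E)) (negMeas (V h c E)) F < ⊤

/-- The potentials of the dual problems, satisfied by the complements. -/
def dualV (V : ℝ → ℝ → Set (RN N) → RN N → EReal) (h c : ℝ) (E : Set (RN N)) (x : RN N) : EReal :=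
  -V h (-c) Eᶜ x

/-- `F` solves the incremental problem with potential `V h c E`. -/
def StepMin (J : Set (RN N) → ℝ≥0∞) (V : ℝ → ℝ → Set (RN N) → RN N → EReal) (h c : ℝ)
    (E F : Set (RN N)) : Prop :=
  IsMin J (posMeas (V h c E)) (negMeas (V h c E)) F

/-- `F` is the minimal solution of the incremental problem. -/
def MinimalStep (J : Set (RN N) → ℝ≥0∞) (V : ℝ → ℝ → Set (RN N) → RN N → EReal) (h c : ℝ)
    (E F : Set (RN N)) : Prop :=
  StepMin J V h c E F ∧ ∀ F', StepMin J V h c E F' → volume (F \ F') = 0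

theorem posMeas_dualV (V : ℝ → ℝ → Set (RN N) → RN N → EReal) (h c : ℝ) (E : Set (RN N)) :
    posMeas (dualV V h c E) = negMeas (V h (-c) Eᶜ) := rfl

theorem negMeas_dualV (V : ℝ → ℝ → Set (RN N) → RN N → EReal) (h c : ℝ) (E : Set (RN N)) :
    negMeas (dualV V h c E) = posMeas (V h (-c) Eᶜ) := negMeas_neg _

theorem StepMin.dual {J : Set (RN N) → ℝ≥0∞} {V : ℝ → ℝ → Set (RN N) → RN N → EReal} {h c : ℝ}
    {E F : Set (RN N)} (hF : StepMin J V h c E F) :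
    StepMin (fun A => J Aᶜ) (dualV V) h (-c) Eᶜ Fᶜ := by
  unfold StepMin
  rw [posMeas_dualV, negMeas_dualV, neg_neg, compl_compl]
  exact hF.compl

theorem neg_sub_ereal {a b : EReal} (ha : a ≠ ⊤) (ha' : a ≠ ⊥) : -(a - b) = b - a := by
  rw [EReal.neg_sub (Or.inl ha') (Or.inl ha), sub_eq_add_neg, add_comm]

/-- Adding W to E is removing W from Eᶜ, so the quotients are opposite; finiteness of J(Eᶜ) is what
allows the difference to be negated in `EReal`. -/
theorem curvPlus_dual (J : Set (RN N) → ℝ≥0∞) (x : RN N) (E : Set (RN N)) (hE : J Eᶜ ≠ ⊤) :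
    curvPlus (fun A => J Aᶜ) x E = -curvMinus J x Eᶜ := by
  have key : ∀ W : ℕ → Set (RN N),
      liminf (fun n => ((J (E ∪ W n)ᶜ : EReal) - (J Eᶜ : EReal)) / (volume (W n \ E) : EReal)) atTop
      = -limsup (fun n => ((J Eᶜ : EReal) - (J (Eᶜ \ W n) : EReal)) /
          (volume (W n ∩ Eᶜ) : EReal)) atTop := fun W => by
    rw [← EReal.liminf_neg]
    congr 1
    ext n
    rw [Pi.neg_apply, compl_union, ← sdiff_eq, ← sdiff_eq, div_eq_mul_inv, div_eq_mul_inv,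
      ← EReal.neg_mul, neg_sub_ereal (by simpa using hE) (by simp)]
  unfold curvPlus curvMinus
  refine le_antisymm ?_ ?_
  · rw [EReal.le_neg]
    refine iSup₂_le fun W hW => ?_
    rw [EReal.le_neg, ← key]
    exact iInf₂_le W ⟨hW.1, by simpa only [sdiff_eq] using hW.2⟩
  · refine le_iInf₂ fun W hW => ?_
    rw [key, EReal.neg_le_neg_iff]
    exact le_iSup₂ (f := fun (W : ℕ → Set (RN N))
      (_ : ShrinksTo W x ∧ ∀ n, 0 < volume (W n ∩ Eᶜ)) =>
      limsup (fun n => ((J Eᶜ : EReal) - (J (Eᶜ \ W n) : EReal)) /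
          (volume (W n ∩ Eᶜ) : EReal)) atTop) W ⟨hW.1, by simpa only [sdiff_eq] using hW.2⟩

theorem curvMinus_dual (J : Set (RN N) → ℝ≥0∞) (x : RN N) (E : Set (RN N)) (hE : J Eᶜ ≠ ⊤) :
    curvMinus (fun A => J Aᶜ) x E = -curvPlus J x Eᶜ := by
  have := curvPlus_dual (fun A => J Aᶜ) x Eᶜ (by simpa using hE)
  simp only [compl_compl] at this
  rw [this, neg_neg]

/-! ### Duality, comparison and translation for a single step -/

section StepLemmas

variable {J : Set (RN N) → ℝ≥0∞} {V : ℝ → ℝ → Set (RN N) → RN N → EReal} {Cf K h c : ℝ}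
  {E E' F F' : Set (RN N)}

/-- Complementation exchanges `far` with `deep` and `inside` with `outside`. Only the curvature
bounds do not transfer, because the complement of a ball is not a ball; they are supplied
separately. -/
theorem FlowData.dual (H : FlowData J V Cf K)
    (hge : ∀ ρ : ℝ, 0 < ρ → ∀ x ∈ Metric.sphere (0 : RN N) ρ,
      ((-K : ℝ) : EReal) ≤ curvPlus (fun A => J Aᶜ) x (Metric.ball 0 ρ))
    (hle : ∀ ρ : ℝ, 0 < ρ → ∃ C : ℝ, ∀ x ∈ Metric.sphere (0 : RN N) ρ,
      curvMinus (fun A => J Aᶜ) x (Metric.ball 0 ρ) ≤ (C : EReal)) :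
    FlowData (fun A => J Aᶜ) (dualV V) Cf K where
  perim := H.perim.dual
  K_pos := H.K_pos
  Cf_nonneg := H.Cf_nonneg
  curv_ge := hge
  curv_le := hle
  anti h c E E' hh hE x := EReal.neg_le_neg_iff.2 (H.anti _ _ _ _ hh (compl_subset_compl.2 hE) x)
  transl h c E z x := by
    unfold dualV; rw [← image_add_compl, H.transl]
  far M := by
    obtain ⟨C, hC, h1⟩ := H.deep M
    refine ⟨C, hC, fun h c E x hh hc hd => ?_⟩
    have := h1 h (-c) Eᶜ x hh (by rwa [abs_neg]) hd.subset_compl_right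
    rw [dualV, EReal.le_neg]; simpa using this
  deep M := by
    obtain ⟨C, hC, h1⟩ := H.far M
    refine ⟨C, hC, fun h c E x hh hc hd => ?_⟩
    have := h1 h (-c) Eᶜ x hh (by rwa [abs_neg]) (disjoint_compl_right_iff_subset.2 hd)
    rw [dualV, EReal.neg_le]; simpa using this
  inside h c E x hh hc hx := by
    have := H.outside h (-c) Eᶜ x hh (by rwa [abs_neg]) (by simpa using hx)
    rw [dualV, EReal.neg_le]; simpa using this
  outside h c E x hh hc hx := by
    have := H.inside h (-c) Eᶜ x hh (by rwa [abs_neg]) hx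
    rw [dualV, EReal.le_neg]; simpa using this
  competitor h c E hh hc hE := by
    obtain ⟨F, hF, h1⟩ := H.competitor h (-c) Eᶜ hh (by rwa [abs_neg]) (by
      rw [compl_compl]; exact hE.symm)
    refine ⟨Fᶜ, hF.compl, ?_⟩
    rwa [posMeas_dualV, negMeas_dualV, functional_compl]

theorem FlowData.exists_minimal (H : FlowData J V Cf K) (hh : 0 < h) (hc : |c| ≤ Cf)
    (hE : Bornology.IsBounded E ∨ Bornology.IsBounded Eᶜ) : ∃ F, MinimalStep J V h c E F :=
  exists_isMin_minimal H.perim (posMeas_ac _) (negMeas_ac _) (H.competitor h c E hh hc hE)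

theorem FlowData.exists_maximal (H : FlowData J V Cf K) (hh : 0 < h) (hc : |c| ≤ Cf)
    (hE : Bornology.IsBounded E ∨ Bornology.IsBounded Eᶜ) :
    ∃ F, StepMin J V h c E F ∧ ∀ F', StepMin J V h c E F' → volume (F' \ F) = 0 :=
  exists_isMin_maximal H.perim (posMeas_ac _) (negMeas_ac _) (H.competitor h c E hh hc hE)

theorem FlowData.minimal_subset (H : FlowData J V Cf K) (hh : 0 < h) (hE : E ⊆ E')
    (hF : MinimalStep J V h c E F) (hF' : StepMin J V h c E' F') : volume (F \ F') = 0 :=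
  hF.1.minimal_subset H.perim (posMeas_ac _) (negMeas_ac _)
    (posMeas_mono (H.anti h c E E' hh hE)) (negMeas_anti (H.anti h c E E' hh hE)) hF.2 hF'

theorem FlowData.subset_maximal (H : FlowData J V Cf K) (hh : 0 < h) (hE : E ⊆ E')
    (hF : StepMin J V h c E F) (hF' : StepMin J V h c E' F')
    (hmax : ∀ G, StepMin J V h c E' G → volume (G \ F') = 0) : volume (F \ F') = 0 :=
  hF.subset_maximal H.perim (posMeas_ac _) (negMeas_ac _)
    (posMeas_mono (H.anti h c E E' hh hE)) (negMeas_anti (H.anti h c E E' hh hE)) hF' hmax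

theorem nullMeasurableSet_image_add (z : RN N) {F : Set (RN N)}
    (hF : NullMeasurableSet F volume) : NullMeasurableSet ((fun y => z + y) '' F) volume := by
  rw [Set.image_add_left]
  exact hF.preimage (measurePreserving_add_left volume (-z)).quasiMeasurePreserving

theorem volume_image_add (z : RN N) (F : Set (RN N)) :
    volume ((fun y => z + y) '' F) = volume F := by
  rw [Set.image_add_left, measure_preimage_add]

theorem image_add_image_neg (z : RN N) (F : Set (RN N)) :
    (fun y => z + y) '' ((fun y => -z + y) '' F) = F := by
  rw [image_image]; simp only [add_neg_cancel_left, image_id']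

theorem image_neg_image_add (z : RN N) (F : Set (RN N)) :
    (fun y => -z + y) '' ((fun y => z + y) '' F) = F := by
  rw [image_image]; simp only [neg_add_cancel_left, image_id']

theorem posMeas_image_add (v w : RN N → EReal) (z : RN N) (hv : ∀ x, w x = v (x - z))
    (F : Set (RN N)) :
    posMeas w ((fun y => z + y) '' F) = posMeas v F := by
  have hp := measurePreserving_add_left (volume : Measure (RN N)) z
  have he : MeasurableEmbedding (fun y : RN N => z + y) := measurableEmbedding_addLeft z
  rw [posMeas_apply, posMeas_apply, ← hp.setLIntegral_comp_emb he]
  simp only [hv, add_sub_cancel_left]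

theorem StepMin.translate (H : FlowData J V Cf K) (z : RN N) (hF : StepMin J V h c E F) :
    StepMin J V h c ((fun y => z + y) '' E) ((fun y => z + y) '' F) := by
  have hfun : ∀ (z : RN N) (E F : Set (RN N)), NullMeasurableSet F volume →
      functional J (posMeas (V h c ((fun y => z + y) '' E)))
        (negMeas (V h c ((fun y => z + y) '' E))) ((fun y => z + y) '' F) =
      functional J (posMeas (V h c E)) (negMeas (V h c E)) F := by
    intro z E F hF
    unfold functional
    rw [H.perim.translation F z hF, ← image_add_compl,
      posMeas_image_add _ _ z (H.transl h c E z), negMeas,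
      posMeas_image_add (fun x => -V h c E x) _ z (fun x => by rw [H.transl h c E z])]
    rfl
  refine ⟨nullMeasurableSet_image_add z hF.meas, fun G hG => ?_, ?_⟩
  · rw [hfun z E F hF.meas]
    refine (hF.le ((fun y => -z + y) '' G) (nullMeasurableSet_image_add _ hG)).trans_eq ?_
    rw [← hfun z _ _ (nullMeasurableSet_image_add _ hG)]
    rw [image_add_image_neg]
  · rw [hfun z E F hF.meas]; exact hF.ne_top

theorem MinimalStep.translate (H : FlowData J V Cf K) (z : RN N) (hF : MinimalStep J V h c E F) :
    MinimalStep J V h c ((fun y => z + y) '' E) ((fun y => z + y) '' F) := by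
  refine ⟨hF.1.translate H z, fun G hG => ?_⟩
  have h1 := hF.2 ((fun y => -z + y) '' G) (by
    have := hG.translate H (-z)
    rwa [image_neg_image_add] at this)
  rw [← volume_image_add z, image_sdiff (add_right_injective z)] at h1
  rwa [image_add_image_neg] at h1

end StepLemmas

/-! ### Dilations and boundedness of minimizers -/

/-- If all small translates of `A` are contained in `F`, then so are the balls around the points of
the support of `A`. -/
theorem volume_ball_sdiff_eq_zero {A F : Set (RN N)} (hA : NullMeasurableSet A volume)
    (hF : NullMeasurableSet F volume) {δ : ℝ}
    (h : ∀ z : RN N, ‖z‖ < δ → volume (((fun y => z + y) '' A) \ F) = 0) {y : RN N}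
    (hy : y ∈ (volume.restrict A).support) : volume (Metric.ball y δ \ F) = 0 := by
  obtain ⟨A', hA's, hA'm, hA'e⟩ := hA.exists_measurable_subset_ae_eq
  obtain ⟨M, hMs, hMm, hMe⟩ := (measurableSet_ball (x := y) (ε := δ)).nullMeasurableSet.diff hF
    |>.exists_measurable_subset_ae_eq
  rw [← measure_congr hMe]
  set S : Set (RN N × RN N) := {p | p.1 ∈ M ∧ p.1 - p.2 ∈ A' ∧ p.2 ∈ Metric.ball 0 δ}
  have hS : MeasurableSet S :=
    (measurable_fst hMm).inter (((measurable_fst.sub measurable_snd) hA'm).inter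
      (measurable_snd measurableSet_ball))
  -- Fubini: the slices of S at fixed z are null by hypothesis. Hence for almost every w in M the
  -- slice over w is null, but that slice has the measure of A' ∩ B(w, δ), which is positive because
  -- y is a support point in B(w, δ).
  have h0 : (volume.prod volume : Measure (RN N × RN N)) S = 0 := by
    rw [Measure.prod_apply_symm hS]
    refine (lintegral_congr fun z => ?_).trans lintegral_zero
    by_cases hz : ‖z‖ < δ
    · refine measure_mono_null ?_ (h z hz)
      rintro w ⟨hw, hwz, -⟩
      exact ⟨⟨w - z, hA's hwz, by simp⟩, (hMs hw).2⟩
    · convert measure_empty (μ := (volume : Measure (RN N)))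
      ext w
      simp only [S, mem_preimage, Set.mem_ofPred_eq, mem_ball_zero_iff, hz, and_false,
        mem_empty_iff_false]
  have h1 := (Measure.measure_prod_null hS).1 h0
  refine measure_eq_zero_iff_ae_notMem.2 ?_
  filter_upwards [h1] with w hw hwM
  have hyw : Metric.ball w δ ∈ 𝓝 y :=
    Metric.isOpen_ball.mem_nhds (by rw [Metric.mem_ball']; exact (hMs hwM).1)
  have hpos := (Measure.mem_support_iff_forall y).1 hy _ hyw
  rw [Measure.restrict_apply measurableSet_ball,
    ← measure_congr ((ae_eq_refl _).inter hA'e)] at hpos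
  have h2 := (Measure.measurePreserving_sub_left (volume : Measure (RN N)) w).measure_preimage
    (measurableSet_ball.inter hA'm : MeasurableSet (Metric.ball w δ ∩ A')).nullMeasurableSet
  rw [← h2] at hpos
  refine hpos.ne' (measure_mono_null (fun z hz => ?_) hw)
  refine ⟨hwM, hz.2, ?_⟩
  have := hz.1
  simpa [dist_eq_norm] using this

theorem volume_ne_top_of_posMeas {v : RN N → EReal} {F : Set (RN N)} {R : ℝ}
    (hF : NullMeasurableSet F volume) (hv : ∀ x, R < ‖x‖ → ((1 : ℝ) : EReal) ≤ v x)
    (h : posMeas v F ≠ ⊤) : volume F ≠ ⊤ := by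
  have h1 : volume (F \ Metric.closedBall 0 R) ≤ posMeas v F := by
    have := le_posMeas (v := v) (s := F \ Metric.closedBall 0 R) (M := 1)
      (hF.diff measurableSet_closedBall.nullMeasurableSet) fun x hx => hv x (by simpa using hx.2)
    rw [ENNReal.ofReal_one, one_mul] at this
    exact this.trans (measure_mono sdiff_subset)
  have h2 : volume (F ∩ Metric.closedBall 0 R) ≠ ⊤ :=
    ne_top_of_le_ne_top measure_closedBall_lt_top.ne (measure_mono inter_subset_right)
  rw [← measure_inter_add_sdiff F measurableSet_closedBall]
  exact ENNReal.add_ne_top.2 ⟨h2, ne_top_of_le_ne_top h h1⟩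

theorem IsMin.perim_ne_top {J : Set (RN N) → ℝ≥0∞} {μ ν : Measure (RN N)} {F : Set (RN N)}
    (hF : IsMin J μ ν F) : J F ≠ ⊤ :=
  ne_top_of_le_ne_top hF.ne_top (by unfold functional; rw [add_assoc]; exact le_self_add)

theorem IsMin.left_ne_top {J : Set (RN N) → ℝ≥0∞} {μ ν : Measure (RN N)} {F : Set (RN N)}
    (hF : IsMin J μ ν F) : μ F ≠ ⊤ :=
  ne_top_of_le_ne_top hF.ne_top (by unfold functional; rw [add_right_comm]; exact le_add_self)

theorem IsMin.right_ne_top {J : Set (RN N) → ℝ≥0∞} {μ ν : Measure (RN N)} {F : Set (RN N)}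
    (hF : IsMin J μ ν F) : ν Fᶜ ≠ ⊤ :=
  ne_top_of_le_ne_top hF.ne_top (by unfold functional; exact le_add_self)

theorem disjoint_ball_of_subset_closedBall {E : Set (RN N)} {R r : ℝ} {x : RN N}
    (hE : E ⊆ Metric.closedBall 0 R) (hx : R + r ≤ ‖x‖) : Disjoint (Metric.ball x r) E := by
  rw [Set.disjoint_left]
  intro y hy hyE
  have h1 := hE hyE
  rw [mem_closedBall_zero_iff] at h1
  rw [mem_ball_iff_norm'] at hy
  have := norm_sub_norm_le x y
  linarith

section Bounds

variable {J : Set (RN N) → ℝ≥0∞} {V : ℝ → ℝ → Set (RN N) → RN N → EReal} {Cf K h c : ℝ}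
  {E E' F F' : Set (RN N)}

/-- A qualitative bound, which provides the farthest point needed in `FlowData.growth`. All
translates of F by vectors shorter than 1 lie in the maximal solution F' for the thickened datum, so
a support point of F puts its unit ball into F'. As F' has finite volume, this is impossible far
out. -/
theorem FlowData.exists_volume_sdiff_closedBall_eq_zero (H : FlowData J V Cf K) (hh : 0 < h)
    (hc : |c| ≤ Cf) (hE : Bornology.IsBounded E) (hF : StepMin J V h c E F) :
    ∃ R, volume (F \ Metric.closedBall 0 R) = 0 := by
  have hE' : Bornology.IsBounded (Metric.thickening 1 E) := hE.thickening
  obtain ⟨F', hF', hmax⟩ := H.exists_maximal hh hc (Or.inl hE')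
  obtain ⟨R, hR⟩ := hE'.subset_closedBall 0
  obtain ⟨C, hC, hfar⟩ := H.far 1
  have hfin : volume F' ≠ ⊤ := volume_ne_top_of_posMeas (R := R + C * h) hF'.meas
    (fun x hx => hfar h c _ x hh hc (disjoint_ball_of_subset_closedBall hR hx.le)) hF'.left_ne_top
  have hint : (⋂ n : ℕ, F' \ Metric.closedBall 0 (n : ℝ)) = ∅ := by
    ext x
    simp only [mem_iInter, Set.mem_sdiff, mem_closedBall_zero_iff, mem_empty_iff_false, iff_false,
      not_forall, not_and, not_not]
    obtain ⟨n, hn⟩ := exists_nat_ge ‖x‖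
    exact ⟨n, fun _ => hn⟩
  have ht := tendsto_measure_iInter_atTop (μ := volume)
    (s := fun n : ℕ => F' \ Metric.closedBall 0 (n : ℝ))
    (fun n => hF'.meas.diff measurableSet_closedBall.nullMeasurableSet)
    (fun m n hmn => sdiff_subset_sdiff_right
      (Metric.closedBall_subset_closedBall (by exact_mod_cast hmn)))
    ⟨0, ne_top_of_le_ne_top hfin (measure_mono sdiff_subset)⟩
  rw [hint, measure_empty] at ht
  obtain ⟨n, hn⟩ := (ht.eventually (gt_mem_nhds
    (Metric.measure_ball_pos volume (0 : RN N) one_pos))).exists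
  refine ⟨n + 1, by_contra fun hne => ?_⟩
  have hpos : 0 < volume.restrict F (Metric.closedBall (0 : RN N) (n + 1))ᶜ := by
    rw [Measure.restrict_apply measurableSet_closedBall.compl, inter_comm, ← sdiff_eq]
    exact pos_iff_ne_zero.2 hne
  obtain ⟨y, hy, hys⟩ := Measure.nonempty_inter_support_of_pos hpos
  have h1 : volume (Metric.ball y 1 \ F') = 0 := by
    refine volume_ball_sdiff_eq_zero hF.meas hF'.meas (fun z hz => ?_) hys
    refine H.subset_maximal hh ?_ (hF.translate H z) hF' hmax
    rintro _ ⟨w, hw, rfl⟩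
    exact Metric.mem_thickening_iff.2 ⟨w, hw, by simpa [dist_eq_norm] using hz⟩
  have h2 : volume (Metric.ball y 1) ≤ volume (F' \ Metric.closedBall 0 (n : ℝ)) := by
    rw [← measure_inter_add_sdiff₀ (Metric.ball y 1) hF'.meas, h1, add_zero]
    refine measure_mono fun w hw => ⟨hw.2, fun hw' => hy ?_⟩
    have := hw.1
    rw [mem_closedBall_zero_iff] at hw' ⊢
    rw [mem_ball_iff_norm'] at this
    have := norm_sub_norm_le y w
    linarith
  rw [Measure.addHaar_ball_center] at h2
  exact absurd hn (not_lt.2 h2)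

end Bounds

/-! ### Touching balls -/

/-- A ball of radius r, touching the ball of radius ρ from inside at ρν, is pushed outwards by ε.
What sticks out is a lens of size O(√(rε)) around ρν, since r ≤ ρ/2 keeps the curvatures of the two
spheres apart. -/
theorem norm_sub_sq_le_of_lens {ν y : RN N} (hν : ‖ν‖ = 1) {r ρ ε : ℝ} (hr : 0 < r)
    (hρ : r ≤ ρ / 2) (hε : 0 < ε) (hεr : ε ≤ r) (hy : ‖y - (ρ - r + ε) • ν‖ ≤ r) (hyρ : ρ ≤ ‖y‖) :
    ‖y - ρ • ν‖ ^ 2 ≤ 4 * r * ε := by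
  set s := ρ - r + ε with hs
  set t : ℝ := inner ℝ y ν
  have e1 : ∀ a : ℝ, ‖y - a • ν‖ ^ 2 = ‖y‖ ^ 2 - 2 * a * t + a ^ 2 := fun a => by
    rw [norm_sub_sq_real, norm_smul, hν, inner_smul_right, mul_one, Real.norm_eq_abs, sq_abs]; ring
  have h1 : ‖y‖ ^ 2 - 2 * s * t + s ^ 2 ≤ r ^ 2 := by
    rw [← e1]; exact pow_le_pow_left₀ (norm_nonneg _) hy 2
  have h2 : ρ ^ 2 ≤ ‖y‖ ^ 2 := pow_le_pow_left₀ (by linarith) hyρ 2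
  rw [e1]
  have hs0 : 0 < s := by linarith
  have h3 : s * (‖y‖ ^ 2 - 2 * ρ * t + ρ ^ 2) ≤ ρ * (2 * r * ε - ε ^ 2) := by
    have a1 : ρ * (‖y‖ ^ 2 + s ^ 2 - r ^ 2) ≤ ρ * (2 * s * t) :=
      mul_le_mul_of_nonneg_left (by linarith) (by linarith)
    have a2 : (r - ε) * ρ ^ 2 ≤ (r - ε) * ‖y‖ ^ 2 := mul_le_mul_of_nonneg_left h2 (by linarith)
    have a3 : r - ε = ρ - s := by rw [hs]; ring
    have a4 : ρ * (2 * r * ε - ε ^ 2) = ρ * (r ^ 2 - (ρ - s) ^ 2) := by rw [← a3]; ring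
    rw [a4]
    rw [a3] at a2
    nlinarith
  have h4 : ρ * (2 * r * ε - ε ^ 2) ≤ s * (4 * r * ε) := by
    have : 0 < r * ε := mul_pos hr hε
    nlinarith [sq_nonneg ε, mul_nonneg (show 0 ≤ ρ by linarith) (sq_nonneg ε)]
  exact le_of_mul_le_mul_left (h3.trans h4) hs0

theorem shrinksTo_of_subset_closedBall {W : ℕ → Set (RN N)} {x : RN N} {r : ℕ → ℝ}
    (hm : ∀ n, NullMeasurableSet (W n) volume) (hne : ∀ n, (W n).Nonempty)
    (hW : ∀ n, W n ⊆ Metric.closedBall x (r n)) (hr : Tendsto r atTop (𝓝 0)) : ShrinksTo W x := by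
  refine ⟨hm, ?_⟩
  have h1 : Tendsto (fun n => ENNReal.ofReal (r n)) atTop (𝓝 0) := by
    simpa [Function.comp_def] using (ENNReal.continuous_ofReal.tendsto 0).comp hr
  refine tendsto_of_tendsto_of_tendsto_of_le_of_le tendsto_const_nhds h1 (fun n => zero_le)
    fun n => ?_
  have hd : ∀ y ∈ W n, edist y x ≤ ENNReal.ofReal (r n) := fun y hy => by
    rw [edist_dist]; exact ENNReal.ofReal_le_ofReal (hW n hy)
  rw [Metric.hausdorffEDist_closure_left]
  refine Metric.hausdorffEDist_le_of_mem_edist (fun y hy => ⟨x, rfl, hd y hy⟩) ?_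
  rintro _ rfl
  obtain ⟨y, hy⟩ := hne n
  exact ⟨y, hy, by rw [edist_comm]; exact hd y hy⟩

/-- The curvature bound in subtraction-free form. The slack between K and K' absorbs the lower
limit, and truncating K' at zero only weakens the inequality. -/
theorem eventually_le_of_le_curvPlus {J : Set (RN N) → ℝ≥0∞} {x : RN N} {B : Set (RN N)} {K K' : ℝ}
    (hJ : J B ≠ ⊤) (hK : ((-K : ℝ) : EReal) ≤ curvPlus J x B) (hKK : K < K')
    {W : ℕ → Set (RN N)} (hW : ShrinksTo W x) (hpos : ∀ n, 0 < volume (W n \ B))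
    (hfin : ∀ n, volume (W n \ B) ≠ ⊤) :
    ∀ᶠ n in atTop, J B ≤ J (B ∪ W n) + ENNReal.ofReal K' * volume (W n \ B) := by
  have h1 : ((-K' : ℝ) : EReal) < liminf (fun n => ((J (B ∪ W n) : EReal) - (J B : EReal)) /
      (volume (W n \ B) : EReal)) atTop := by
    refine lt_of_lt_of_le ?_ (hK.trans (iInf₂_le W ⟨hW, hpos⟩))
    exact_mod_cast neg_lt_neg hKK
  filter_upwards [eventually_lt_of_lt_liminf h1] with n hn
  have hm := hpos n
  have hf := hfin n
  generalize volume (W n \ B) = m at hn hm hf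
  generalize J B = a at hn hJ ⊢
  generalize J (B ∪ W n) = b at hn ⊢
  rcases eq_or_ne b ⊤ with rfl | hb
  · simp
  lift a to NNReal using hJ
  lift b to NNReal using hb
  lift m to NNReal using hf
  have hm' : (0 : ℝ) < m := by exact_mod_cast hm
  simp only [EReal.coe_nnreal_eq_coe_real, ← EReal.coe_sub, ← EReal.coe_div,
    EReal.coe_lt_coe_iff] at hn
  rw [lt_div_iff₀ hm'] at hn
  change (a : ℝ≥0∞) ≤ b + (K'.toNNReal : ℝ≥0∞) * m
  norm_cast
  rw [← NNReal.coe_le_coe]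
  push_cast
  nlinarith [Real.le_coe_toNNReal K', Real.coe_toNNReal' K', le_max_left K' 0]

theorem eventually_le_of_curvMinus_le {J : Set (RN N) → ℝ≥0∞} {x : RN N} {B : Set (RN N)} {K K' : ℝ}
    (hJ : J B ≠ ⊤) (hK : curvMinus J x B ≤ (K : EReal)) (hKK : K < K')
    {W : ℕ → Set (RN N)} (hW : ShrinksTo W x) (hpos : ∀ n, 0 < volume (W n ∩ B))
    (hfin : ∀ n, volume (W n ∩ B) ≠ ⊤) :
    ∀ᶠ n in atTop, J B ≤ J (B \ W n) + ENNReal.ofReal K' * volume (W n ∩ B) := by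
  have h1 : limsup (fun n => ((J B : EReal) - (J (B \ W n) : EReal)) /
      (volume (W n ∩ B) : EReal)) atTop < (K' : EReal) := by
    refine lt_of_le_of_lt (le_trans ?_ hK) (by exact_mod_cast hKK)
    exact le_iSup₂ (f := fun (W : ℕ → Set (RN N))
      (_ : ShrinksTo W x ∧ ∀ n, 0 < volume (W n ∩ B)) =>
      limsup (fun n => ((J B : EReal) - (J (B \ W n) : EReal)) /
          (volume (W n ∩ B) : EReal)) atTop) W ⟨hW, hpos⟩
  filter_upwards [eventually_lt_of_limsup_lt h1] with n hn
  have hm := hpos n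
  have hf := hfin n
  generalize volume (W n ∩ B) = m at hn hm hf
  generalize J B = a at hn hJ ⊢
  generalize J (B \ W n) = b at hn ⊢
  rcases eq_or_ne b ⊤ with rfl | hb
  · simp
  lift a to NNReal using hJ
  lift b to NNReal using hb
  lift m to NNReal using hf
  have hm' : (0 : ℝ) < m := by exact_mod_cast hm
  simp only [EReal.coe_nnreal_eq_coe_real, ← EReal.coe_sub, ← EReal.coe_div,
    EReal.coe_lt_coe_iff] at hn
  rw [div_lt_iff₀ hm'] at hn
  change (a : ℝ≥0∞) ≤ b + (K'.toNNReal : ℝ≥0∞) * m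
  norm_cast
  rw [← NNReal.coe_le_coe]
  push_cast
  nlinarith [Real.le_coe_toNNReal K', Real.coe_toNNReal' K', le_max_left K' 0]

/-- A minimizer which sticks out of `B` only where the potential is larger than the curvature of
`B` is contained in `B`. -/
theorem IsMin.volume_sdiff_eq_zero {J : Set (RN N) → ℝ≥0∞} (hJ : IsGeneralizedPerimeter J)
    {v : RN N → EReal} {G B : Set (RN N)} (hG : IsMin J (posMeas v) (negMeas v) G)
    (hB : NullMeasurableSet B volume) (hJB : J B ≠ ⊤) {k M : ℝ} (hk : 0 ≤ k) (hkM : k < M)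
    (hfin : volume (G \ B) ≠ ⊤)
    (hle : J B ≤ J (B ∪ G) + ENNReal.ofReal k * volume (G \ B))
    (hv : ∀ x ∈ G \ B, (M : EReal) ≤ v x) : volume (G \ B) = 0 := by
  set w := volume (G \ B)
  have hGB := hG.meas.diff hB
  have hs := hJ.submodular G B hG.meas hB
  have hU : J (G ∪ B) ≠ ⊤ := ne_top_of_le_ne_top
    (ENNReal.add_ne_top.2 ⟨hG.perim_ne_top, hJB⟩) (le_add_self.trans hs)
  -- Submodularity carries the curvature estimate for B ∪ G over to G ∩ B: cutting G down to B
  -- raises J by at most k|G \ B|, whereas the potential terms drop by at least M|G \ B|.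
  have h1 : J (G ∩ B) ≤ J G + ENNReal.ofReal k * w := by
    refine (ENNReal.add_le_add_iff_right hU).1 (hs.trans ?_)
    calc J G + J B ≤ J G + (J (B ∪ G) + ENNReal.ofReal k * w) := by gcongr
      _ = _ := by rw [union_comm]; ring
  have h2 : negMeas v (G ∩ B)ᶜ ≤ negMeas v Gᶜ := by
    have e : (G ∩ B)ᶜ ⊆ Gᶜ ∪ (G \ B) := fun x hx => by
      by_cases hxG : x ∈ G
      · exact Or.inr ⟨hxG, fun hxB => hx ⟨hxG, hxB⟩⟩
      · exact Or.inl hxG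
    have e2 : negMeas v (G \ B) ≤ ENNReal.ofReal 0 * volume (G \ B) :=
      negMeas_le hGB fun x hx => le_trans (by exact_mod_cast (by linarith : -0 ≤ M)) (hv x hx)
    rw [ENNReal.ofReal_zero, zero_mul] at e2
    refine (measure_mono e).trans ((measure_union_le _ _).trans ?_)
    rw [nonpos_iff_eq_zero.1 e2, add_zero]
  have h3 : posMeas v (G ∩ B) + ENNReal.ofReal M * w ≤ posMeas v G := by
    rw [← measure_inter_add_sdiff₀ G (hB.mono_ac (posMeas_ac v))]
    gcongr
    exact le_posMeas hGB hv
  have h4 := hG.le _ (hG.meas.inter hB)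
  have h5 : posMeas v (G ∩ B) ≠ ⊤ :=
    ne_top_of_le_ne_top hG.left_ne_top (measure_mono inter_subset_left)
  have h6 : (J G + posMeas v (G ∩ B) + negMeas v Gᶜ) + ENNReal.ofReal M * w ≤
      (J G + posMeas v (G ∩ B) + negMeas v Gᶜ) + ENNReal.ofReal k * w :=
    calc _ = J G + (posMeas v (G ∩ B) + ENNReal.ofReal M * w) + negMeas v Gᶜ := by ring
      _ ≤ functional J (posMeas v) (negMeas v) G := by unfold functional; gcongr
      _ ≤ _ := h4
      _ ≤ (J G + ENNReal.ofReal k * w) + posMeas v (G ∩ B) + negMeas v Gᶜ := by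
        unfold functional; gcongr
      _ = _ := by ring
  have h7 := (ENNReal.add_le_add_iff_left (ENNReal.add_ne_top.2
    ⟨ENNReal.add_ne_top.2 ⟨hG.perim_ne_top, h5⟩, hG.right_ne_top⟩)).1 h6
  by_contra hw
  have h8 := (ENNReal.mul_le_mul_iff_left hw hfin).1 h7
  rw [ENNReal.ofReal_le_ofReal_iff hk] at h8
  linarith

/-- The previous argument for the complements, with J(·ᶜ) and the opposite potential. -/
theorem IsMin.volume_sdiff_eq_zero_of_inner {J : Set (RN N) → ℝ≥0∞} (hJ : IsGeneralizedPerimeter J)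
    {v : RN N → EReal} {G B : Set (RN N)} (hG : IsMin J (posMeas v) (negMeas v) G)
    (hB : NullMeasurableSet B volume) (hJB : J B ≠ ⊤) {k M : ℝ} (hk : 0 ≤ k) (hkM : k < M)
    (hfin : volume (B \ G) ≠ ⊤)
    (hle : J B ≤ J (B ∩ G) + ENNReal.ofReal k * volume (B \ G))
    (hv : ∀ x ∈ B \ G, v x ≤ ((-M : ℝ) : EReal)) : volume (B \ G) = 0 := by
  have e : Gᶜ \ Bᶜ = B \ G := by ext; simp [and_comm]
  have h := IsMin.volume_sdiff_eq_zero (v := fun x => -v x) (G := Gᶜ) (B := Bᶜ) hJ.dual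
    (by rw [negMeas_neg]; exact hG.compl) hB.compl (by simpa using hJB) hk hkM (by rwa [e])
    (by simpa [e] using hle) (fun x hx => by
      rw [e] at hx
      rw [EReal.le_neg]; simpa using hv x hx)
  rwa [e] at h

theorem isAdmissibleC2_ball (p : RN N) {ρ : ℝ} (hρ : 0 < ρ) :
    IsAdmissibleC2 (Metric.ball p ρ) := by
  refine ⟨fun x hx => ?_, Or.inl Metric.isBounded_ball⟩
  have hx' : ‖x - p‖ = ρ := by
    have := Metric.frontier_ball_subset_sphere hx
    simpa [dist_eq_norm] using this
  refine ⟨fun y => ‖y - p‖ ^ 2 - ρ ^ 2, ?_, ?_, Eventually.of_forall fun y => ⟨fun h => ?_,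
    fun h h' => ?_⟩⟩
  · exact ((contDiff_id.sub contDiff_const).norm_sq ℝ).contDiffAt.sub contDiffAt_const
  · have h1 : HasFDerivAt (fun y : RN N => ‖y - p‖ ^ 2 - ρ ^ 2) _ x :=
      ((hasFDerivAt_id x).sub_const p).norm_sq.sub_const (ρ ^ 2)
    rw [h1.fderiv]
    intro h0
    have h2 := congrArg (fun L : RN N →L[ℝ] ℝ => L (x - p)) h0
    simp [-map_sub, hx', hρ.ne'] at h2
  · rw [mem_ball_iff_norm]
    exact lt_of_pow_lt_pow_left₀ 2 hρ.le (by linarith)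
  · rw [mem_ball_iff_norm] at h'
    have := pow_lt_pow_left₀ h' (norm_nonneg _) two_ne_zero
    linarith

theorem IsGeneralizedPerimeter.ball_ne_top {J : Set (RN N) → ℝ≥0∞} (hJ : IsGeneralizedPerimeter J)
    (p : RN N) {ρ : ℝ} (hρ : 0 < ρ) : J (Metric.ball p ρ) ≠ ⊤ :=
  (hJ.finite_C2 _ (isAdmissibleC2_ball p hρ)).ne

theorem tendsto_const_div_nat_add_one (r : ℝ) :
    Tendsto (fun n : ℕ => r / ((n : ℝ) + 1)) atTop (𝓝 0) := by
  simpa [div_eq_mul_inv] using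
    (tendsto_one_div_add_atTop_nhds_zero_nat (𝕜 := ℝ)).const_mul r

theorem div_nat_add_one_mem {r : ℝ} (hr : 0 < r) (n : ℕ) :
    0 < r / ((n : ℝ) + 1) ∧ r / ((n : ℝ) + 1) ≤ r :=
  ⟨by positivity, div_le_self hr.le (by linarith [n.cast_nonneg (α := ℝ)])⟩

/-! ### Speed bounds for bounded sets and for balls -/

section Evolution

variable {J : Set (RN N) → ℝ≥0∞} {V : ℝ → ℝ → Set (RN N) → RN N → EReal} {Cf K : ℝ}

/-- A bounded set grows at most with bounded speed. -/
theorem FlowData.growth (H : FlowData J V Cf K) : ∃ C, 0 < C ∧ ∀ h c E F R, 0 < h → |c| ≤ Cf →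
    0 ≤ R → E ⊆ Metric.closedBall 0 R → StepMin J V h c E F →
    volume (F \ Metric.closedBall 0 (R + C * h)) = 0 := by
  obtain ⟨C, hC, hfar⟩ := H.far (K + 1)
  refine ⟨C, hC, fun h c E F R hh hc hR hE hF => by_contra fun hne => ?_⟩
  obtain ⟨R₁, hR₁⟩ := H.exists_volume_sdiff_closedBall_eq_zero hh hc
    (Metric.isBounded_closedBall.subset hE) hF
  have hrestr : ∀ s, volume.restrict F (Metric.closedBall (0 : RN N) s)ᶜ =
      volume (F \ Metric.closedBall 0 s) := fun s => by
    rw [Measure.restrict_apply measurableSet_closedBall.compl, inter_comm, ← sdiff_eq]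
  set S := (volume.restrict F).support with hS
  have hSsub : S ⊆ Metric.closedBall 0 R₁ :=
    Measure.support_subset_of_isClosed Metric.isClosed_closedBall
      (by rw [mem_ae_iff, hrestr, hR₁])
  have hScpt : IsCompact S :=
    (isCompact_closedBall 0 R₁).of_isClosed_subset Measure.isClosed_support hSsub
  obtain ⟨y, hy, hyS⟩ := Measure.nonempty_inter_support_of_pos (μ := volume.restrict F)
    (by rw [hrestr]; exact pos_iff_ne_zero.2 hne)
  -- The farthest point x of the support of F has norm r > R + C h, and F is contained in the closed
  -- ball of radius r up to a null set.
  obtain ⟨x, hxS, hx⟩ := hScpt.exists_isMaxOn ⟨y, hyS⟩ continuous_norm.continuousOn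
  have hyx : ‖y‖ ≤ ‖x‖ := hx hyS
  rw [mem_compl_iff, mem_closedBall_zero_iff, not_le] at hy
  set r := ‖x‖ with hr
  have hxR : R + C * h < r := hy.trans_le hyx
  have hr0 : 0 < r := by have := mul_pos hC hh; linarith
  have hF0 : volume (F \ Metric.closedBall 0 r) = 0 := by
    rw [← hrestr]
    refine measure_mono_null (compl_subset_compl.2 fun z hz => ?_)
      (Measure.measure_compl_support (μ := volume.restrict F))
    rw [mem_closedBall_zero_iff]; exact hx hz
  have hae : (F ∩ Metric.closedBall 0 r : Set (RN N)) =ᵐ[volume] F := by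
    rw [← Set.sdiff_sdiff_right_self]
    exact sdiff_null_ae_eq_self hF0
  set F₀ := F ∩ Metric.closedBall 0 r
  have hF₀ : StepMin J V h c E F₀ := hF.congr H.perim (posMeas_ac _) (negMeas_ac _)
    (hF.meas.inter measurableSet_closedBall.nullMeasurableSet) hae.symm
  set ν := r⁻¹ • x
  have hν : ‖ν‖ = 1 := by rw [norm_smul, norm_inv, norm_norm, inv_mul_cancel₀ hr0.ne']
  have hxν : x = r • ν := by rw [smul_smul, mul_inv_cancel₀ hr0.ne', one_smul]
  set ε : ℕ → ℝ := fun n => r / ((n : ℝ) + 1)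
  have hε : ∀ n, 0 < ε n ∧ ε n ≤ r := div_nat_add_one_mem hr0
  have hε0 : Tendsto ε atTop (𝓝 0) := tendsto_const_div_nat_add_one r
  -- Translation by rν makes the ball of radius r around F touch the ball of radius 2r from inside
  -- at 2rν; the extra ε pushes part of F outside. The larger radius 2r makes the contact a single
  -- point, to which the lenses shrink.
  set a : ℕ → RN N := fun n => (r + ε n) • ν
  set η : ℕ → ℝ := fun n => √(4 * r * ε n)
  have hη0 : Tendsto η atTop (𝓝 0) := by
    simpa using (hε0.const_mul (4 * r)).sqrt
  set G : ℕ → Set (RN N) := fun n => (fun y => a n + y) '' F₀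
  set B : Set (RN N) := Metric.ball 0 (2 * r)
  have hGm : ∀ n, NullMeasurableSet (G n) volume := fun n => nullMeasurableSet_image_add _ hF₀.meas
  have hWm : ∀ n, NullMeasurableSet (G n \ B) volume :=
    fun n => (hGm n).diff measurableSet_ball.nullMeasurableSet
  have hlens : ∀ n, G n \ B ⊆ Metric.closedBall ((2 * r) • ν) (η n) := by
    rintro n _ ⟨⟨w, hw, rfl⟩, hwB⟩
    have h1 := norm_sub_sq_le_of_lens (y := a n + w) hν hr0 (ρ := 2 * r) (by linarith) (hε n).1
      (hε n).2 (by
        have : a n + w - (2 * r - r + ε n) • ν = w := by simp only [a]; module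
        rw [this]; simpa using hw.2) (by simpa [B] using hwB)
    rw [mem_closedBall_iff_norm]
    exact Real.le_sqrt_of_sq_le h1
  have hpos : ∀ n, 0 < volume (G n \ B) := by
    intro n
    have h1 : 0 < volume (F₀ ∩ Metric.ball x (ε n)) := by
      have h2 := (Measure.mem_support_iff_forall x).1 hxS _ (Metric.ball_mem_nhds x (hε n).1)
      rw [Measure.restrict_apply measurableSet_ball, inter_comm] at h2
      exact h2.trans_eq (measure_congr (hae.symm.inter (ae_eq_refl _)))
    rw [← volume_image_add (a n)] at h1
    refine h1.trans_le (measure_mono ?_)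
    rintro _ ⟨w, hw, rfl⟩
    refine ⟨⟨w, hw.1, rfl⟩, fun hwB => ?_⟩
    have h2 := mem_ball_zero_iff.1 hwB
    have h3 := mem_ball_iff_norm.1 hw.2
    have h4 : (2 * r + ε n) • ν = (a n + w) - (w - x) := by
      rw [hxν]; simp only [a]; module
    have h5 := norm_sub_le (a n + w) (w - x)
    rw [← h4, norm_smul, hν, mul_one, Real.norm_of_nonneg (by linarith [(hε n).1])] at h5
    simp only at h2
    linarith
  have hshr : ShrinksTo (fun n => G n \ B) ((2 * r) • ν) :=
    shrinksTo_of_subset_closedBall hWm (fun n => nonempty_of_measure_ne_zero (hpos n).ne') hlens hη0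
  have hWB : ∀ n, (G n \ B) \ B = G n \ B := fun n => sdiff_idem
  have hJB : J B ≠ ⊤ := H.perim.ball_ne_top 0 (by linarith)
  have hfin : ∀ n, volume (G n \ B) ≠ ⊤ := fun n =>
    ne_top_of_le_ne_top measure_closedBall_lt_top.ne (measure_mono (hlens n))
  have hev := eventually_le_of_le_curvPlus hJB (H.curv_ge (2 * r) (by linarith) ((2 * r) • ν) (by
      rw [mem_sphere_zero_iff_norm, norm_smul, hν, Real.norm_of_nonneg (by linarith), mul_one]))
    (show K < K + 1 / 2 by linarith) hshr (by simpa only [hWB] using hpos)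
    (by simpa only [hWB] using hfin)
  have hev2 : ∀ᶠ n in atTop, ε n + η n < r - (R + C * h) := by
    have := hε0.add hη0
    rw [add_zero] at this
    exact this.eventually (gt_mem_nhds (by linarith))
  obtain ⟨n, hn, hn2⟩ := (hev.and hev2).exists
  rw [hWB, union_sdiff_self] at hn
  refine (hpos n).ne' (IsMin.volume_sdiff_eq_zero H.perim (hF₀.translate H (a n))
    measurableSet_ball.nullMeasurableSet hJB (k := K + 1 / 2) (M := K + 1) (by linarith [H.K_pos])
    (by linarith) (hfin n) hn fun z hz => ?_)
  rw [H.transl]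
  -- Moved back by a, the lens is close to x, hence farther than C h from E, where the potential is
  -- at least K + 1.
  refine hfar h c E _ hh hc (disjoint_ball_of_subset_closedBall hE ?_)
  have h1 := mem_closedBall_iff_norm.1 (hlens n hz)
  have h2 : (r - ε n) • ν = (z - a n) - (z - (2 * r) • ν) := by simp only [a]; module
  have h3 := norm_sub_le (z - a n) (z - (2 * r) • ν)
  rw [← h2, norm_smul, hν, mul_one, Real.norm_of_nonneg (by linarith [(hε n).2])] at h3
  linarith

/-- Balls do not vanish in one step, if the step is small. -/
theorem FlowData.volume_pos_of_ball (H : FlowData J V Cf K) {r : ℝ} (hr : 0 < r) :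
    ∃ h₀, 0 < h₀ ∧ ∀ h c F, 0 < h → h ≤ h₀ → |c| ≤ Cf → StepMin J V h c (Metric.ball 0 r) F →
      volume F ≠ 0 := by
  obtain ⟨C₁, hC₁, hfar⟩ := H.far 0
  set b : Set (RN N) := Metric.ball 0 r
  set A : ℝ≥0∞ := J b + ENNReal.ofReal Cf * volume b +
    ENNReal.ofReal Cf * volume (Metric.ball (0 : RN N) (2 * r))
  have hA : A ≠ ⊤ := by
    refine ENNReal.add_ne_top.2 ⟨ENNReal.add_ne_top.2 ⟨H.perim.ball_ne_top 0 hr, ?_⟩, ?_⟩ <;>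
    exact ENNReal.mul_ne_top ENNReal.ofReal_ne_top measure_ball_lt_top.ne
  set w := volume (Metric.ball (0 : RN N) (r / 2))
  have hw0 : w ≠ 0 := (Metric.measure_ball_pos volume _ (by linarith)).ne'
  have hwt : w ≠ ⊤ := measure_ball_lt_top.ne
  -- A bounds the cost of the ball itself. If F were null, it would pay at least M on the half ball,
  -- where the potential is below -M for small h.
  obtain ⟨M, hM⟩ : ∃ M : ℝ, A < ENNReal.ofReal M * w := by
    refine ⟨(A / w + 1).toReal, ?_⟩
    have h1 : A / w ≠ ⊤ := ENNReal.div_ne_top hA hw0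
    rw [ENNReal.ofReal_toReal (ENNReal.add_ne_top.2 ⟨h1, ENNReal.one_ne_top⟩), add_mul, one_mul,
      ENNReal.div_mul_cancel hw0 hwt]
    exact ENNReal.lt_add_right hA hw0
  obtain ⟨C₂, hC₂, hdeep⟩ := H.deep M
  refine ⟨min (r / C₁) (r / 2 / C₂), by positivity, fun h c F hh hh₀ hc hF h0 => ?_⟩
  have hh1 : C₁ * h ≤ r := by
    have := hh₀.trans (min_le_left _ _)
    rw [le_div_iff₀ hC₁] at this; linarith
  have hh2 : C₂ * h ≤ r / 2 := by
    have := hh₀.trans (min_le_right _ _)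
    rw [le_div_iff₀ hC₂] at this; linarith
  have hup : functional J (posMeas (V h c b)) (negMeas (V h c b)) b ≤ A := by
    unfold functional
    refine add_le_add (add_le_add le_rfl ?_) ?_
    · exact posMeas_le measurableSet_ball.nullMeasurableSet fun x hx => H.inside h c b x hh hc hx
    · have h1 : negMeas (V h c b) (bᶜ ∩ Metric.ball 0 (2 * r)) ≤
          ENNReal.ofReal Cf * volume (Metric.ball (0 : RN N) (2 * r)) := by
        refine (negMeas_le (M := Cf) (measurableSet_ball.compl.inter
          measurableSet_ball).nullMeasurableSet
          fun x hx => H.outside h c b x hh hc hx.1).trans ?_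
        gcongr
        exact inter_subset_right
      have h2 : negMeas (V h c b) (bᶜ \ Metric.ball 0 (2 * r)) ≤
          ENNReal.ofReal 0 * volume (bᶜ \ Metric.ball 0 (2 * r)) := by
        refine negMeas_le (M := 0) (measurableSet_ball.compl.diff
          measurableSet_ball).nullMeasurableSet fun x hx => ?_
        rw [neg_zero]
        refine hfar h c b x hh hc (disjoint_ball_of_subset_closedBall Metric.ball_subset_closedBall ?_)
        have := hx.2
        rw [mem_ball_zero_iff, not_lt] at this
        linarith
      rw [ENNReal.ofReal_zero, zero_mul] at h2
      rw [← measure_inter_add_sdiff bᶜ (measurableSet_ball (x := (0 : RN N)) (ε := 2 * r)),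
        nonpos_iff_eq_zero.1 h2, add_zero]
      exact h1
  have hlow : ENNReal.ofReal M * w ≤ functional J (posMeas (V h c b)) (negMeas (V h c b)) F := by
    refine le_trans ?_ (show negMeas (V h c b) Fᶜ ≤ _ from le_add_self)
    refine (le_negMeas (v := V h c b) (M := M) measurableSet_ball.nullMeasurableSet
      fun x hx => ?_).trans ?_
    · refine hdeep h c b x hh hc (Metric.ball_subset_ball' ?_)
      have := Metric.mem_ball.1 hx
      linarith
    · rw [← measure_inter_add_sdiff₀ (Metric.ball (0 : RN N) (r / 2))
        (hF.meas.mono_ac (negMeas_ac (V h c b)))]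
      rw [negMeas_ac (V h c b) (measure_mono_null inter_subset_right h0), zero_add]
      exact measure_mono fun x hx => hx.2
  exact absurd (hM.trans_le (hlow.trans ((hF.le _ measurableSet_ball.nullMeasurableSet).trans hup)))
    (lt_irrefl _)

/-- For small steps, the evolution of a ball contains the ball of half the radius. -/
theorem FlowData.volume_half_ball_sdiff (H : FlowData J V Cf K) {r₀ : ℝ} (hr₀ : 0 < r₀) :
    ∃ h₀, 0 < h₀ ∧ ∀ h c R F, 0 < h → h ≤ h₀ → |c| ≤ Cf → r₀ ≤ R →
      StepMin J V h c (Metric.ball 0 R) F → volume (Metric.ball 0 (r₀ / 2) \ F) = 0 := by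
  -- The minimal evolution A of the ball of radius r₀/8 is not null and has a support point y with
  -- |y| ≤ r₀/4. Translates of this ball by less than R - r₀/8 stay inside the datum, so F contains
  -- the ball of radius R - r₀/8 around y, hence that of radius r₀/2 around 0.
  obtain ⟨h₁, hh₁, hnull⟩ := H.volume_pos_of_ball (r := r₀ / 8) (by linarith)
  obtain ⟨C, hC, hgrow⟩ := H.growth
  refine ⟨min h₁ (r₀ / 8 / C), by positivity, fun h c R F hh hh₀ hc hR hF => ?_⟩
  have hCh : C * h ≤ r₀ / 8 := by
    have := hh₀.trans (min_le_right _ _)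
    rw [le_div_iff₀ hC] at this; linarith
  obtain ⟨A, hA⟩ := H.exists_minimal (E := Metric.ball 0 (r₀ / 8)) hh hc
    (Or.inl Metric.isBounded_ball)
  have hA0 := hnull h c A hh (hh₀.trans (min_le_left _ _)) hc hA.1
  have hAg := hgrow h c _ A (r₀ / 8) hh hc (by linarith) Metric.ball_subset_closedBall hA.1
  have hpos : 0 < volume.restrict A (Metric.closedBall (0 : RN N) (r₀ / 8 + C * h)) := by
    rw [Measure.restrict_apply measurableSet_closedBall, inter_comm]
    have := measure_inter_add_sdiff (μ := volume) A
      (measurableSet_closedBall (x := (0 : RN N)) (ε := r₀ / 8 + C * h))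
    rw [hAg, add_zero] at this
    rw [this]; exact pos_iff_ne_zero.2 hA0
  obtain ⟨y, hy, hyS⟩ := Measure.nonempty_inter_support_of_pos hpos
  rw [mem_closedBall_zero_iff] at hy
  have h1 : volume (Metric.ball y (R - r₀ / 8) \ F) = 0 := by
    refine volume_ball_sdiff_eq_zero hA.1.meas hF.meas (fun z hz => ?_) hyS
    refine H.minimal_subset hh ?_ (hA.translate H z) hF
    rintro _ ⟨w, hw, rfl⟩
    rw [mem_ball_zero_iff] at hw ⊢
    have := norm_add_le z w
    simp only
    linarith
  refine measure_mono_null (sdiff_subset_sdiff_left (Metric.ball_subset_ball' ?_)) h1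
  rw [dist_zero_left]
  linarith

/-- Balls shrink at most with a speed which is locally bounded in the radius. -/
theorem FlowData.shrink (H : FlowData J V Cf K) {r₀ : ℝ} (hr₀ : 0 < r₀) :
    ∃ C, 0 < C ∧ ∃ h₀, 0 < h₀ ∧ ∀ h c R F, 0 < h → h ≤ h₀ → |c| ≤ Cf → r₀ ≤ R →
      StepMin J V h c (Metric.ball 0 R) F → volume (Metric.ball 0 (R - C * h) \ F) = 0 := by
  -- The test ball has this fixed radius whatever R is, so only its curvature enters and C depends
  -- on r₀ alone. By `FlowData.volume_half_ball_sdiff` the nearest point of the complement has norm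
  -- ρ ≥ r₀/2 = 2r, as the lens estimate requires.
  set r := r₀ / 4 with hrr
  have hr0 : 0 < r := by linarith
  obtain ⟨k₀, hk₀⟩ := H.curv_le r hr0
  set k := max k₀ 0 + 1
  have hk : k₀ < k := by linarith [le_max_left k₀ 0]
  have hk' : 0 ≤ k := by linarith [le_max_right k₀ 0]
  obtain ⟨C, hC, hdeep⟩ := H.deep (k + 1)
  obtain ⟨h₀, hh₀, hhalf⟩ := H.volume_half_ball_sdiff hr₀
  refine ⟨C, hC, h₀, hh₀, fun h c R F hh hhh₀ hc hR hF => by_contra fun hne => ?_⟩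
  have hhalf := hhalf h c R F hh hhh₀ hc hR hF
  have hrestr : ∀ (p : RN N) s, volume.restrict Fᶜ (Metric.ball p s) =
      volume (Metric.ball p s \ F) := fun p s => by
    rw [Measure.restrict_apply measurableSet_ball, ← sdiff_eq]
  set S := (volume.restrict Fᶜ).support with hS
  obtain ⟨y, hy, hyS⟩ := Measure.nonempty_inter_support_of_pos (μ := volume.restrict Fᶜ)
    (by rw [hrestr]; exact pos_iff_ne_zero.2 hne)
  -- The point of the support of the complement nearest to the origin: F contains the ball of radius
  -- ρ = |x|, up to a null set.
  obtain ⟨x, hxS, hx⟩ := (Measure.isClosed_support (μ := volume.restrict Fᶜ)).exists_infDist_eq_dist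
    ⟨y, hyS⟩ 0
  have hmin : ∀ z ∈ S, ‖x‖ ≤ ‖z‖ := fun z hz => by
    rw [← dist_zero_left x, ← hx, ← dist_zero_left z]
    exact Metric.infDist_le_dist_of_mem hz
  have hyx := hmin y hyS
  rw [mem_ball_zero_iff] at hy
  set ρ := ‖x‖ with hρ
  have hρr : r ≤ ρ / 2 := by
    by_contra hlt
    have h1 := (Measure.mem_support_iff_forall x).1 hxS (Metric.ball 0 (r₀ / 2))
      (Metric.isOpen_ball.mem_nhds (by rw [mem_ball_zero_iff]; linarith))
    rw [hrestr, hhalf] at h1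
    exact lt_irrefl _ h1
  have hρ0 : 0 < ρ := by linarith
  have hF0 : volume (Metric.ball 0 ρ \ F) = 0 := by
    rw [← hrestr]
    refine measure_mono_null (t := Sᶜ) (fun z hz hzS => ?_)
      (Measure.measure_compl_support (μ := volume.restrict Fᶜ))
    rw [mem_ball_zero_iff] at hz
    exact absurd (hmin z hzS) (not_le.2 hz)
  have hae : (F ∪ Metric.ball 0 ρ : Set (RN N)) =ᵐ[volume] F := by
    rw [← union_sdiff_self]
    exact union_ae_eq_left_of_ae_eq_empty (ae_eq_empty.2 hF0)
  set F₀ := F ∪ Metric.ball 0 ρ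
  have hF₀ : StepMin J V h c (Metric.ball 0 R) F₀ :=
    hF.congr H.perim (posMeas_ac _) (negMeas_ac _)
      (hF.meas.union measurableSet_ball.nullMeasurableSet) hae.symm
  set ν := ρ⁻¹ • x
  have hν : ‖ν‖ = 1 := by rw [norm_smul, norm_inv, norm_norm, inv_mul_cancel₀ hρ0.ne']
  have hxν : x = ρ • ν := by rw [smul_smul, mul_inv_cancel₀ hρ0.ne', one_smul]
  set ε : ℕ → ℝ := fun n => r / ((n : ℝ) + 1)
  have hε : ∀ n, 0 < ε n ∧ ε n ≤ r := div_nat_add_one_mem hr0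
  have hε0 : Tendsto ε atTop (𝓝 0) := tendsto_const_div_nat_add_one r
  set a : ℕ → RN N := fun n => (ρ - r + ε n) • ν
  set η : ℕ → ℝ := fun n => √(4 * r * ε n)
  have hη0 : Tendsto η atTop (𝓝 0) := by
    simpa using (hε0.const_mul (4 * r)).sqrt
  -- Instead of moving the test ball to a, the minimizer is moved by -a, because the curvature
  -- bounds concern balls centred at the origin.
  set G : ℕ → Set (RN N) := fun n => (fun y => -a n + y) '' F₀
  have hmemG : ∀ n z, z ∈ G n ↔ a n + z ∈ F₀ := fun n z => by
    simp only [G, Set.image_add_left, neg_neg, mem_preimage]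
  set B : Set (RN N) := Metric.ball 0 r
  have hWm : ∀ n, NullMeasurableSet (B \ G n) volume :=
    fun n => measurableSet_ball.nullMeasurableSet.diff (nullMeasurableSet_image_add _ hF₀.meas)
  have hlens : ∀ n, ∀ z ∈ B \ G n, ‖a n + z - ρ • ν‖ ≤ η n := by
    rintro n z ⟨hzB, hzG⟩
    rw [hmemG] at hzG
    refine Real.le_sqrt_of_sq_le (norm_sub_sq_le_of_lens hν hr0 hρr (hε n).1 (hε n).2 ?_ ?_)
    · rw [add_sub_cancel_left]; exact (mem_ball_zero_iff.1 hzB).le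
    · by_contra hlt
      exact hzG (Or.inr (mem_ball_zero_iff.2 (not_le.1 hlt)))
  have hsub : ∀ n, B \ G n ⊆ Metric.closedBall (r • ν) (η n + ε n) := by
    intro n z hz
    rw [mem_closedBall_iff_norm]
    have h1 : z - r • ν = (a n + z - ρ • ν) - ε n • ν := by simp only [a]; module
    have h2 := norm_sub_le (a n + z - ρ • ν) (ε n • ν)
    rw [← h1, norm_smul, hν, mul_one, Real.norm_of_nonneg (hε n).1.le] at h2
    linarith [hlens n z hz]
  have hpos : ∀ n, 0 < volume (B \ G n) := by
    intro n
    have h1 : 0 < volume (Metric.ball x (ε n) ∩ F₀ᶜ) := by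
      have h2 := (Measure.mem_support_iff_forall x).1 hxS _ (Metric.ball_mem_nhds x (hε n).1)
      rw [Measure.restrict_apply measurableSet_ball] at h2
      exact h2.trans_eq (measure_congr ((ae_eq_refl _).inter hae.symm.compl))
    rw [← volume_image_add (-a n)] at h1
    refine h1.trans_le (measure_mono ?_)
    rintro _ ⟨w, hw, rfl⟩
    refine ⟨?_, fun hwG => hw.2 (by simpa using (hmemG n _).1 hwG)⟩
    have h3 := mem_ball_iff_norm.1 hw.1
    have h4 : -a n + w = (w - x) + (r - ε n) • ν := by rw [hxν]; simp only [a]; module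
    have h5 := norm_add_le (w - x) ((r - ε n) • ν)
    rw [← h4, norm_smul, hν, mul_one, Real.norm_of_nonneg (by linarith [(hε n).2])] at h5
    rw [mem_ball_zero_iff]
    simp only
    linarith
  have hshr : ShrinksTo (fun n => B \ G n) (r • ν) :=
    shrinksTo_of_subset_closedBall hWm (fun n => nonempty_of_measure_ne_zero (hpos n).ne') hsub
      (by simpa using hη0.add hε0)
  have hJB : J B ≠ ⊤ := H.perim.ball_ne_top 0 hr0
  have hfin : ∀ n, volume (B \ G n) ≠ ⊤ := fun n =>
    ne_top_of_le_ne_top measure_ball_lt_top.ne (measure_mono sdiff_subset)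
  have hBG : ∀ n, (B \ G n) ∩ B = B \ G n := fun n => inter_eq_left.2 sdiff_subset
  have hev := eventually_le_of_curvMinus_le hJB (hk₀ (r • ν) (by
      rw [mem_sphere_zero_iff_norm, norm_smul, hν, Real.norm_of_nonneg hr0.le, mul_one]))
    hk hshr (by simpa only [hBG] using hpos) (by simpa only [hBG] using hfin)
  have hev2 : ∀ᶠ n in atTop, η n < R - C * h - ρ :=
    hη0.eventually (gt_mem_nhds (by linarith))
  obtain ⟨n, hn, hn2⟩ := (hev.and hev2).exists
  rw [hBG, Set.sdiff_sdiff_right_self] at hn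
  refine (hpos n).ne' (IsMin.volume_sdiff_eq_zero_of_inner H.perim (hF₀.translate H (-a n))
    measurableSet_ball.nullMeasurableSet hJB (k := k) (M := k + 1) hk'
    (by linarith) (hfin n) hn fun z hz => ?_)
  rw [H.transl]
  refine hdeep h c _ _ hh hc (Metric.ball_subset_ball' ?_)
  rw [dist_zero_right, sub_neg_eq_add, add_comm z]
  have h1 := hlens n z hz
  have h2 := norm_add_le (a n + z - ρ • ν) (ρ • ν)
  rw [sub_add_cancel, norm_smul, hν, mul_one, Real.norm_of_nonneg hρ0.le] at h2
  linarith

end Evolution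

/-! ### The nonlinearity -/

/-- The properties of the extended inverse `g` of the velocity function. -/
structure IsNonlin (g : EReal → EReal) : Prop where
  mono : Monotone g
  zero : g 0 = 0
  top : ∀ M : ℝ, ∃ s : ℝ, 0 < s ∧ ∀ y : EReal, (s : EReal) ≤ y → (M : EReal) ≤ g y
  bot : ∀ M : ℝ, ∃ s : ℝ, 0 < s ∧ ∀ y : EReal, y ≤ ((-s : ℝ) : EReal) → g y ≤ ((-M : ℝ) : EReal)
  fin : ∃ s : ℝ, 0 < s ∧ (g s < ⊤ ∨ ⊥ < g ((-s : ℝ) : EReal))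

theorem IsNonlin.dual {g : EReal → EReal} (hg : IsNonlin g) : IsNonlin (fun s => -g (-s)) where
  mono x y hxy := EReal.neg_le_neg_iff.2 (hg.mono (EReal.neg_le_neg_iff.2 hxy))
  zero := by simp [hg.zero]
  top M := by
    obtain ⟨s, hs, h⟩ := hg.bot M
    refine ⟨s, hs, fun y hy => ?_⟩
    rw [EReal.le_neg]
    simpa using h (-y) (by rw [EReal.neg_le]; simpa using hy)
  bot M := by
    obtain ⟨s, hs, h⟩ := hg.top M
    refine ⟨s, hs, fun y hy => ?_⟩
    rw [EReal.neg_le]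
    simpa using h (-y) (by rw [EReal.le_neg]; simpa using hy)
  fin := by
    obtain ⟨s, hs, h⟩ := hg.fin
    refine ⟨s, hs, h.symm.imp (fun h => ?_) fun h => ?_⟩
    · rw [EReal.neg_lt_comm]; simpa using h
    · rw [EReal.lt_neg_comm]; simpa using h

/-- Monotonicity passes from G to the selection; g y < M forces y ≤ G M, so g exceeds any M for
large arguments. As G is not identically zero, -a < 0 or 0 < b, so g is finite at some nonzero
point; this is `fin`, on which existence of competitors rests. -/
theorem IsInverseSelection.isNonlin {G : ℝ → ℝ} {g : EReal → EReal} (hg : IsInverseSelection G g)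
    (hGm : Monotone G) (hG0 : G 0 = 0) (hG : ∃ s, G s ≠ 0) : IsNonlin g := by
  obtain ⟨a, b, ha, hb, h0, hr, hbot, htop⟩ := hg
  have hGE : Monotone fun s => (G s : EReal) := fun x y h => EReal.coe_le_coe_iff.2 (hGm h)
  have hGa : ∀ s, -a ≤ (G s : EReal) := fun s => hGE.le_of_tendsto ha s
  have hGb : ∀ s, (G s : EReal) ≤ b := fun s => hGE.ge_of_tendsto hb s
  have ha0 : -a ≤ 0 := by simpa [hG0] using hGa 0
  have hb0 : 0 ≤ b := by simpa [hG0] using hGb 0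
  have hpos : ∀ y : EReal, 0 < y → 0 ≤ g y := fun y hy => by
    by_cases hyb : b ≤ y
    · rw [htop y hy.ne' hyb]; exact le_top
    · rw [not_le] at hyb
      lift y to ℝ using ⟨hyb.ne_top, (EReal.bot_lt_zero.trans hy).ne'⟩
      obtain ⟨s, hs, hGs⟩ := hr y (ha0.trans_lt hy) hyb
      rw [hs]
      by_contra hlt
      have hs0 : s ≤ 0 := by exact_mod_cast (not_le.1 hlt).le
      have h1 : (0 : ℝ) < y := by exact_mod_cast hy
      have h2 := hGm hs0
      linarith
  have hneg : ∀ y : EReal, y < 0 → g y ≤ 0 := fun y hy => by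
    by_cases hya : y ≤ -a
    · rw [hbot y hy.ne hya]; exact bot_le
    · rw [not_le] at hya
      lift y to ℝ using ⟨(hy.trans EReal.zero_lt_top).ne, (bot_le.trans_lt hya).ne'⟩
      obtain ⟨s, hs, hGs⟩ := hr y hya (hy.trans_le hb0)
      rw [hs]
      by_contra hlt
      have hs0 : 0 ≤ s := by exact_mod_cast (not_le.1 hlt).le
      have h1 : y < (0 : ℝ) := by exact_mod_cast hy
      have h2 := hGm hs0
      linarith
  refine ⟨fun x y hxy => ?_, h0, fun M => ?_, fun M => ?_, ?_⟩
  · rcases lt_trichotomy x 0 with hx | rfl | hx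
    · rcases lt_trichotomy y 0 with hy | rfl | hy
      · by_cases hxa : x ≤ -a
        · rw [hbot x hx.ne hxa]; exact bot_le
        rw [not_le] at hxa
        have hya := hxa.trans_le hxy
        lift x to ℝ using ⟨(hx.trans EReal.zero_lt_top).ne, (bot_le.trans_lt hxa).ne'⟩
        lift y to ℝ using ⟨(hy.trans EReal.zero_lt_top).ne, (bot_le.trans_lt hya).ne'⟩
        obtain ⟨s, hs, hGs⟩ := hr x hxa (hx.trans_le hb0)
        obtain ⟨t, ht, hGt⟩ := hr y hya (hy.trans_le hb0)
        rcases hxy.eq_or_lt with he | hlt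
        · rw [he]
        rw [hs, ht, EReal.coe_le_coe_iff]
        by_contra hst
        have h1 := hGm (not_le.1 hst).le
        have h2 : x < y := by exact_mod_cast hlt
        linarith
      · rw [h0]; exact hneg x hx
      · exact (hneg x hx).trans (hpos y hy)
    · rcases hxy.eq_or_lt with he | hlt
      · rw [he]
      · rw [h0]; exact hpos y hlt
    · have hy := hx.trans_le hxy
      by_cases hyb : b ≤ y
      · rw [htop y hy.ne' hyb]; exact le_top
      rw [not_le] at hyb
      have hxb := hxy.trans_lt hyb
      lift x to ℝ using ⟨hxb.ne_top, (EReal.bot_lt_zero.trans hx).ne'⟩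
      lift y to ℝ using ⟨hyb.ne_top, (EReal.bot_lt_zero.trans hy).ne'⟩
      obtain ⟨s, hs, hGs⟩ := hr x (ha0.trans_lt hx) hxb
      obtain ⟨t, ht, hGt⟩ := hr y (ha0.trans_lt hy) hyb
      rcases hxy.eq_or_lt with he | hlt
      · rw [he]
      rw [hs, ht, EReal.coe_le_coe_iff]
      by_contra hst
      have h1 := hGm (not_le.1 hst).le
      have h2 : x < y := by exact_mod_cast hlt
      linarith
  · refine ⟨max (G M) 0 + 1, by positivity, fun y hy => ?_⟩
    have hy0 : 0 < y := lt_of_lt_of_le (by exact_mod_cast (by positivity : 0 < max (G M) 0 + 1)) hy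
    by_cases hyb : b ≤ y
    · rw [htop y hy0.ne' hyb]; exact le_top
    rw [not_le] at hyb
    lift y to ℝ using ⟨hyb.ne_top, (EReal.bot_lt_zero.trans hy0).ne'⟩
    obtain ⟨s, hs, hGs⟩ := hr y (ha0.trans_lt hy0) hyb
    rw [hs, EReal.coe_le_coe_iff]
    by_contra hlt
    have h1 := hGm (not_le.1 hlt).le
    have h2 : max (G M) 0 + 1 ≤ y := by exact_mod_cast hy
    linarith [le_max_left (G M) 0]
  · refine ⟨max (-G (-M)) 0 + 1, by positivity, fun y hy => ?_⟩
    have hy0 : y < 0 := lt_of_le_of_lt hy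
      (by exact_mod_cast (by linarith [le_max_right (-G (-M)) 0] : -(max (-G (-M)) 0 + 1) < 0))
    by_cases hya : y ≤ -a
    · rw [hbot y hy0.ne hya]; exact bot_le
    rw [not_le] at hya
    lift y to ℝ using ⟨(hy0.trans EReal.zero_lt_top).ne, (bot_le.trans_lt hya).ne'⟩
    obtain ⟨s, hs, hGs⟩ := hr y hya (hy0.trans_le hb0)
    rw [hs, EReal.coe_le_coe_iff]
    by_contra hlt
    have h1 := hGm (not_le.1 hlt).le
    have h2 : y ≤ -(max (-G (-M)) 0 + 1) := by exact_mod_cast hy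
    linarith [le_max_left (-G (-M)) 0]
  · obtain ⟨t, ht⟩ := hG
    rcases lt_or_gt_of_ne ht with hlt | hgt
    · refine ⟨-G t / 2, by linarith, Or.inr ?_⟩
      obtain ⟨s, hs, -⟩ := hr (-(-G t / 2))
        ((hGa t).trans_lt (by exact_mod_cast (by linarith : G t < -(-G t / 2))))
        (lt_of_lt_of_le (by exact_mod_cast (by linarith : -(-G t / 2) < 0)) hb0)
      rw [hs]; exact EReal.bot_lt_coe s
    · refine ⟨G t / 2, by linarith, Or.inl ?_⟩
      obtain ⟨s, hs, -⟩ := hr (G t / 2)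
        (ha0.trans_lt (by exact_mod_cast (by linarith : 0 < G t / 2)))
        (lt_of_lt_of_le (by exact_mod_cast (by linarith : G t / 2 < G t)) (hGb t))
      rw [hs]; exact EReal.coe_lt_top s

/-! ### The anisotropic signed distance -/

/-- A continuous function comparable with the Euclidean norm. -/
structure IsNormLike (ψ : RN N → ℝ) (C : ℝ) : Prop where
  pos : 0 < C
  lower : ∀ v, C⁻¹ * ‖v‖ ≤ polar ψ v
  upper : ∀ v, polar ψ v ≤ C * ‖v‖
  cont : Continuous (polar ψ)

theorem IsAnisotropy.isNormLike {ψ : RN N → ℝ} (hψ : IsAnisotropy ψ) : ∃ C, IsNormLike ψ C := by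
  obtain ⟨C, hC, hb⟩ := hψ.bounds
  have h0 : ψ 0 = 0 := by
    have := hb 0
    simp only [norm_zero, mul_zero] at this
    linarith
  have hbd : ∀ v ξ : RN N, ψ ξ ≤ 1 → inner ℝ ξ v ≤ C * ‖v‖ := fun v ξ hξ => by
    have h1 : ‖ξ‖ ≤ C := by
      have := (hb ξ).1.trans hξ
      rwa [inv_mul_le_iff₀ hC, mul_one] at this
    exact (real_inner_le_norm ξ v).trans (by gcongr)
  have hbdd : ∀ v, BddAbove ((fun ξ : RN N => inner ℝ ξ v) '' {ξ | ψ ξ ≤ 1}) := fun v =>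
    ⟨C * ‖v‖, by rintro _ ⟨ξ, hξ, rfl⟩; exact hbd v ξ hξ⟩
  have hne : ∀ v, ((fun ξ : RN N => (inner ℝ ξ v : ℝ)) '' {ξ | ψ ξ ≤ 1}).Nonempty := fun v =>
    ⟨_, 0, by simp [h0], rfl⟩
  have hlip : ∀ v w, polar ψ v ≤ polar ψ w + C * ‖v - w‖ := fun v w => by
    refine csSup_le (hne v) ?_
    rintro _ ⟨ξ, hξ, rfl⟩
    have h1 : inner ℝ ξ w ≤ polar ψ w := le_csSup (hbdd w) ⟨ξ, hξ, rfl⟩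
    have h2 := hbd (v - w) ξ hξ
    rw [inner_sub_right] at h2
    simp only
    linarith
  refine ⟨C, hC, fun v => ?_, fun v => csSup_le (hne v) ?_, ?_⟩
  · rcases eq_or_ne v 0 with rfl | hv
    · rw [norm_zero, mul_zero]
      exact le_csSup (hbdd 0) ⟨0, by simp [h0], by simp⟩
    · have hv' : 0 < ‖v‖ := norm_pos_iff.2 hv
      refine le_csSup (hbdd v) ⟨(C * ‖v‖)⁻¹ • v, ?_, ?_⟩
      · refine (hb _).2.trans_eq ?_
        rw [norm_smul, Real.norm_of_nonneg (by positivity)]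
        field_simp
      · simp only [inner_smul_left, real_inner_self_eq_norm_sq, RCLike.conj_to_real]
        field_simp
  · rintro _ ⟨ξ, hξ, rfl⟩
    exact hbd v ξ hξ
  · refine (LipschitzWith.of_le_add_mul C.toNNReal fun v w => ?_).continuous
    rw [Real.coe_toNNReal _ hC.le, dist_eq_norm]
    exact hlip v w

section Distance

variable {ψ : RN N → ℝ} {C : ℝ} {E E' : Set (RN N)} {x : RN N}

theorem IsNormLike.polar_nonneg (hψ : IsNormLike ψ C) (v : RN N) : 0 ≤ polar ψ v :=
  (mul_nonneg (inv_nonneg.2 hψ.pos.le) (norm_nonneg v)).trans (hψ.lower v)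

theorem IsNormLike.psiDist_nonneg (hψ : IsNormLike ψ C) (E : Set (RN N)) (x : RN N) :
    0 ≤ psiDist ψ E x :=
  le_iInf₂ fun y _ => by exact_mod_cast hψ.polar_nonneg _

theorem IsNormLike.psiDist_le (hψ : IsNormLike ψ C) {y : RN N} (hy : y ∈ E) :
    psiDist ψ E x ≤ ((C * ‖x - y‖ : ℝ) : EReal) :=
  (iInf₂_le y hy).trans (by exact_mod_cast hψ.upper _)

theorem IsNormLike.psiDist_of_mem (hψ : IsNormLike ψ C) (hx : x ∈ E) : psiDist ψ E x = 0 :=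
  le_antisymm (by simpa using hψ.psiDist_le (x := x) hx) (hψ.psiDist_nonneg E x)

theorem IsNormLike.le_psiDist (hψ : IsNormLike ψ C) {r : ℝ} (h : Disjoint (Metric.ball x r) E) :
    ((C⁻¹ * r : ℝ) : EReal) ≤ psiDist ψ E x :=
  le_iInf₂ fun y hy => by
    have h1 : r ≤ ‖x - y‖ := by
      by_contra hlt
      exact Set.disjoint_left.1 h (by rw [mem_ball_iff_norm']; exact not_le.1 hlt) hy
    have h2 := mul_le_mul_of_nonneg_left h1 (inv_nonneg.2 hψ.pos.le)
    exact_mod_cast h2.trans (hψ.lower _)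

theorem psiDist_anti (h : E ⊆ E') : psiDist ψ E' x ≤ psiDist ψ E x :=
  biInf_mono h

theorem psiDist_image_add (z : RN N) :
    psiDist ψ ((fun y => z + y) '' E) x = psiDist ψ E (x - z) := by
  unfold psiDist
  rw [iInf_image]
  simp only [sub_add_eq_sub_sub]

/-- An infimum of continuous functions has open strict sublevel sets, even over an uncountable and
possibly non-measurable E. -/
theorem IsNormLike.measurable_psiDist (hψ : IsNormLike ψ C) (E : Set (RN N)) :
    Measurable (psiDist ψ E) := by
  refine measurable_of_Iio fun a => IsOpen.measurableSet ?_
  have : psiDist ψ E ⁻¹' Iio a = ⋃ y ∈ E, {x | ((polar ψ (x - y) : ℝ) : EReal) < a} := by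
    ext x
    simp [psiDist, iInf_lt_iff]
  rw [this]
  refine isOpen_biUnion fun y _ => ?_
  exact isOpen_lt (continuous_coe_real_ereal.comp (hψ.cont.comp (continuous_id.sub
    continuous_const))) continuous_const

theorem IsNormLike.signedDist_of_mem (hψ : IsNormLike ψ C) (hx : x ∈ E) :
    signedDist ψ E x = -psiDist ψ Eᶜ x := by
  rw [signedDist, hψ.psiDist_of_mem hx, zero_sub]

theorem IsNormLike.signedDist_of_notMem (hψ : IsNormLike ψ C) (hx : x ∉ E) :
    signedDist ψ E x = psiDist ψ E x := by
  rw [signedDist, hψ.psiDist_of_mem (show x ∈ Eᶜ from hx), sub_zero]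

theorem IsNormLike.signedDist_compl (hψ : IsNormLike ψ C) (E : Set (RN N)) (x : RN N) :
    signedDist ψ Eᶜ x = -signedDist ψ E x := by
  by_cases hx : x ∈ E
  · rw [hψ.signedDist_of_mem hx, hψ.signedDist_of_notMem (not_not.2 hx), neg_neg]
  · rw [hψ.signedDist_of_notMem hx, hψ.signedDist_of_mem (show x ∈ Eᶜ from hx), compl_compl]

theorem signedDist_anti (h : E ⊆ E') (x : RN N) : signedDist ψ E' x ≤ signedDist ψ E x :=
  EReal.sub_le_sub (psiDist_anti h) (psiDist_anti (compl_subset_compl.2 h))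

theorem signedDist_image_add (z : RN N) :
    signedDist ψ ((fun y => z + y) '' E) x = signedDist ψ E (x - z) := by
  rw [signedDist, ← image_add_compl, psiDist_image_add, psiDist_image_add, signedDist]

theorem IsNormLike.measurable_signedDist (hψ : IsNormLike ψ C) (E : Set (RN N)) :
    Measurable (signedDist ψ E) := by
  unfold signedDist
  simp only [sub_eq_add_neg]
  exact (hψ.measurable_psiDist E).add
    (continuous_neg.measurable.comp (hψ.measurable_psiDist Eᶜ))

end Distance

/-! ### The potentials -/

/-- The potential `g(sd_E / h) - c`. -/
def potential (ψ : RN N → ℝ) (g : EReal → EReal) (h c : ℝ) (E : Set (RN N)) (x : RN N) : EReal :=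
  g (signedDist ψ E x / (h : EReal)) - (c : EReal)

section Potential

variable {ψ : RN N → ℝ} {g : EReal → EReal} {C Cf h c : ℝ} {E E' : Set (RN N)} {x : RN N}

theorem IsNormLike.potential_dual (hψ : IsNormLike ψ C) (g : EReal → EReal) (h c : ℝ)
    (E : Set (RN N)) (x : RN N) :
    potential ψ (fun s => -g (-s)) h (-c) Eᶜ x = -potential ψ g h c E x := by
  simp only [potential]
  rw [hψ.signedDist_compl, div_eq_mul_inv, EReal.neg_mul, neg_neg, ← div_eq_mul_inv,
    EReal.neg_sub (Or.inr (EReal.coe_ne_bot c)) (Or.inr (EReal.coe_ne_top c)), EReal.coe_neg,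
    sub_eq_add_neg, neg_neg]

theorem div_le_div_ereal {a b : EReal} (hh : 0 < h) (hab : a ≤ b) :
    a / (h : EReal) ≤ b / (h : EReal) :=
  EReal.div_le_div_right_of_nonneg (by exact_mod_cast hh.le) hab

theorem potential_anti (hg : IsNonlin g) (hh : 0 < h) (hE : E ⊆ E') (x : RN N) :
    potential ψ g h c E' x ≤ potential ψ g h c E x :=
  EReal.sub_le_sub (hg.mono (div_le_div_ereal hh (signedDist_anti hE x))) le_rfl

theorem le_sub_coe {M Cf c : ℝ} {u : EReal} (hc : |c| ≤ Cf) (h : ((M + Cf : ℝ) : EReal) ≤ u) :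
    (M : EReal) ≤ u - (c : EReal) := by
  rw [EReal.le_sub_iff_add_le (Or.inl (EReal.coe_ne_bot c)) (Or.inl (EReal.coe_ne_top c))]
  refine le_trans ?_ h
  exact_mod_cast (by linarith [le_abs_self c] : M + c ≤ M + Cf)

theorem sub_coe_le {M Cf c : ℝ} {u : EReal} (hc : |c| ≤ Cf) (h : u ≤ (M : EReal)) :
    u - (c : EReal) ≤ ((M + Cf : ℝ) : EReal) := by
  refine (EReal.sub_le_sub h le_rfl).trans ?_
  exact_mod_cast (by linarith [neg_abs_le c] : M - c ≤ M + Cf)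

/-- The distance enters as sd/h, so a large value of g requires a distance proportional to h. This
scaling is the source of the speed bounds. -/
theorem IsNormLike.potential_far (hψ : IsNormLike ψ C) (hg : IsNonlin g) (Cf M : ℝ) :
    ∃ C', 0 < C' ∧ ∀ h c E x, 0 < h → |c| ≤ Cf → Disjoint (Metric.ball x (C' * h)) E →
      (M : EReal) ≤ potential ψ g h c E x := by
  obtain ⟨s, hs, hM⟩ := hg.top (M + Cf)
  refine ⟨C * s, mul_pos hψ.pos hs, fun h c E x hh hc hd => le_sub_coe hc (hM _ ?_)⟩
  have hx : x ∉ E := Set.disjoint_left.1 hd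
    (Metric.mem_ball_self (mul_pos (mul_pos hψ.pos hs) hh))
  rw [hψ.signedDist_of_notMem hx, EReal.le_div_iff_mul_le (by exact_mod_cast hh) (by simp)]
  refine le_trans (le_of_eq ?_) (hψ.le_psiDist hd)
  rw [← EReal.coe_mul, EReal.coe_eq_coe_iff]
  have := hψ.pos.ne'
  field_simp

theorem IsNormLike.potential_le_of_mem (hψ : IsNormLike ψ C) (hg : IsNonlin g) (hh : 0 < h)
    (hc : |c| ≤ Cf) (hx : x ∈ E) : potential ψ g h c E x ≤ (Cf : EReal) := by
  have h1 : g (signedDist ψ E x / (h : EReal)) ≤ ((0 : ℝ) : EReal) := by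
    rw [EReal.coe_zero, ← hg.zero]
    refine hg.mono ?_
    refine (div_le_div_ereal hh (b := 0) ?_).trans_eq (by simp)
    rw [hψ.signedDist_of_mem hx, EReal.neg_le, neg_zero]
    exact hψ.psiDist_nonneg _ _
  simpa [potential] using sub_coe_le hc h1

theorem IsNormLike.le_potential_of_notMem (hψ : IsNormLike ψ C) (hg : IsNonlin g) (hh : 0 < h)
    (hc : |c| ≤ Cf) (hx : x ∉ E) : ((-Cf : ℝ) : EReal) ≤ potential ψ g h c E x := by
  have := hψ.potential_le_of_mem hg.dual hh (c := -c) (Cf := Cf) (by rwa [abs_neg]) (show x ∈ Eᶜ from hx)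
  rw [hψ.potential_dual, EReal.neg_le] at this
  simpa using this

/-- A finite union of balls works, since submodularity keeps J finite under unions. -/
theorem exists_between_of_isCompact {J : Set (RN N) → ℝ≥0∞} (hJ : IsGeneralizedPerimeter J)
    {A U : Set (RN N)} (hA : IsCompact A) (hU : IsOpen U) (hAU : A ⊆ U) :
    ∃ F, MeasurableSet F ∧ A ⊆ F ∧ F ⊆ U ∧ Bornology.IsBounded F ∧ J F < ⊤ := by
  refine hA.induction_on (p := fun s => ∃ F, MeasurableSet F ∧ s ⊆ F ∧ F ⊆ U ∧
    Bornology.IsBounded F ∧ J F < ⊤) ?_ ?_ ?_ ?_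
  · exact ⟨∅, MeasurableSet.empty, subset_rfl, empty_subset _, Bornology.isBounded_empty,
      by simp [hJ.empty]⟩
  · rintro s t hst ⟨F, h1, h2, h3⟩
    exact ⟨F, h1, hst.trans h2, h3⟩
  · rintro s t ⟨F, h1, h2, h3, h4, h5⟩ ⟨F', h1', h2', h3', h4', h5'⟩
    exact ⟨F ∪ F', h1.union h1', union_subset_union h2 h2', union_subset h3 h3', h4.union h4',
      (le_add_self.trans (hJ.submodular F F' h1.nullMeasurableSet h1'.nullMeasurableSet)).trans_lt
        (ENNReal.add_lt_top.2 ⟨h5, h5'⟩)⟩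
  · intro x hx
    obtain ⟨r, hr, hrU⟩ := Metric.isOpen_iff.1 hU x (hAU hx)
    exact ⟨Metric.ball x r, mem_nhdsWithin_of_mem_nhds (Metric.ball_mem_nhds x hr),
      Metric.ball x r, measurableSet_ball, subset_rfl, hrU, Metric.isBounded_ball,
      (hJ.ball_ne_top x hr).lt_top⟩

/-- E itself may have J(E) = ∞, and g may be infinite immediately on one side of 0. A competitor
with finite J is fitted between a compact and an open set separated by a layer along ∂E, on the side
where g stays finite. -/
theorem IsNormLike.exists_competitor (hψ : IsNormLike ψ C) (hg : IsNonlin g)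
    {J : Set (RN N) → ℝ≥0∞} (hJ : IsGeneralizedPerimeter J) (hh : 0 < h) (hc : |c| ≤ Cf)
    (hE : Bornology.IsBounded E) : ∃ F, NullMeasurableSet F volume ∧
      functional J (posMeas (potential ψ g h c E)) (negMeas (potential ψ g h c E)) F < ⊤ := by
  obtain ⟨R, hR⟩ := hE.subset_closedBall 0
  obtain ⟨C', hC', hfar⟩ := hψ.potential_far hg Cf 0
  have key : ∀ (A U : Set (RN N)) (M₁ M₂ : ℝ), IsCompact A → IsOpen U → A ⊆ U →
      (∀ x ∈ U, potential ψ g h c E x ≤ (M₁ : EReal)) →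
      (∀ x ∉ A, ((-M₂ : ℝ) : EReal) ≤ potential ψ g h c E x) → ∃ F, NullMeasurableSet F volume ∧
      functional J (posMeas (potential ψ g h c E)) (negMeas (potential ψ g h c E)) F < ⊤ := by
    intro A U M₁ M₂ hA hU hAU h1 h2
    obtain ⟨F, hF, hAF, hFU, hFb, hJF⟩ := exists_between_of_isCompact hJ hA hU hAU
    refine ⟨F, hF.nullMeasurableSet, ?_⟩
    set D : Set (RN N) := Metric.closedBall 0 (R + C' * h)
    have e1 : posMeas (potential ψ g h c E) F ≤ ENNReal.ofReal M₁ * volume F :=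
      posMeas_le hF.nullMeasurableSet fun x hx => h1 x (hFU hx)
    have e2 : negMeas (potential ψ g h c E) (Fᶜ ∩ D) ≤ ENNReal.ofReal M₂ * volume (Fᶜ ∩ D) :=
      negMeas_le (hF.compl.inter measurableSet_closedBall).nullMeasurableSet
        fun x hx => h2 x fun hxA => hx.1 (hAF hxA)
    have e3 : negMeas (potential ψ g h c E) (Fᶜ \ D) ≤ ENNReal.ofReal 0 * volume (Fᶜ \ D) :=
      negMeas_le (hF.compl.diff measurableSet_closedBall).nullMeasurableSet fun x hx => by
        rw [neg_zero]
        refine hfar h c E x hh hc (disjoint_ball_of_subset_closedBall hR ?_)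
        have := hx.2
        rw [mem_closedBall_zero_iff, not_le] at this
        exact this.le
    rw [ENNReal.ofReal_zero, zero_mul] at e3
    unfold functional
    rw [← measure_inter_add_sdiff Fᶜ (measurableSet_closedBall (x := (0 : RN N))
      (ε := R + C' * h)), nonpos_iff_eq_zero.1 e3, add_zero]
    refine ENNReal.add_lt_top.2 ⟨ENNReal.add_lt_top.2 ⟨hJF, e1.trans_lt ?_⟩, e2.trans_lt ?_⟩
    · exact ENNReal.mul_lt_top ENNReal.ofReal_lt_top hFb.measure_lt_top
    · exact ENNReal.mul_lt_top ENNReal.ofReal_lt_top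
        ((measure_mono inter_subset_right).trans_lt measure_closedBall_lt_top)
  obtain ⟨s, hs, hs'⟩ := hg.fin
  -- In a layer of Euclidean width δ the anisotropic distance is at most s h, so g is evaluated
  -- between 0 and ±s.
  set δ := s * h / C with hδ
  have hδ0 : 0 < δ := div_pos (mul_pos hs hh) hψ.pos
  have hCδ : C * δ = s * h := by rw [hδ]; field_simp [hψ.pos.ne']
  have hnear : ∀ (A : Set (RN N)) x, x ∈ Metric.thickening δ A →
      psiDist ψ A x ≤ ((s * h : ℝ) : EReal) := fun A x hx => by
    obtain ⟨y, hy, hxy⟩ := Metric.mem_thickening_iff.1 hx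
    refine (hψ.psiDist_le hy).trans ?_
    rw [← hCδ, ← dist_eq_norm]
    exact_mod_cast mul_le_mul_of_nonneg_left hxy.le hψ.pos.le
  rcases hs' with hfin | hfin
  · have hg0 : 0 ≤ g s := by rw [← hg.zero]; exact hg.mono (by exact_mod_cast hs.le)
    lift g s to ℝ using ⟨hfin.ne, (EReal.bot_lt_zero.trans_le hg0).ne'⟩ with t ht
    refine key (closure E) (Metric.thickening δ E) (t + Cf) Cf hE.isCompact_closure
      Metric.isOpen_thickening (Metric.closure_subset_thickening hδ0 E) (fun x hx => ?_)
      fun x hx => hψ.le_potential_of_notMem hg hh hc fun h' => hx (subset_closure h')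
    refine sub_coe_le hc (ht ▸ hg.mono ?_)
    rw [EReal.div_le_iff_le_mul (by exact_mod_cast hh) (by simp), ← EReal.coe_mul, mul_comm h]
    by_cases hxE : x ∈ E
    · rw [hψ.signedDist_of_mem hxE]
      refine le_trans (b := 0) ?_ (by exact_mod_cast (mul_pos hs hh).le)
      rw [EReal.neg_le, neg_zero]
      exact hψ.psiDist_nonneg _ _
    · rw [hψ.signedDist_of_notMem hxE]; exact hnear E x hx
  · have hg0 : g ((-s : ℝ) : EReal) ≤ 0 := by
      rw [← hg.zero]; exact hg.mono (by exact_mod_cast (neg_neg_of_pos hs).le)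
    lift g ((-s : ℝ) : EReal) to ℝ using ⟨(hg0.trans_lt EReal.zero_lt_top).ne, hfin.ne'⟩ with t ht
    have hsub : (Metric.thickening δ Eᶜ)ᶜ ⊆ E :=
      compl_subset_comm.1 (Metric.self_subset_thickening hδ0 _)
    refine key (Metric.thickening δ Eᶜ)ᶜ (interior E) Cf (-(t - Cf))
      (Metric.isCompact_of_isClosed_isBounded Metric.isOpen_thickening.isClosed_compl
        (hE.subset hsub)) isOpen_interior ?_
      (fun x hx => hψ.potential_le_of_mem hg hh hc (interior_subset hx)) fun x hx => ?_
    · rw [interior_eq_compl_closure_compl]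
      exact compl_subset_compl.2 (Metric.closure_subset_thickening hδ0 _)
    rw [neg_neg]
    refine le_sub_coe hc ?_
    rw [sub_add_cancel, ht]
    refine hg.mono ?_
    rw [EReal.le_div_iff_mul_le (by exact_mod_cast hh) (by simp), ← EReal.coe_mul, neg_mul,
      EReal.coe_neg]
    by_cases hxE : x ∈ E
    · rw [hψ.signedDist_of_mem hxE, EReal.neg_le_neg_iff]
      exact hnear _ x (not_not.1 hx)
    · rw [hψ.signedDist_of_notMem hxE]
      refine le_trans (b := 0) ?_ (hψ.psiDist_nonneg _ _)
      exact_mod_cast (neg_neg_of_pos (mul_pos hs hh)).le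

theorem IsNormLike.flowData (hψ : IsNormLike ψ C) (hg : IsNonlin g)
    {J : Set (RN N) → ℝ≥0∞} {K : ℝ} (hJ : IsGeneralizedPerimeter J) (hK : 0 < K) (hCf : 0 ≤ Cf)
    (hge : ∀ ρ : ℝ, 0 < ρ → ∀ x ∈ Metric.sphere (0 : RN N) ρ,
      ((-K : ℝ) : EReal) ≤ curvPlus J x (Metric.ball 0 ρ))
    (hle : ∀ ρ : ℝ, 0 < ρ → ∃ C : ℝ, ∀ x ∈ Metric.sphere (0 : RN N) ρ,
      curvMinus J x (Metric.ball 0 ρ) ≤ (C : EReal)) :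
    FlowData J (potential ψ g) Cf K where
  perim := hJ
  K_pos := hK
  Cf_nonneg := hCf
  curv_ge := hge
  curv_le := hle
  anti h c E E' hh hE x := potential_anti hg hh hE x
  transl h c E z x := by unfold potential; rw [signedDist_image_add]
  far := hψ.potential_far hg Cf
  deep M := by
    obtain ⟨C', hC', h1⟩ := hψ.potential_far hg.dual Cf M
    refine ⟨C', hC', fun h c E x hh hc hd => ?_⟩
    have := h1 h (-c) Eᶜ x hh (by rwa [abs_neg]) (disjoint_compl_right_iff_subset.2 hd)
    rw [hψ.potential_dual, EReal.le_neg] at this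
    simpa using this
  inside h c E x hh hc hx := hψ.potential_le_of_mem hg hh hc hx
  outside h c E x hh hc hx := hψ.le_potential_of_notMem hg hh hc hx
  competitor h c E hh hc hE := by
    rcases hE with hE | hE
    · exact hψ.exists_competitor hg hJ hh hc hE
    · obtain ⟨F, hF, h1⟩ := hψ.exists_competitor hg.dual hJ.dual hh (c := -c) (Cf := Cf)
        (by rwa [abs_neg]) hE
      refine ⟨Fᶜ, hF.compl, ?_⟩
      have e : potential ψ (fun s => -g (-s)) h (-c) Eᶜ = fun x => -potential ψ g h c E x :=
        funext fun x => hψ.potential_dual g h c E x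
      rw [e, negMeas_neg, ← compl_compl F, functional_compl] at h1
      exact h1

end Potential

/-! ### The incremental problems in terms of the functional -/

theorem toENNReal_sub_add {u : EReal} (hu : 0 ≤ u) (c : ℝ) :
    (u - (c : EReal)).toENNReal + ENNReal.ofReal c =
      u.abs + ENNReal.ofReal (-c) + (-(u - (c : EReal))).toENNReal := by
  induction u with
  | bot => simp at hu
  | top => simp
  | coe t =>
    have ht : 0 ≤ t := by exact_mod_cast hu
    rw [← EReal.coe_sub, ← EReal.coe_neg, EReal.real_coe_toENNReal, EReal.real_coe_toENNReal,
      EReal.abs_def, abs_of_nonneg ht]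
    simp only [ENNReal.ofReal]
    norm_cast
    rw [← NNReal.coe_inj]
    push_cast
    simp only [Real.coe_toNNReal', max_def]
    split_ifs <;> linarith

theorem toENNReal_neg_sub_add {u : EReal} (hu : u ≤ 0) (c : ℝ) :
    (-(u - (c : EReal))).toENNReal + ENNReal.ofReal (-c) =
      u.abs + ENNReal.ofReal c + (u - (c : EReal)).toENNReal := by
  have e : -u - ((-c : ℝ) : EReal) = -(u - (c : EReal)) := by
    rw [EReal.neg_sub (Or.inr (EReal.coe_ne_bot c)) (Or.inr (EReal.coe_ne_top c)), EReal.coe_neg,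
      sub_eq_add_neg, neg_neg]
  have := toENNReal_sub_add (u := -u) (by rwa [EReal.neg_nonneg]) (-c)
  rwa [e, neg_neg, neg_neg, EReal.abs_neg] at this

section Link

variable {ψ : RN N → ℝ} {g : EReal → EReal} {C Cf K h c : ℝ} {E F : Set (RN N)} {x : RN N}
  {J : Set (RN N) → ℝ≥0∞}

theorem IsNormLike.measurable_speed (hψ : IsNormLike ψ C) (hg : IsNonlin g) (hh : 0 < h)
    (E : Set (RN N)) : Measurable fun x => g (signedDist ψ E x / (h : EReal)) :=
  hg.mono.measurable.comp
    ((show Monotone fun a : EReal => a / (h : EReal) from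
      fun _ _ hab => div_le_div_ereal hh hab).measurable.comp (hψ.measurable_signedDist E))

theorem IsNormLike.measurable_potential (hψ : IsNormLike ψ C) (hg : IsNonlin g) (hh : 0 < h)
    (c : ℝ) (E : Set (RN N)) : Measurable (potential ψ g h c E) :=
  (show Monotone fun a : EReal => a - (c : EReal) from
    fun _ _ hab => EReal.sub_le_sub hab le_rfl).measurable.comp (hψ.measurable_speed hg hh E)

theorem IsNormLike.speed_nonpos (hψ : IsNormLike ψ C) (hg : IsNonlin g) (hh : 0 < h)
    (hx : x ∈ E) : g (signedDist ψ E x / (h : EReal)) ≤ 0 := by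
  have := hψ.potential_le_of_mem hg hh (c := 0) (Cf := 0) (by simp) hx
  simpa [potential] using this

theorem IsNormLike.speed_nonneg (hψ : IsNormLike ψ C) (hg : IsNonlin g) (hh : 0 < h)
    (hx : x ∉ E) : 0 ≤ g (signedDist ψ E x / (h : EReal)) := by
  have := hψ.le_potential_of_notMem hg hh (c := 0) (Cf := 0) (by simp) hx
  simpa [potential] using this

/-- On F \ E and on E \ F the sign of g(sd/h) is known, so v⁺ - v⁻ = g - c becomes a pointwise
identity of nonnegative quantities. Writing c = c⁺ - c⁻ and moving negative terms across keeps it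
valid with infinite values. -/
theorem IsNormLike.functional_add (hψ : IsNormLike ψ C) (hg : IsNonlin g) (hh : 0 < h)
    (c : ℝ) (hE : MeasurableSet E) (hF : NullMeasurableSet F volume) :
    functional J (posMeas (potential ψ g h c E)) (negMeas (potential ψ g h c E)) F +
      (ENNReal.ofReal c * volume F + ENNReal.ofReal (-c) * volume E) =
    (J F + ∫⁻ x in symmDiff E F, (g (signedDist ψ E x / (h : EReal))).abs) +
      (ENNReal.ofReal (-c) * volume F + ENNReal.ofReal c * volume E +
        (negMeas (potential ψ g h c E) Eᶜ + posMeas (potential ψ g h c E) E)) := by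
  set v := potential ψ g h c E with hv
  have hvm : Measurable v := hψ.measurable_potential hg hh c E
  have hp : Measurable fun x => (v x).toENNReal := measurable_ereal_toENNReal.comp hvm
  have hn : Measurable fun x => (-v x).toENNReal :=
    measurable_ereal_toENNReal.comp (continuous_neg.measurable.comp hvm)
  set ω : Measure (RN N) :=
    volume.withDensity fun x => (g (signedDist ψ E x / (h : EReal))).abs with hω
  have hω' : ∀ s, ω s = ∫⁻ x in s, (g (signedDist ψ E x / (h : EReal))).abs :=
    fun s => withDensity_apply' _ _
  have h1 : posMeas v (F \ E) + ENNReal.ofReal c * volume (F \ E) =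
      ω (F \ E) + ENNReal.ofReal (-c) * volume (F \ E) + negMeas v (F \ E) := by
    rw [negMeas, posMeas_apply, posMeas_apply, hω', ← setLIntegral_const, ← setLIntegral_const,
      ← lintegral_add_right _ measurable_const, ← lintegral_add_right _ measurable_const,
      ← lintegral_add_right _ hn]
    refine lintegral_congr_ae ?_
    filter_upwards [ae_restrict_mem₀ (hF.diff hE.nullMeasurableSet)] with x hx
    exact toENNReal_sub_add (hψ.speed_nonneg hg hh hx.2) c
  have h2 : negMeas v (E \ F) + ENNReal.ofReal (-c) * volume (E \ F) =
      ω (E \ F) + ENNReal.ofReal c * volume (E \ F) + posMeas v (E \ F) := by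
    rw [negMeas, posMeas_apply, posMeas_apply, hω', ← setLIntegral_const, ← setLIntegral_const,
      ← lintegral_add_right _ measurable_const, ← lintegral_add_right _ measurable_const,
      ← lintegral_add_right _ hp]
    refine lintegral_congr_ae ?_
    filter_upwards [ae_restrict_mem₀ (hE.nullMeasurableSet.diff hF)] with x hx
    exact toENNReal_neg_sub_add (hψ.speed_nonpos hg hh hx.1) c
  have e1 : posMeas v F = posMeas v (E ∩ F) + posMeas v (F \ E) := by
    rw [inter_comm, measure_inter_add_sdiff F hE]
  have e2 : posMeas v E = posMeas v (E ∩ F) + posMeas v (E \ F) :=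
    (measure_inter_add_sdiff₀ E (hF.mono_ac (posMeas_ac v))).symm
  have e3 : negMeas v Fᶜ = negMeas v (E \ F) + negMeas v (Fᶜ ∩ Eᶜ) := by
    rw [← measure_inter_add_sdiff Fᶜ hE, inter_comm, ← sdiff_eq, ← sdiff_eq]
  have e4 : negMeas v Eᶜ = negMeas v (F \ E) + negMeas v (Fᶜ ∩ Eᶜ) := by
    rw [← measure_inter_add_sdiff₀ Eᶜ (hF.mono_ac (negMeas_ac v)), inter_comm, ← sdiff_eq,
      inter_comm Fᶜ, ← sdiff_eq Eᶜ]
  have e5 : volume F = volume (E ∩ F) + volume (F \ E) := by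
    rw [inter_comm, measure_inter_add_sdiff F hE]
  have e6 : volume E = volume (E ∩ F) + volume (E \ F) := (measure_inter_add_sdiff₀ E hF).symm
  have e7 : (∫⁻ x in symmDiff E F, (g (signedDist ψ E x / (h : EReal))).abs) =
      ω (E \ F) + ω (F \ E) := by
    rw [← hω', ← measure_inter_add_sdiff (symmDiff E F) hE]
    congr 2 <;> ext y <;> simp only [mem_inter_iff, Set.mem_sdiff, mem_symmDiff] <;> tauto
  unfold functional
  rw [e7, e1, e2, e3, e4, e5, e6]
  calc _ = J F + (posMeas v (F \ E) + ENNReal.ofReal c * volume (F \ E)) +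
        (negMeas v (E \ F) + ENNReal.ofReal (-c) * volume (E \ F)) +
        (posMeas v (E ∩ F) + negMeas v (Fᶜ ∩ Eᶜ) +
          (ENNReal.ofReal c + ENNReal.ofReal (-c)) * volume (E ∩ F)) := by ring
    _ = _ := by rw [h1, h2]; ring

theorem IsNormLike.exists_energy_eq (hψ : IsNormLike ψ C) (hg : IsNonlin g) (J : Set (RN N) → ℝ≥0∞)
    (hh : 0 < h) (hc : |c| ≤ Cf) (hE : MeasurableSet E) (hEb : Bornology.IsBounded E) :
    ∃ A : ℝ, ∀ F, NullMeasurableSet F volume →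
      ((functional J (posMeas (potential ψ g h c E)) (negMeas (potential ψ g h c E)) F : ℝ≥0∞) :
        EReal) = energy J ψ g h c E F + (A : EReal) := by
  obtain ⟨R, hR⟩ := hEb.subset_closedBall 0
  set v := potential ψ g h c E
  have hEfin : volume E ≠ ⊤ := hEb.measure_lt_top.ne
  have hμE : posMeas v E ≠ ⊤ := ne_top_of_le_ne_top
    (ENNReal.mul_ne_top ENNReal.ofReal_ne_top hEfin)
    (posMeas_le hE.nullMeasurableSet fun x hx => hψ.potential_le_of_mem hg hh hc hx)
  have hνE : negMeas v Eᶜ ≠ ⊤ := by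
    obtain ⟨C', hC', hfar⟩ := hψ.potential_far hg Cf 0
    rw [← measure_inter_add_sdiff Eᶜ (measurableSet_closedBall (x := (0 : RN N))
      (ε := R + C' * h))]
    refine ENNReal.add_ne_top.2 ⟨ne_top_of_le_ne_top ?_ (negMeas_le (M := Cf)
      (hE.compl.inter measurableSet_closedBall).nullMeasurableSet fun x hx =>
        hψ.le_potential_of_notMem hg hh hc hx.1), ne_top_of_le_ne_top ?_ (negMeas_le (M := 0)
      (hE.compl.diff measurableSet_closedBall).nullMeasurableSet fun x hx => ?_)⟩
    · exact ENNReal.mul_ne_top ENNReal.ofReal_ne_top (ne_top_of_le_ne_top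
        measure_closedBall_lt_top.ne (measure_mono inter_subset_right))
    · simp
    · rw [neg_zero]
      refine hfar h c E x hh hc (disjoint_ball_of_subset_closedBall hR ?_)
      have := hx.2
      rw [mem_closedBall_zero_iff, not_le] at this
      exact this.le
  refine ⟨(negMeas v Eᶜ).toReal + (posMeas v E).toReal + c * (volume E).toReal, fun F hF => ?_⟩
  unfold energy
  split_ifs with hFt
  -- The convention for |F| = ∞ is consistent: the potential is at least 1 far from E, so the
  -- functional is infinite too.
  · have : posMeas v F = ⊤ := by
      by_contra hne
      obtain ⟨C', hC', hfar⟩ := hψ.potential_far hg Cf 1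
      exact volume_ne_top_of_posMeas (R := R + C' * h) hF
        (fun x hx => hfar h c _ x hh hc (disjoint_ball_of_subset_closedBall hR hx.le)) hne hFt
    simp only [functional, this]
    rw [add_top, top_add, EReal.coe_ennreal_top, EReal.top_add_coe]
  · have h1 := hψ.functional_add (J := J) hg hh c hE hF
    set X := J F + ∫⁻ x in symmDiff E F, (g (signedDist ψ E x / (h : EReal))).abs
    set Y := functional J (posMeas v) (negMeas v) F
    have hcF : ∀ a : ℝ, ENNReal.ofReal a * volume F ≠ ⊤ :=
      fun a => ENNReal.mul_ne_top ENNReal.ofReal_ne_top hFt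
    have hcE : ∀ a : ℝ, ENNReal.ofReal a * volume E ≠ ⊤ :=
      fun a => ENNReal.mul_ne_top ENNReal.ofReal_ne_top hEfin
    have ha := ENNReal.add_ne_top.2 ⟨hcF c, hcE (-c)⟩
    have hb := ENNReal.add_ne_top.2 ⟨ENNReal.add_ne_top.2 ⟨hcF (-c), hcE c⟩,
      ENNReal.add_ne_top.2 ⟨hνE, hμE⟩⟩
    by_cases hX : X = ⊤
    · have hY : Y = ⊤ := by
        by_contra hY
        exact ENNReal.add_ne_top.2 ⟨hY, ha⟩ (h1.trans (by rw [hX, top_add]))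
      rw [hX, hY, EReal.coe_ennreal_top, EReal.top_sub_coe, EReal.top_add_coe]
    · have hY : Y ≠ ⊤ := fun hY => ENNReal.add_ne_top.2 ⟨hX, hb⟩ (by
        rw [← h1, hY, top_add])
      have h2 := congrArg ENNReal.toReal h1
      rw [ENNReal.toReal_add hY ha, ENNReal.toReal_add hX hb, ENNReal.toReal_add (hcF _) (hcE _),
        ENNReal.toReal_add (ENNReal.add_ne_top.2 ⟨hcF _, hcE _⟩)
          (ENNReal.add_ne_top.2 ⟨hνE, hμE⟩), ENNReal.toReal_add (hcF _) (hcE _),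
        ENNReal.toReal_add hνE hμE] at h2
      simp only [ENNReal.toReal_mul, ENNReal.toReal_ofReal'] at h2
      rw [← EReal.coe_ennreal_toReal hX, ← EReal.coe_ennreal_toReal hY, ← EReal.coe_sub,
        ← EReal.coe_add, EReal.coe_eq_coe_iff]
      have h3 : max c 0 = c + max (-c) 0 := by
        simp only [max_def]; split_ifs <;> linarith
      rw [h3] at h2
      linarith

theorem IsNormLike.isMinimizer_iff (hψ : IsNormLike ψ C) (hg : IsNonlin g)
    (hJ : IsGeneralizedPerimeter J)
    (hh : 0 < h) (hc : |c| ≤ Cf) (hE : MeasurableSet E) (hEb : Bornology.IsBounded E) :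
    IsMinimizer J ψ g h c E F ↔ StepMin J (potential ψ g) h c E F := by
  obtain ⟨A, hA⟩ := hψ.exists_energy_eq hg J hh hc hE hEb
  have hiff : ∀ F F', NullMeasurableSet F volume → NullMeasurableSet F' volume →
      (energy J ψ g h c E F ≤ energy J ψ g h c E F' ↔
        functional J (posMeas (potential ψ g h c E)) (negMeas (potential ψ g h c E)) F ≤
        functional J (posMeas (potential ψ g h c E)) (negMeas (potential ψ g h c E)) F') := by
    intro F F' hF hF'
    rw [← EReal.coe_ennreal_le_coe_ennreal_iff, hA F hF, hA F' hF']
    refine ⟨fun h => add_le_add_left h _, fun h => ?_⟩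
    have := EReal.sub_le_sub h (le_refl (A : EReal))
    rwa [EReal.add_sub_cancel_right, EReal.add_sub_cancel_right] at this
  constructor
  · rintro ⟨h1, h2⟩
    obtain ⟨F', hF', hlt⟩ := hψ.exists_competitor hg hJ hh hc hEb
    have h3 := fun F' hF' => (hiff F F' h1 hF').1 (h2 F' hF')
    exact ⟨h1, h3, ((h3 F' hF').trans_lt hlt).ne⟩
  · rintro ⟨h1, h2, -⟩
    exact ⟨h1, fun F' hF' => (hiff F F' h1 hF').2 (h2 F' hF')⟩

theorem IsNormLike.isMinimalMinimizer_iff (hψ : IsNormLike ψ C) (hg : IsNonlin g)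
    (hJ : IsGeneralizedPerimeter J)
    (hh : 0 < h) (hc : |c| ≤ Cf) (hE : MeasurableSet E) (hEb : Bornology.IsBounded E) :
    IsMinimalMinimizer J ψ g h c E F ↔ MinimalStep J (potential ψ g) h c E F := by
  simp only [IsMinimalMinimizer, MinimalStep, hψ.isMinimizer_iff hg hJ hh hc hE hEb]

theorem IsNormLike.stepMin_dual_iff (hψ : IsNormLike ψ C) (g : EReal → EReal) (h c : ℝ)
    (E F : Set (RN N)) :
    StepMin (fun A => J Aᶜ) (potential ψ fun s => -g (-s)) h (-c) Eᶜ F ↔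
      StepMin J (potential ψ g) h c E Fᶜ := by
  have e : potential ψ (fun s => -g (-s)) h (-c) Eᶜ = fun x => -potential ψ g h c E x :=
    funext fun x => hψ.potential_dual g h c E x
  unfold StepMin
  rw [e, negMeas_neg]
  refine ⟨fun hF => ?_, fun hF => ?_⟩
  · have := hF.compl
    simp only [compl_compl] at this
    exact this
  · have := hF.compl
    rw [compl_compl] at this
    exact this

theorem IsNormLike.isMaximalMinimizer_dual_iff (hψ : IsNormLike ψ C) (hg : IsNonlin g)
    (hJ : IsGeneralizedPerimeter J)
    (hh : 0 < h) (hc : |c| ≤ Cf) (hE : MeasurableSet E) (hEb : Bornology.IsBounded Eᶜ) :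
    IsMaximalMinimizer (fun A => J Aᶜ) ψ (fun s => -g (-s)) h (-c) Eᶜ F ↔
      MinimalStep J (potential ψ g) h c E Fᶜ := by
  simp only [IsMaximalMinimizer, MinimalStep,
    hψ.isMinimizer_iff hg.dual hJ.dual hh (c := -c) (Cf := Cf) (by rwa [abs_neg]) hE.compl hEb,
    hψ.stepMin_dual_iff]
  refine and_congr_right fun _ => ⟨fun h F' hF' => ?_, fun h F' hF' => ?_⟩
  · have := h F'ᶜ (by rwa [compl_compl])
    rwa [sdiff_eq, inter_comm, ← sdiff_eq] at this
  · have := h _ hF'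
    rwa [Set.sdiff_eq, inter_comm, compl_compl, ← Set.sdiff_eq] at this

end Link

/-! ### Points of density one -/

theorem densityOne_mono {F F' : Set (RN N)} (h : volume (F \ F') = 0) :
    densityOne F ⊆ densityOne F' := by
  intro x hx
  refine tendsto_of_tendsto_of_tendsto_of_le_of_le hx tendsto_const_nhds (fun r => ?_) fun r => ?_
  · refine ENNReal.div_le_div_right ?_ _
    refine measure_mono_ae ?_
    have : ∀ᵐ y, y ∉ F \ F' := measure_eq_zero_iff_ae_notMem.1 h
    filter_upwards [this] with y hy hyF
    exact ⟨not_not.1 fun h' => hy ⟨hyF.1, h'⟩, hyF.2⟩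
  · exact ENNReal.div_le_of_le_mul (by rw [one_mul]; exact measure_mono inter_subset_right)

theorem subset_densityOne {U F : Set (RN N)} (hU : IsOpen U) (h : volume (U \ F) = 0) :
    U ⊆ densityOne F := by
  intro x hx
  obtain ⟨ε, hε, hsub⟩ := Metric.isOpen_iff.1 hU x hx
  refine (tendsto_congr' ?_).2 tendsto_const_nhds
  filter_upwards [Ioo_mem_nhdsGT hε] with r hr
  have h1 : volume (F ∩ Metric.ball x r) = volume (Metric.ball x r) := by
    refine le_antisymm (measure_mono inter_subset_right) (measure_mono_ae ?_)
    have : ∀ᵐ y, y ∉ U \ F := measure_eq_zero_iff_ae_notMem.1 h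
    filter_upwards [this] with y hy hyb
    exact ⟨not_not.1 fun h' => hy ⟨hsub (Metric.ball_subset_ball hr.2.le hyb), h'⟩, hyb⟩
  rw [h1, ENNReal.div_self (Metric.measure_ball_pos _ _ hr.1).ne' measure_ball_lt_top.ne]

theorem disjoint_densityOne {U F : Set (RN N)} (hU : IsOpen U) (h : volume (U ∩ F) = 0) :
    Disjoint U (densityOne F) := by
  rw [Set.disjoint_left]
  intro x hx hxF
  obtain ⟨ε, hε, hsub⟩ := Metric.isOpen_iff.1 hU x hx
  refine zero_ne_one (tendsto_nhds_unique ((tendsto_congr' ?_).2 tendsto_const_nhds) hxF)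
  filter_upwards [Ioo_mem_nhdsGT hε] with r hr
  have h1 : volume (F ∩ Metric.ball x r) = 0 :=
    measure_mono_null (t := U ∩ F)
      (fun y hy => ⟨hsub (Metric.ball_subset_ball hr.2.le hy.2), hy.1⟩) h
  rw [h1, ENNReal.zero_div]

theorem densityOne_image_add (z : RN N) (F : Set (RN N)) :
    densityOne ((fun y => z + y) '' F) = (fun y => z + y) '' densityOne F := by
  have key : ∀ x r, volume (((fun y => z + y) '' F) ∩ Metric.ball (z + x) r) =
      volume (F ∩ Metric.ball x r) := fun x r => by
    rw [← volume_image_add z (F ∩ _), image_inter (add_right_injective z)]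
    congr 2
    simp [add_comm z x]
  ext x
  rw [Set.image_add_left (t := densityOne F), mem_preimage]
  unfold densityOne
  rw [Set.mem_ofPred_eq, Set.mem_ofPred_eq]
  refine tendsto_congr fun r => ?_
  rw [← key, add_neg_cancel_left, Measure.addHaar_ball_center, Measure.addHaar_ball_center _ (-z + x)]

/-! ### The set operators -/

/-- `T` is the operator associated with the incremental problems: it maps `E` to the points of
density one of the minimal minimizer. -/
def IsStepOp (J : Set (RN N) → ℝ≥0∞) (V : ℝ → ℝ → Set (RN N) → RN N → EReal) (h c : ℝ)
    (T : Set (RN N) → Set (RN N)) : Prop :=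
  ∀ E, MeasurableSet E → Bornology.IsBounded E ∨ Bornology.IsBounded Eᶜ →
    ∃ F, MinimalStep J V h c E F ∧ T E = densityOne F

/-- The complement of the maximal minimizer of the dual problem is the minimal minimizer of the
original one, so both branches of `setStep` solve the same problem. Minimal minimizers agree up to
null sets, hence have the same density points. -/
theorem IsNormLike.isStepOp_setStep {ψ : RN N → ℝ} {g : EReal → EReal} {C Cf K h t : ℝ}
    {J : Set (RN N) → ℝ≥0∞} (hψ : IsNormLike ψ C) (hg : IsNonlin g)
    (H : FlowData J (potential ψ g) Cf K) (hh : 0 < h) (f : ℝ → ℝ)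
    (hc : |meanForcing f h ⌊t / h⌋₊| ≤ Cf) :
    IsStepOp J (potential ψ g) h (meanForcing f h ⌊t / h⌋₊) (setStep J ψ g f h t) := by
  intro E hE hEb
  obtain ⟨F, hF⟩ := H.exists_minimal hh hc hEb
  refine ⟨F, hF, ?_⟩
  have huniq : ∀ F', MinimalStep J (potential ψ g) h (meanForcing f h ⌊t / h⌋₊) E F' →
      densityOne F' = densityOne F := fun F' hF' =>
    subset_antisymm (densityOne_mono (hF'.2 F hF.1)) (densityOne_mono (hF.2 F' hF'.1))
  unfold setStep
  split_ifs with hb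
  · ext x
    unfold stepBounded
    rw [Set.mem_ofPred_eq]
    constructor
    · rintro ⟨F', hF', hx⟩
      rw [hψ.isMinimalMinimizer_iff hg H.perim hh hc hE hb] at hF'
      rwa [← huniq F' hF']
    · exact fun hx => ⟨F, (hψ.isMinimalMinimizer_iff hg H.perim hh hc hE hb).2 hF, hx⟩
  · have hb' := hEb.resolve_left hb
    ext x
    unfold stepUnbounded
    rw [Set.mem_ofPred_eq]
    constructor
    · rintro ⟨F', hF', hx⟩
      rw [hψ.isMaximalMinimizer_dual_iff hg H.perim hh hc hE hb'] at hF'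
      rwa [← huniq _ hF']
    · intro hx
      refine ⟨Fᶜ, (hψ.isMaximalMinimizer_dual_iff hg H.perim hh hc hE hb').2 ?_, ?_⟩
      · rwa [compl_compl]
      · rwa [compl_compl]

section StepOp

variable {J : Set (RN N) → ℝ≥0∞} {V : ℝ → ℝ → Set (RN N) → RN N → EReal} {Cf K h c : ℝ}
  {E E' : Set (RN N)} {T : Set (RN N) → Set (RN N)}

theorem IsStepOp.mono (hT : IsStepOp J V h c T) (H : FlowData J V Cf K) (hh : 0 < h)
    (hE : MeasurableSet E) (hEb : Bornology.IsBounded E ∨ Bornology.IsBounded Eᶜ)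
    (hE' : MeasurableSet E') (hEb' : Bornology.IsBounded E' ∨ Bornology.IsBounded E'ᶜ)
    (hEE : E ⊆ E') : T E ⊆ T E' := by
  obtain ⟨F, hF, e⟩ := hT E hE hEb
  obtain ⟨F', hF', e'⟩ := hT E' hE' hEb'
  rw [e, e']
  exact densityOne_mono (H.minimal_subset hh hEE hF hF'.1)

theorem IsStepOp.translate (hT : IsStepOp J V h c T) (H : FlowData J V Cf K) (z : RN N)
    (hE : MeasurableSet E) (hEb : Bornology.IsBounded E ∨ Bornology.IsBounded Eᶜ)
    (hE' : MeasurableSet ((fun y => z + y) '' E))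
    (hEb' : Bornology.IsBounded ((fun y => z + y) '' E) ∨
      Bornology.IsBounded ((fun y => z + y) '' E)ᶜ) :
    T ((fun y => z + y) '' E) = (fun y => z + y) '' T E := by
  obtain ⟨F, hF, e⟩ := hT E hE hEb
  obtain ⟨F', hF', e'⟩ := hT _ hE' hEb'
  have hF2 := hF.translate H z
  rw [e, e', ← densityOne_image_add]
  exact subset_antisymm (densityOne_mono (hF'.2 _ hF2.1)) (densityOne_mono (hF2.2 _ hF'.1))

/-- Every point is far from the empty set, so the potential is at least 1 everywhere: ∅ costs
nothing and F costs at least |F|. -/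
theorem FlowData.volume_eq_zero_of_empty (H : FlowData J V Cf K) (hh : 0 < h) (hc : |c| ≤ Cf)
    {F : Set (RN N)} (hF : StepMin J V h c ∅ F) : volume F = 0 := by
  obtain ⟨C, hC, hfar⟩ := H.far 1
  have hv : ∀ x, ((1 : ℝ) : EReal) ≤ V h c ∅ x := fun x => hfar h c ∅ x hh hc (disjoint_empty _)
  have h1 : negMeas (V h c ∅) univ ≤ ENNReal.ofReal 0 * volume (univ : Set (RN N)) :=
    negMeas_le nullMeasurableSet_univ fun x _ =>
      le_trans (by exact_mod_cast (by norm_num : (-0 : ℝ) ≤ 1)) (hv x)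
  have h2 : functional J (posMeas (V h c ∅)) (negMeas (V h c ∅)) F ≤ 0 := by
    refine (hF.le ∅ nullMeasurableSet_empty).trans ?_
    unfold functional
    rw [compl_empty, H.perim.empty, measure_empty, zero_add, zero_add]
    simpa using h1
  have h3 : posMeas (V h c ∅) F ≤ 0 := by
    refine le_trans ?_ h2
    unfold functional
    rw [add_right_comm]; exact le_add_self
  have h4 := (le_posMeas hF.meas fun x _ => hv x).trans h3
  simpa using h4

theorem IsStepOp.empty (hT : IsStepOp J V h c T) (H : FlowData J V Cf K) (hh : 0 < h)
    (hc : |c| ≤ Cf) : T ∅ = ∅ := by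
  obtain ⟨F, hF, e⟩ := hT ∅ MeasurableSet.empty (Or.inl Bornology.isBounded_empty)
  have := disjoint_densityOne (F := F) isOpen_univ
    (by rw [univ_inter]; exact H.volume_eq_zero_of_empty hh hc hF.1)
  rw [e]
  exact univ_disjoint.1 this

theorem IsStepOp.univ (hT : IsStepOp J V h c T) (H' : FlowData (fun A => J Aᶜ) (dualV V) Cf K)
    (hh : 0 < h) (hc : |c| ≤ Cf) : T univ = univ := by
  obtain ⟨F, hF, e⟩ := hT Set.univ MeasurableSet.univ (Or.inr (by simp))
  have h1 := hF.1.dual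
  rw [compl_univ] at h1
  have h2 := H'.volume_eq_zero_of_empty hh (by rwa [abs_neg]) h1
  rw [e]
  exact univ_subset_iff.1 (subset_densityOne isOpen_univ (by rwa [← compl_eq_univ_sdiff]))

theorem FlowData.stepOp_subset (H : FlowData J V Cf K) : ∃ C, 0 < C ∧ ∀ h c T E R, 0 < h →
    |c| ≤ Cf → IsStepOp J V h c T → 0 ≤ R → MeasurableSet E → E ⊆ Metric.closedBall 0 R →
    T E ⊆ Metric.closedBall 0 (R + C * h) := by
  obtain ⟨C, hC, hgrow⟩ := H.growth
  refine ⟨C, hC, fun h c T E R hh hc hT hR hE hER => ?_⟩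
  obtain ⟨F, hF, e⟩ := hT E hE (Or.inl (Metric.isBounded_closedBall.subset hER))
  have h1 := hgrow h c E F R hh hc hR hER hF.1
  have := disjoint_densityOne (F := F)
    (Metric.isClosed_closedBall (x := (0 : RN N)) (ε := R + C * h)).isOpen_compl
    (by rwa [inter_comm, ← sdiff_eq])
  rw [e]
  exact disjoint_compl_left_iff_subset.1 this

theorem FlowData.compl_subset_stepOp (H' : FlowData (fun A => J Aᶜ) (dualV V) Cf K) :
    ∃ C, 0 < C ∧ ∀ h c T E R, 0 < h →
    |c| ≤ Cf → IsStepOp J V h c T → 0 ≤ R → MeasurableSet E → Eᶜ ⊆ Metric.closedBall 0 R →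
    (Metric.closedBall 0 (R + C * h))ᶜ ⊆ T E := by
  obtain ⟨C, hC, hgrow⟩ := H'.growth
  refine ⟨C, hC, fun h c T E R hh hc hT hR hE hER => ?_⟩
  obtain ⟨F, hF, e⟩ := hT E hE (Or.inr (Metric.isBounded_closedBall.subset hER))
  have h1 := hgrow h (-c) Eᶜ Fᶜ R hh (by rwa [abs_neg]) hR hER hF.1.dual
  rw [e]
  refine subset_densityOne Metric.isClosed_closedBall.isOpen_compl ?_
  rwa [sdiff_eq, inter_comm, ← sdiff_eq]

theorem image_add_ball (p : RN N) (r : ℝ) :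
    (fun y => p + y) '' Metric.ball 0 r = Metric.ball p r := by
  simp

/-- Comparison with the evolution of the ball itself, translated to the origin. -/
theorem FlowData.ball_subset_stepOp (H : FlowData J V Cf K) {r₀ : ℝ} (hr₀ : 0 < r₀) :
    ∃ C, 0 < C ∧ ∃ h₀, 0 < h₀ ∧ ∀ h c T E p R, 0 < h → h ≤ h₀ → |c| ≤ Cf → IsStepOp J V h c T →
      MeasurableSet E → Bornology.IsBounded E ∨ Bornology.IsBounded Eᶜ → r₀ ≤ R →
      Metric.ball p R ⊆ E → Metric.ball p (R - C * h) ⊆ T E := by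
  obtain ⟨C, hC, h₀, hh₀, hs⟩ := H.shrink hr₀
  refine ⟨C, hC, h₀, hh₀, fun h c T E p R hh hhh₀ hc hT hE hEb hR hsub => ?_⟩
  obtain ⟨F, hF, e⟩ := hT E hE hEb
  obtain ⟨A, hA⟩ := H.exists_minimal (E := Metric.ball 0 R) hh hc (Or.inl Metric.isBounded_ball)
  have h1 := hs h c R A hh hhh₀ hc hR hA.1
  have h2 := hA.translate H p
  rw [image_add_ball] at h2
  have h3 := H.minimal_subset hh hsub h2 hF.1
  rw [← volume_image_add p, image_sdiff (add_right_injective p), image_add_ball] at h1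
  rw [e]
  exact subset_densityOne Metric.isOpen_ball
    (measure_mono_null (sdiff_triangle _ _ _) (measure_union_null h1 h3))

/-- E is compared with the complement of the ball, whose evolution is controlled by
`FlowData.shrink` for the dual data. -/
theorem FlowData.disjoint_ball_stepOp (H : FlowData J V Cf K)
    (H' : FlowData (fun A => J Aᶜ) (dualV V) Cf K) {r₀ : ℝ} (hr₀ : 0 < r₀) :
    ∃ C, 0 < C ∧ ∃ h₀, 0 < h₀ ∧ ∀ h c T E p R, 0 < h → h ≤ h₀ → |c| ≤ Cf → IsStepOp J V h c T →
      MeasurableSet E → Bornology.IsBounded E ∨ Bornology.IsBounded Eᶜ → r₀ ≤ R →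
      Disjoint (Metric.ball p R) E → Disjoint (Metric.ball p (R - C * h)) (T E) := by
  obtain ⟨C, hC, h₀, hh₀, hs⟩ := H'.shrink hr₀
  refine ⟨C, hC, h₀, hh₀, fun h c T E p R hh hhh₀ hc hT hE hEb hR hdis => ?_⟩
  obtain ⟨F, hF, e⟩ := hT E hE hEb
  obtain ⟨A, hA⟩ := H.exists_minimal (E := (Metric.ball 0 R)ᶜ) hh hc
    (Or.inr (by rw [compl_compl]; exact Metric.isBounded_ball))
  have h0 := hA.1.dual
  rw [compl_compl] at h0
  have h1 := hs h (-c) R Aᶜ hh hhh₀ (by rwa [abs_neg]) hR h0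
  have h2 := hA.1.translate H p
  rw [image_add_compl, image_add_ball] at h2
  have h3 := H.minimal_subset hh hdis.subset_compl_left hF h2
  rw [sdiff_compl, ← volume_image_add p, image_inter (add_right_injective p), image_add_ball] at h1
  rw [e]
  refine disjoint_densityOne Metric.isOpen_ball
    (measure_mono_null (t := _ ∪ _) (fun y hy => ?_) (measure_union_null h1 h3))
  by_cases hyA : y ∈ (fun y => p + y) '' A
  · exact Or.inl ⟨hy.1, hyA⟩
  · exact Or.inr ⟨hy.2, hyA⟩

end StepOp

/-! ### The operators on functions -/

/-- The operator on functions induced by an operator on sets. -/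
def funOp (T : Set (RN N) → Set (RN N)) (u : RN N → ℝ) (x : RN N) : ℝ :=
  sSup {s : ℝ | x ∈ T {y | s ≤ u y}}

/-- Continuous functions with values in `[-M, M]`, constant outside a ball. -/
structure IsAdmissibleFun (u : RN N → ℝ) (a R M : ℝ) : Prop where
  cont : Continuous u
  const : ∀ x, R < ‖x‖ → u x = a
  bound : ∀ x, |u x| ≤ M
  radius : 0 ≤ R

theorem isBounded_image_add (z : RN N) {E : Set (RN N)} (hE : Bornology.IsBounded E) :
    Bornology.IsBounded ((fun y => z + y) '' E) := by
  obtain ⟨R, hR⟩ := hE.subset_closedBall 0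
  refine (Metric.isBounded_closedBall (x := (0 : RN N)) (r := ‖z‖ + R)).subset ?_
  rintro _ ⟨y, hy, rfl⟩
  have := mem_closedBall_zero_iff.1 (hR hy)
  rw [mem_closedBall_zero_iff]
  exact (norm_add_le z y).trans (by gcongr)

theorem isBounded_or_image_add (z : RN N) {E : Set (RN N)}
    (hE : Bornology.IsBounded E ∨ Bornology.IsBounded Eᶜ) :
    Bornology.IsBounded ((fun y => z + y) '' E) ∨
      Bornology.IsBounded ((fun y => z + y) '' E)ᶜ := by
  rw [← image_add_compl]
  exact hE.imp (isBounded_image_add z) (isBounded_image_add z)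

theorem measurableSet_image_add (z : RN N) {E : Set (RN N)} (hE : MeasurableSet E) :
    MeasurableSet ((fun y => z + y) '' E) := by
  rw [Set.image_add_left]
  exact measurable_const_add (-z) hE

namespace IsAdmissibleFun

variable {u : RN N → ℝ} {a R M : ℝ}

theorem measurableSet_superlevel (hu : IsAdmissibleFun u a R M) (s : ℝ) :
    MeasurableSet {y | s ≤ u y} :=
  (isClosed_le continuous_const hu.cont).measurableSet

theorem superlevel_subset (hu : IsAdmissibleFun u a R M) {s : ℝ} (hs : a < s) :
    {y | s ≤ u y} ⊆ Metric.closedBall 0 R := fun y hy => by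
  rw [mem_closedBall_zero_iff]
  by_contra hlt
  have h1 := hu.const y (not_le.1 hlt)
  have h2 : s ≤ u y := hy
  linarith

theorem compl_superlevel_subset (hu : IsAdmissibleFun u a R M) {s : ℝ} (hs : s ≤ a) :
    {y | s ≤ u y}ᶜ ⊆ Metric.closedBall 0 R := fun y hy => by
  rw [mem_closedBall_zero_iff]
  by_contra hlt
  exact hy (hs.trans_eq (hu.const y (not_le.1 hlt)).symm)

theorem isBounded_superlevel (hu : IsAdmissibleFun u a R M) (s : ℝ) :
    Bornology.IsBounded {y | s ≤ u y} ∨ Bornology.IsBounded {y | s ≤ u y}ᶜ := by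
  rcases lt_or_ge a s with hs | hs
  · exact Or.inl (Metric.isBounded_closedBall.subset (hu.superlevel_subset hs))
  · exact Or.inr (Metric.isBounded_closedBall.subset (hu.compl_superlevel_subset hs))

end IsAdmissibleFun

section FunOp

variable {J : Set (RN N) → ℝ≥0∞} {V : ℝ → ℝ → Set (RN N) → RN N → EReal} {Cf K h c : ℝ}
  {T : Set (RN N) → Set (RN N)} {u : RN N → ℝ} {a R M : ℝ}

theorem IsStepOp.le_bound (hT : IsStepOp J V h c T) (H : FlowData J V Cf K) (hh : 0 < h)
    (hc : |c| ≤ Cf) (hu : IsAdmissibleFun u a R M) {s : ℝ} {x : RN N}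
    (hx : x ∈ T {y | s ≤ u y}) : s ≤ M := by
  by_contra hlt
  have : {y | s ≤ u y} = ∅ := by
    ext y
    simp only [Set.mem_ofPred_eq, mem_empty_iff_false, iff_false, not_le]
    exact ((le_abs_self _).trans (hu.bound y)).trans_lt (not_le.1 hlt)
  rw [this, hT.empty H hh hc] at hx
  exact hx

theorem IsStepOp.neg_bound_mem (hT : IsStepOp J V h c T)
    (H' : FlowData (fun A => J Aᶜ) (dualV V) Cf K) (hh : 0 < h) (hc : |c| ≤ Cf)
    (hu : IsAdmissibleFun u a R M) (x : RN N) : x ∈ T {y | -M ≤ u y} := by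
  have : {y | -M ≤ u y} = Set.univ := by
    ext y
    simp only [Set.mem_ofPred_eq, mem_univ, iff_true]
    exact (abs_le.1 (hu.bound y)).1
  rw [this, hT.univ H' hh hc]
  exact mem_univ x

/-- The levels are bounded above because T ∅ = ∅, so the real supremum does not take its default
value. For the converse estimate they are nonempty because T fixes the whole space. -/
theorem IsStepOp.le_funOp (hT : IsStepOp J V h c T) (H : FlowData J V Cf K) (hh : 0 < h)
    (hc : |c| ≤ Cf) (hu : IsAdmissibleFun u a R M) {s : ℝ} {x : RN N}
    (hx : x ∈ T {y | s ≤ u y}) : s ≤ funOp T u x :=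
  le_csSup ⟨M, fun _ hs => hT.le_bound H hh hc hu hs⟩ hx

theorem IsStepOp.funOp_le (hT : IsStepOp J V h c T)
    (H' : FlowData (fun A => J Aᶜ) (dualV V) Cf K) (hh : 0 < h) (hc : |c| ≤ Cf)
    (hu : IsAdmissibleFun u a R M) {b : ℝ} {x : RN N}
    (hb : ∀ s, x ∈ T {y | s ≤ u y} → s ≤ b) : funOp T u x ≤ b :=
  csSup_le ⟨-M, hT.neg_bound_mem H' hh hc hu x⟩ hb

theorem IsStepOp.abs_funOp_le (hT : IsStepOp J V h c T) (H : FlowData J V Cf K)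
    (H' : FlowData (fun A => J Aᶜ) (dualV V) Cf K) (hh : 0 < h) (hc : |c| ≤ Cf)
    (hu : IsAdmissibleFun u a R M) (x : RN N) : |funOp T u x| ≤ M :=
  abs_le.2 ⟨hT.le_funOp H hh hc hu (hT.neg_bound_mem H' hh hc hu x),
    hT.funOp_le H' hh hc hu fun _ hs => hT.le_bound H hh hc hu hs⟩

/-- The operator preserves moduli of continuity. -/
theorem IsStepOp.funOp_add_le (hT : IsStepOp J V h c T) (H : FlowData J V Cf K)
    (H' : FlowData (fun A => J Aᶜ) (dualV V) Cf K) (hh : 0 < h) (hc : |c| ≤ Cf)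
    (hu : IsAdmissibleFun u a R M) {z : RN N} {ε : ℝ} (hz : ∀ y, u (z + y) ≤ u y + ε) (x : RN N) :
    funOp T u (z + x) ≤ funOp T u x + ε := by
  refine hT.funOp_le H' hh hc hu fun s hs => ?_
  have hm := hu.measurableSet_superlevel s
  have hb := hu.isBounded_superlevel s
  -- The superlevel set at s, moved by -z, lies in the one at s - ε; translation invariance and
  -- monotonicity then compare the values at z + x and x.
  have h1 : x ∈ T ((fun y => -z + y) '' {y | s ≤ u y}) := by
    rw [hT.translate H (-z) hm hb (measurableSet_image_add _ hm) (isBounded_or_image_add _ hb)]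
    exact ⟨z + x, hs, by simp⟩
  have h2 := hT.mono H hh (measurableSet_image_add _ hm) (isBounded_or_image_add _ hb)
    (hu.measurableSet_superlevel (s - ε)) (hu.isBounded_superlevel (s - ε)) (by
      rintro _ ⟨y, hy, rfl⟩
      have h3 := hz (-z + y)
      rw [add_neg_cancel_left] at h3
      have h4 : s ≤ u y := hy
      rw [Set.mem_ofPred_eq]
      linarith) h1
  linarith [hT.le_funOp H hh hc hu h2]

end FunOp

/-! ### A priori estimates for the iterates -/

section Evolution

variable {J : Set (RN N) → ℝ≥0∞} {V : ℝ → ℝ → Set (RN N) → RN N → EReal} {Cf K : ℝ}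

theorem FlowData.funOp_eq_of_lt (H : FlowData J V Cf K)
    (H' : FlowData (fun A => J Aᶜ) (dualV V) Cf K) : ∃ C, 0 < C ∧ ∀ h c T u a R M x, 0 < h →
    |c| ≤ Cf → IsStepOp J V h c T → IsAdmissibleFun u a R M → R + C * h < ‖x‖ →
    funOp T u x = a := by
  obtain ⟨C₁, hC₁, h1⟩ := H.stepOp_subset
  obtain ⟨C₂, hC₂, h2⟩ := H'.compl_subset_stepOp
  refine ⟨max C₁ C₂, lt_max_of_lt_left hC₁, fun h c T u a R M x hh hc hT hu hx => ?_⟩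
  have e1 : C₁ * h ≤ max C₁ C₂ * h := by gcongr; exact le_max_left _ _
  have e2 : C₂ * h ≤ max C₁ C₂ * h := by gcongr; exact le_max_right _ _
  refine le_antisymm (hT.funOp_le H' hh hc hu fun s hs => ?_) (hT.le_funOp H hh hc hu ?_)
  · by_contra hlt
    have := h1 h c T _ R hh hc hT hu.radius (hu.measurableSet_superlevel s)
      (hu.superlevel_subset (not_le.1 hlt)) hs
    rw [mem_closedBall_zero_iff] at this
    linarith
  · refine h2 h c T _ R hh hc hT hu.radius (hu.measurableSet_superlevel a)
      (hu.compl_superlevel_subset le_rfl) ?_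
    rw [mem_compl_iff, mem_closedBall_zero_iff]
    linarith

theorem FlowData.le_funOp_on_ball (H : FlowData J V Cf K)
    (H' : FlowData (fun A => J Aᶜ) (dualV V) Cf K) {r₀ : ℝ} (hr₀ : 0 < r₀) :
    ∃ C, 0 < C ∧ ∃ h₀, 0 < h₀ ∧ ∀ h c T u a R M p r s, 0 < h → h ≤ h₀ → |c| ≤ Cf →
      IsStepOp J V h c T → IsAdmissibleFun u a R M → r₀ ≤ r →
      ((∀ y ∈ Metric.ball p r, s ≤ u y) → ∀ y ∈ Metric.ball p (r - C * h), s ≤ funOp T u y) ∧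
      ((∀ y ∈ Metric.ball p r, u y ≤ s) → ∀ y ∈ Metric.ball p (r - C * h), funOp T u y ≤ s) := by
  obtain ⟨C₁, hC₁, h₁, hh₁, hs₁⟩ := H.ball_subset_stepOp hr₀
  obtain ⟨C₂, hC₂, h₂, hh₂, hs₂⟩ := H.disjoint_ball_stepOp H' hr₀
  refine ⟨max C₁ C₂, lt_max_of_lt_left hC₁, min h₁ h₂, lt_min hh₁ hh₂,
    fun h c T u a R M p r s hh hh₀ hc hT hu hr => ⟨fun hy y hyr => ?_, fun hy y hyr => ?_⟩⟩
  · have e1 : C₁ * h ≤ max C₁ C₂ * h := by gcongr; exact le_max_left _ _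
    exact hT.le_funOp H hh hc hu (hs₁ h c T _ p r hh (hh₀.trans (min_le_left _ _)) hc hT
      (hu.measurableSet_superlevel s) (hu.isBounded_superlevel s) hr hy
      (Metric.ball_subset_ball (by linarith) hyr))
  · have e2 : C₂ * h ≤ max C₁ C₂ * h := by gcongr; exact le_max_right _ _
    refine hT.funOp_le H' hh hc hu fun s' hs' => ?_
    by_contra hlt
    have hd := hs₂ h c T {y | s' ≤ u y} p r hh (hh₀.trans (min_le_right _ _)) hc hT
      (hu.measurableSet_superlevel s') (hu.isBounded_superlevel s') hr (by
        rw [Set.disjoint_left]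
        intro w hw hws
        have h3 : s' ≤ u w := hws
        linarith [hy w hw])
    exact Set.disjoint_left.1 hd (Metric.ball_subset_ball (by linarith) hyr) hs'

/-- `U` is the sequence of the iterates, with time step `h`, of step operators. -/
def IsEvolution (J : Set (RN N) → ℝ≥0∞) (V : ℝ → ℝ → Set (RN N) → RN N → EReal) (Cf h : ℝ)
    (u₀ : RN N → ℝ) (U : ℕ → RN N → ℝ) : Prop :=
  U 0 = u₀ ∧ ∀ k, ∃ c T, |c| ≤ Cf ∧ IsStepOp J V h c T ∧ U (k + 1) = funOp T (U k)

/-- The modulus inequalities of u₀ are inherited at each step. They also give continuity of the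
iterates, so that superlevel sets stay measurable and the induction can go on. -/
theorem FlowData.evolution_admissible (H : FlowData J V Cf K)
    (H' : FlowData (fun A => J Aᶜ) (dualV V) Cf K) : ∃ C, 0 < C ∧ ∀ h u₀ U a R M, 0 < h →
    IsEvolution J V Cf h u₀ U → IsAdmissibleFun u₀ a R M → UniformContinuous u₀ → ∀ k : ℕ,
      IsAdmissibleFun (U k) a (R + k * (C * h)) M ∧
      ∀ z ε, (∀ y, u₀ (z + y) ≤ u₀ y + ε) → ∀ y, U k (z + y) ≤ U k y + ε := by
  obtain ⟨C, hC, hconst⟩ := H.funOp_eq_of_lt H'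
  refine ⟨C, hC, fun h u₀ U a R M hh hU hu₀ huc k => ?_⟩
  have hCh := mul_pos hC hh
  induction k with
  | zero => simpa [hU.1] using hu₀
  | succ k ih =>
    obtain ⟨hadm, hmod⟩ := ih
    obtain ⟨c, T, hc, hT, e⟩ := hU.2 k
    have hmod' : ∀ z ε, (∀ y, u₀ (z + y) ≤ u₀ y + ε) → ∀ y, U (k + 1) (z + y) ≤ U (k + 1) y + ε :=
      fun z ε hz y => by
        rw [e]; exact hT.funOp_add_le H H' hh hc hadm (hmod z ε hz) y
    refine ⟨⟨?_, fun x hx => ?_, fun x => ?_, ?_⟩, hmod'⟩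
    · refine Metric.continuous_iff.2 fun y ε hε => ?_
      obtain ⟨δ, hδ, h1⟩ := Metric.uniformContinuous_iff.1 huc (ε / 2) (by linarith)
      have h2 : ∀ z : RN N, ‖z‖ < δ → ∀ w, U (k + 1) (z + w) ≤ U (k + 1) w + ε / 2 :=
        fun z hz => hmod' z _ fun w => by
          have := h1 (a := z + w) (b := w) (by simpa [dist_eq_norm] using hz)
          rw [Real.dist_eq] at this
          linarith [(abs_lt.1 this).2]
      refine ⟨δ, hδ, fun x hx => ?_⟩
      rw [dist_eq_norm] at hx
      have a1 := h2 (x - y) hx y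
      have a2 := h2 (y - x) (by rwa [norm_sub_rev]) x
      rw [sub_add_cancel] at a1 a2
      rw [Real.dist_eq, abs_lt]
      constructor <;> linarith
    · rw [e]
      push_cast at hx
      exact hconst h c T (U k) a _ M x hh hc hT hadm (by linarith)
    · rw [e]; exact hT.abs_funOp_le H H' hh hc hadm x
    · have := hu₀.radius
      positivity

/-- The bounds U k p ± ε on the ball of radius 2r₀ persist on balls shrinking by C h per step. Up to
step j the radius stays at least r₀, so the speed constant for r₀ applies, and the centre p is never
lost. -/
theorem FlowData.evolution_time (H : FlowData J V Cf K)
    (H' : FlowData (fun A => J Aᶜ) (dualV V) Cf K) {r₀ : ℝ} (hr₀ : 0 < r₀) :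
    ∃ C, 0 < C ∧ ∃ h₀, 0 < h₀ ∧ ∀ h u₀ U a R M p ε, 0 < h → h ≤ h₀ → IsEvolution J V Cf h u₀ U →
      IsAdmissibleFun u₀ a R M → UniformContinuous u₀ → ∀ k j : ℕ, j * (C * h) ≤ r₀ →
      (∀ y ∈ Metric.ball p (2 * r₀), |U k y - U k p| ≤ ε) → |U (k + j) p - U k p| ≤ ε := by
  obtain ⟨C₁, hC₁, hadm⟩ := H.evolution_admissible H'
  obtain ⟨C, hC, h₀, hh₀, hs⟩ := H.le_funOp_on_ball H' hr₀
  refine ⟨C, hC, h₀, hh₀, fun h u₀ U a R M p ε hh hhh₀ hU hu₀ huc k j hj hy => ?_⟩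
  have hCh := mul_pos hC hh
  have key : ∀ i : ℕ, i ≤ j → ∀ y ∈ Metric.ball p (2 * r₀ - i * (C * h)),
      U k p - ε ≤ U (k + i) y ∧ U (k + i) y ≤ U k p + ε := by
    intro i
    induction i with
    | zero =>
      intro _ y hyb
      have := abs_le.1 (hy y (by simpa using hyb))
      rw [add_zero]
      constructor <;> linarith
    | succ i ih =>
      intro hij y hyb
      have ih := ih (by omega)
      obtain ⟨c, T, hc, hT, e⟩ := hU.2 (k + i)
      have hr : r₀ ≤ 2 * r₀ - i * (C * h) := by
        have : (i : ℝ) * (C * h) ≤ j * (C * h) := by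
          gcongr; omega
        linarith
      have h1 := hadm h u₀ U a R M hh hU hu₀ huc (k + i)
      rw [← add_assoc, e]
      have hyb' : y ∈ Metric.ball p (2 * r₀ - i * (C * h) - C * h) := by
        convert hyb using 2
        push_cast; ring
      exact ⟨(hs h c T _ _ _ _ p _ (U k p - ε) hh hhh₀ hc hT h1.1 hr).1
          (fun w hw => (ih w hw).1) y hyb',
        (hs h c T _ _ _ _ p _ (U k p + ε) hh hhh₀ hc hT h1.1 hr).2
          (fun w hw => (ih w hw).2) y hyb'⟩
  have := key j le_rfl p (Metric.mem_ball_self (by linarith))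
  rw [abs_le]
  constructor <;> linarith [this.1, this.2]

theorem FlowData.evolution_equicontinuous (H : FlowData J V Cf K)
    (H' : FlowData (fun A => J Aᶜ) (dualV V) Cf K) {u₀ : RN N → ℝ} {a R M : ℝ}
    (hu₀ : IsAdmissibleFun u₀ a R M) (huc : UniformContinuous u₀) {ε : ℝ} (hε : 0 < ε) :
    ∃ δ, 0 < δ ∧ ∃ h₀, 0 < h₀ ∧ ∀ h U, 0 < h → h ≤ h₀ → IsEvolution J V Cf h u₀ U →
      ∀ x y t s, 0 ≤ t → 0 ≤ s → dist x y ≤ δ → |t - s| ≤ δ →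
        |U ⌊t / h⌋₊ x - U ⌊s / h⌋₊ y| ≤ ε := by
  obtain ⟨C₁, hC₁, hadm⟩ := H.evolution_admissible H'
  obtain ⟨δ₁, hδ₁, h1⟩ := Metric.uniformContinuous_iff.1 huc (ε / 2) (by linarith)
  obtain ⟨C, hC, h₂, hh₂, htime⟩ := H.evolution_time H' (r₀ := δ₁ / 4) (by linarith)
  -- The number j of steps between s and t satisfies j h ≤ (t - s) + h. Each summand may use half of
  -- δ₁/(4C), so that j C h ≤ δ₁/4 = r₀; the balls of radius 2r₀ = δ₁/2 fit in the spatial modulus.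
  refine ⟨min (δ₁ / 2) (δ₁ / 4 / (2 * C)), by positivity, min h₂ (δ₁ / 4 / (2 * C)), by positivity,
    fun h U hh hh₀ hU => ?_⟩
  have hspace : ∀ k x y, dist x y < δ₁ → |U k x - U k y| ≤ ε / 2 := by
    intro k x y hxy
    have h2 : ∀ z : RN N, ‖z‖ < δ₁ → ∀ w, U k (z + w) ≤ U k w + ε / 2 :=
      fun z hz => (hadm h u₀ U a R M hh hU hu₀ huc k).2 z _ fun w => by
        have := h1 (a := z + w) (b := w) (by simpa [dist_eq_norm] using hz)
        rw [Real.dist_eq] at this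
        linarith [(abs_lt.1 this).2]
    rw [dist_eq_norm] at hxy
    have a1 := h2 (x - y) hxy y
    have a2 := h2 (y - x) (by rwa [norm_sub_rev]) x
    rw [sub_add_cancel] at a1 a2
    rw [abs_le]
    constructor <;> linarith
  have hts : ∀ p t s, 0 ≤ s → s ≤ t → t - s ≤ δ₁ / 4 / (2 * C) →
      |U ⌊t / h⌋₊ p - U ⌊s / h⌋₊ p| ≤ ε / 2 := by
    intro p t s hs hst hδ
    have hle : ⌊s / h⌋₊ ≤ ⌊t / h⌋₊ := Nat.floor_le_floor (by gcongr)
    obtain ⟨j, hj⟩ := Nat.exists_eq_add_of_le hle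
    rw [hj]
    refine htime h u₀ U a R M p (ε / 2) hh (hh₀.trans (min_le_left _ _)) hU hu₀ huc _ j ?_
      fun y hy => hspace _ _ _ (lt_of_lt_of_le (Metric.mem_ball.1 hy) (by linarith))
    have f1 : ((⌊t / h⌋₊ : ℕ) : ℝ) ≤ t / h := Nat.floor_le (div_nonneg (hs.trans hst) hh.le)
    have f2 : s / h < (⌊s / h⌋₊ : ℕ) + 1 := Nat.lt_floor_add_one _
    rw [hj] at f1
    push_cast at f1
    rw [le_div_iff₀ hh] at f1
    rw [div_lt_iff₀ hh] at f2
    have f3 : (j : ℝ) * h ≤ δ₁ / 4 / (2 * C) + δ₁ / 4 / (2 * C) := by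
      have := hh₀.trans (min_le_right _ _)
      linarith
    have f4 : C * (δ₁ / 4 / (2 * C) + δ₁ / 4 / (2 * C)) = δ₁ / 4 := by field_simp; ring
    calc (j : ℝ) * (C * h) = C * (j * h) := by ring
      _ ≤ C * (δ₁ / 4 / (2 * C) + δ₁ / 4 / (2 * C)) := by gcongr
      _ = δ₁ / 4 := f4
  intro x y t s ht hs hxy hts'
  have b1 := hspace ⌊t / h⌋₊ x y (lt_of_le_of_lt (hxy.trans (min_le_left _ _)) (by linarith))
  have b2 : |U ⌊t / h⌋₊ y - U ⌊s / h⌋₊ y| ≤ ε / 2 := by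
    have hδ := hts'.trans (min_le_right _ _)
    rcases le_total s t with hst | hst
    · exact hts y t s hs hst ((le_abs_self _).trans hδ)
    · rw [abs_sub_comm]
      exact hts y s t ht hst ((le_abs_self _).trans (by rwa [abs_sub_comm] at hδ))
  have := abs_sub_le (U ⌊t / h⌋₊ x) (U ⌊t / h⌋₊ y) (U ⌊s / h⌋₊ y)
  linarith

end Evolution

/-! ### The curvature of balls -/

theorem tendstoC2_const (E : Set (RN N)) : TendstoC2 (fun _ => E) E := by
  refine ⟨fun _ => Equiv.refl _, fun n => ⟨contDiff_id, contDiff_id, by simp⟩,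
    fun i _ ε hε => Eventually.of_forall fun n y => ?_⟩
  have h0 : (fun z : RN N => (Equiv.refl (RN N)) z - z) = fun _ => 0 := by ext1 z; simp
  rw [h0, iteratedFDeriv_fun_zero]
  simpa using hε.le

/-- Condition (C) along the constant sequence Eₙ = E says that κ(·, E) is continuous on the
boundary. -/
theorem CurvatureContinuous.exists_bound {κ : RN N → Set (RN N) → ℝ} (hκ : CurvatureContinuous κ)
    {E : Set (RN N)} (hE : IsAdmissibleC2 E) (hc : IsCompact (frontier E)) :
    ∃ C : ℝ, ∀ x ∈ frontier E, |κ x E| ≤ C := by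
  have hcont : ContinuousOn (fun x => κ x E) (frontier E) := by
    rw [continuousOn_iff_continuous_domRestrict]
    refine continuous_iff_seqContinuous.2 fun xn x hx => ?_
    exact hκ (fun _ => E) E (fun n => xn n) x (fun _ => hE) hE (tendstoC2_const E)
      (fun n => (xn n).2) x.2 ((continuous_subtype_val.tendsto x).comp hx)
  exact hc.exists_bound_of_continuousOn hcont

/-- Condition (D) gives the bounds uniform in the radius; those depending on the radius come from
(C) and compactness of spheres. The dual data use the same facts for complements of balls. -/
theorem exists_flowData {J : Set (RN N) → ℝ≥0∞} (hJ : IsGeneralizedPerimeter J)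
    {κ : RN N → Set (RN N) → ℝ} (hκ : IsCurvatureOf J κ) (hκC : CurvatureContinuous κ)
    (hκD : CurvatureBallBound κ) {ψ : RN N → ℝ} {C Cf : ℝ} (hψ : IsNormLike ψ C)
    {g : EReal → EReal} (hg : IsNonlin g) (hCf : 0 ≤ Cf) :
    ∃ K, FlowData J (potential ψ g) Cf K ∧
      FlowData (fun A => J Aᶜ) (dualV (potential ψ g)) Cf K := by
  obtain ⟨K, hK, hb⟩ := hκD
  have hfr : ∀ ρ : ℝ, 0 < ρ → frontier (Metric.ball (0 : RN N) ρ) = Metric.sphere 0 ρ :=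
    fun ρ hρ => frontier_ball 0 hρ.ne'
  have hfr' : ∀ ρ : ℝ, 0 < ρ → frontier (Metric.ball (0 : RN N) ρ)ᶜ = Metric.sphere 0 ρ :=
    fun ρ hρ => by rw [frontier_compl, hfr ρ hρ]
  have hadm : ∀ ρ : ℝ, 0 < ρ → IsAdmissibleC2 (Metric.ball (0 : RN N) ρ) :=
    fun ρ hρ => isAdmissibleC2_ball 0 hρ
  have H : FlowData J (potential ψ g) Cf K := by
    refine hψ.flowData hg hJ hK hCf (fun ρ hρ x hx => ?_) fun ρ hρ => ?_
    · rw [(hκ _ (hadm ρ hρ) x (by rwa [hfr ρ hρ])).1, EReal.coe_le_coe_iff]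
      exact (hb ρ hρ x hx).1
    · obtain ⟨B, hB⟩ := hκC.exists_bound (hadm ρ hρ) (by rw [hfr ρ hρ]; exact isCompact_sphere 0 ρ)
      rw [hfr ρ hρ] at hB
      refine ⟨B, fun x hx => ?_⟩
      rw [(hκ _ (hadm ρ hρ) x (by rwa [hfr ρ hρ])).2, EReal.coe_le_coe_iff]
      exact (le_abs_self _).trans (hB x hx)
  refine ⟨K, H, H.dual (fun ρ hρ x hx => ?_) fun ρ hρ => ?_⟩
  · rw [curvPlus_dual J x _ (hJ.finite_C2 _ (hadm ρ hρ).compl).ne,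
      (hκ _ (hadm ρ hρ).compl x (by rwa [hfr' ρ hρ])).2, ← EReal.coe_neg, EReal.coe_le_coe_iff]
    exact (hb ρ hρ x hx).2
  · obtain ⟨B, hB⟩ := hκC.exists_bound (hadm ρ hρ).compl
      (by rw [hfr' ρ hρ]; exact isCompact_sphere 0 ρ)
    rw [hfr' ρ hρ] at hB
    refine ⟨B, fun x hx => ?_⟩
    rw [curvMinus_dual J x _ (hJ.finite_C2 _ (hadm ρ hρ).compl).ne,
      (hκ _ (hadm ρ hρ).compl x (by rwa [hfr' ρ hρ])).1, ← EReal.coe_neg, EReal.coe_le_coe_iff]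
    exact (neg_le_abs _).trans (hB x hx)

/-! ### The discrete solutions -/

theorem abs_meanForcing_le {f : ℝ → ℝ} {C h : ℝ} (hf : ∀ s, |f s| ≤ C) (hh : 0 < h) (k : ℕ) :
    |meanForcing f h k| ≤ C := by
  have h1 := intervalIntegral.norm_integral_le_of_norm_le_const (a := k * h) (b := (k + 1) * h)
    (f := f) (C := C) fun s _ => hf s
  rw [show (k + 1) * h - k * h = h by ring, abs_of_pos hh, Real.norm_eq_abs] at h1
  rw [meanForcing, abs_mul, abs_of_pos (inv_pos.2 hh), inv_mul_le_iff₀ hh, mul_comm h]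
  exact h1

theorem isEvolution_iterate {J : Set (RN N) → ℝ≥0∞} {ψ : RN N → ℝ} {g : EReal → EReal}
    {C Cf K h : ℝ} (hψ : IsNormLike ψ C) (hg : IsNonlin g) (H : FlowData J (potential ψ g) Cf K)
    (hh : 0 < h) {f : ℝ → ℝ} (hf : ∀ s, |f s| ≤ Cf) (u₀ : RN N → ℝ) :
    IsEvolution J (potential ψ g) Cf h u₀ (iterate J ψ g f u₀ h) :=
  ⟨rfl, fun k => ⟨_, setStep J ψ g f h (k * h), abs_meanForcing_le hf hh _,
    hψ.isStepOp_setStep hg H hh f (abs_meanForcing_le hf hh _), rfl⟩⟩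

theorem exists_isAdmissibleFun {u : RN N → ℝ} (hu : Continuous u) {c : ℝ} {K : Set (RN N)}
    (hK : IsCompact K) (hc : ∀ x, x ∉ K → u x = c) :
    ∃ R M, IsAdmissibleFun u c R M ∧ UniformContinuous u := by
  obtain ⟨R, hR⟩ := hK.isBounded.subset_closedBall 0
  obtain ⟨M, hM⟩ := hK.exists_bound_of_continuousOn hu.continuousOn
  refine ⟨max R 0, max M |c|, ⟨hu, fun x hx => hc x fun hxK => ?_, fun x => ?_, le_max_right _ _⟩,
    hu.uniformContinuous_of_tendsto_cocompact (x := c) ?_⟩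
  · exact ((le_max_left R 0).trans_lt hx).not_ge (mem_closedBall_zero_iff.1 (hR hxK))
  · by_cases hx : x ∈ K
    · exact (hM x hx).trans (le_max_left _ _)
    · rw [hc x hx]; exact le_max_right _ _
  · refine tendsto_const_nhds.congr' ?_
    filter_upwards [hK.compl_mem_cocompact] with x hx using (hc x hx).symm

/-! ### Compactness of asymptotically equicontinuous sequences -/

theorem exists_subseq_tendsto_on_countable {X : Type*} {D : Set X} (hD : D.Countable)
    {f : ℕ → X → ℝ} {M : ℝ} (hM : ∀ n, ∀ z ∈ D, |f n z| ≤ M) :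
    ∃ φ : ℕ → ℕ, StrictMono φ ∧ ∀ z ∈ D, ∃ a, Tendsto (fun n => f (φ n) z) atTop (𝓝 a) := by
  have := hD.to_subtype
  obtain ⟨v, -, φ, hφ, hv⟩ := (isCompact_univ_pi fun _ : D => isCompact_Icc (a := -M) (b := M)
    ).tendsto_subseq (x := fun n (z : D) => f n z) fun n z _ => abs_le.1 (hM n z z.2)
  exact ⟨φ, hφ, fun z hz => ⟨v ⟨z, hz⟩, tendsto_pi_nhds.1 hv ⟨z, hz⟩⟩⟩

/-- The usual three-term estimate through a finite net of `Kc`; off `Kc` the functions coincide.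
Equicontinuity is needed only for large n. -/
theorem uniformCauchySeqOn_of_dense_tendsto {X : Type*} [PseudoMetricSpace X] {S Kc D : Set X}
    (hD : ∀ δ > 0, ∃ F ⊆ D, F.Finite ∧ F ⊆ S ∧ ∀ x ∈ Kc, ∃ z ∈ F, dist x z < δ)
    {f : ℕ → X → ℝ} {c : ℝ}
    (heq : ∀ ε > 0, ∃ δ > 0, ∀ᶠ n in atTop, ∀ x ∈ S, ∀ y ∈ S, dist x y ≤ δ → |f n x - f n y| ≤ ε)
    (hc : ∀ n, ∀ x ∈ S \ Kc, f n x = c)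
    (hlim : ∀ z ∈ D, ∃ a, Tendsto (fun n => f n z) atTop (𝓝 a)) :
    UniformCauchySeqOn f atTop S := by
  rw [Metric.uniformCauchySeqOn_iff]
  intro ε hε
  obtain ⟨δ, hδ, hev⟩ := heq (ε / 4) (by positivity)
  obtain ⟨F, hFD, hF, hFS, hnet⟩ := hD δ hδ
  have hcau : ∀ z ∈ F, ∃ n₀, ∀ m ≥ n₀, ∀ n ≥ n₀, dist (f m z) (f n z) < ε / 4 := fun z hz => by
    obtain ⟨a, ha⟩ := hlim z (hFD hz)
    exact Metric.cauchySeq_iff.1 ha.cauchySeq (ε / 4) (by positivity)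
  choose! n₀ hn₀ using hcau
  obtain ⟨n₁, hn₁⟩ := eventually_atTop.1 hev
  obtain ⟨B, hB⟩ := (hF.image n₀).bddAbove
  refine ⟨max n₁ B, fun m hm n hn x hx => ?_⟩
  by_cases hxK : x ∈ Kc
  · obtain ⟨z, hz, hxz⟩ := hnet x hxK
    have hBz : n₀ z ≤ B := hB (mem_image_of_mem _ hz)
    have h1 := hn₁ m ((le_max_left _ _).trans hm) x hx z (hFS hz) hxz.le
    have h2 := hn₁ n ((le_max_left _ _).trans hn) x hx z (hFS hz) hxz.le
    have h3 := hn₀ z hz m (hBz.trans ((le_max_right _ _).trans hm)) n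
      (hBz.trans ((le_max_right _ _).trans hn))
    rw [Real.dist_eq] at h3 ⊢
    rw [abs_le] at h1 h2
    rw [abs_lt] at h3 ⊢
    constructor <;> linarith
  · rw [hc m x ⟨hx, hxK⟩, hc n x ⟨hx, hxK⟩, dist_self]
    exact hε

theorem exists_subseq_tendstoUniformlyOn {X : Type*} [PseudoMetricSpace X] {S Kc : Set X}
    (hKc : IsCompact Kc) (hKS : Kc ⊆ S) {f : ℕ → X → ℝ} {M c : ℝ}
    (hM : ∀ n, ∀ x ∈ S, |f n x| ≤ M)
    (heq : ∀ ε > 0, ∃ δ > 0, ∀ᶠ n in atTop, ∀ x ∈ S, ∀ y ∈ S, dist x y ≤ δ → |f n x - f n y| ≤ ε)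
    (hc : ∀ n, ∀ x ∈ S \ Kc, f n x = c) :
    ∃ (φ : ℕ → ℕ) (u : X → ℝ), StrictMono φ ∧
      TendstoUniformlyOn (fun n => f (φ n)) u atTop S ∧ UniformContinuousOn u S ∧
      (∀ x ∈ S, |u x| ≤ M) ∧ ∀ x ∈ S \ Kc, u x = c := by
  have hnet : ∀ m : ℕ, ∃ F ⊆ Kc, F.Finite ∧ Kc ⊆ ⋃ z ∈ F, Metric.ball z (1 / ((m : ℝ) + 1)) :=
    fun m => hKc.finite_cover_balls Nat.one_div_pos_of_nat
  choose F hFK hF hcov using hnet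
  set D := ⋃ m, F m
  have hDK : D ⊆ Kc := iUnion_subset hFK
  obtain ⟨φ, hφ, hlim⟩ := exists_subseq_tendsto_on_countable
    (countable_iUnion fun m => (hF m).countable : D.Countable) (f := f) (M := M)
    fun n z hz => hM n z (hKS (hDK hz))
  have heq' : ∀ ε > 0, ∃ δ > 0, ∀ᶠ n in atTop, ∀ x ∈ S, ∀ y ∈ S, dist x y ≤ δ →
      |f (φ n) x - f (φ n) y| ≤ ε := fun ε hε => by
    obtain ⟨δ, hδ, h⟩ := heq ε hε
    exact ⟨δ, hδ, hφ.tendsto_atTop.eventually h⟩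
  have hcauchy : UniformCauchySeqOn (fun n => f (φ n)) atTop S := by
    refine uniformCauchySeqOn_of_dense_tendsto (Kc := Kc) (D := D) (c := c) (fun δ hδ => ?_) heq'
      (fun n => hc (φ n)) hlim
    obtain ⟨m, hm⟩ := exists_nat_one_div_lt hδ
    refine ⟨F m, subset_iUnion F m, hF m, (hFK m).trans hKS, fun x hx => ?_⟩
    obtain ⟨z, hz, hxz⟩ := mem_iUnion₂.1 (hcov m hx)
    exact ⟨z, hz, (Metric.mem_ball.1 hxz).trans hm⟩
  have hpt : ∀ x ∈ S, ∃ a, Tendsto (fun n => f (φ n) x) atTop (𝓝 a) := fun x hx =>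
    cauchySeq_tendsto_of_complete (hcauchy.cauchySeq hx)
  choose! u hu using hpt
  refine ⟨φ, u, hφ, hcauchy.tendstoUniformlyOn_of_tendsto hu, ?_, fun x hx => ?_, fun x hx => ?_⟩
  · rw [Metric.uniformContinuousOn_iff]
    intro ε hε
    obtain ⟨δ, hδ, h⟩ := heq' (ε / 2) (by positivity)
    refine ⟨δ, hδ, fun x hx y hy hxy => ?_⟩
    have hle : |u x - u y| ≤ ε / 2 := le_of_tendsto ((hu x hx).sub (hu y hy)).abs
      (h.mono fun n hn => hn x hx y hy hxy.le)
    rw [Real.dist_eq]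
    linarith
  · exact le_of_tendsto (hu x hx).abs (Eventually.of_forall fun n => hM (φ n) x hx)
  · refine tendsto_nhds_unique (hu x hx.1) ?_
    simp only [hc _ x hx]
    exact tendsto_const_nhds

end MinMov

end

/-! ### The proposition -/

theorem proposition3p1 (N : ℕ) (hN : 0 < N)
    (J : Set (RN N) → ℝ≥0∞) (hJ : MinMov.IsGeneralizedPerimeter J)
    (κ : RN N → Set (RN N) → ℝ) (hκ : MinMov.IsCurvatureOf J κ)
    (hκC : MinMov.CurvatureContinuous κ) (hκD : MinMov.CurvatureBallBound κ)
    (ψ : RN N → ℝ) (hψ : MinMov.IsAnisotropy ψ)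
    (G : ℝ → ℝ) (hGc : Continuous G) (hGm : Monotone G) (hG0 : G 0 = 0) (hG : ∃ s, G s ≠ 0)
    (g : EReal → EReal) (hg : MinMov.IsInverseSelection G g)
    (f : ℝ → ℝ) (hfc : Continuous f) (hfb : ∃ C : ℝ, ∀ s, |f s| ≤ C)
    (u₀ : RN N → ℝ) (hu₀ : Continuous u₀)
    (hu₀K : ∃ (c : ℝ) (K : Set (RN N)), IsCompact K ∧ ∀ x, x ∉ K → u₀ x = c)
    (T : ℝ) (hT : 0 < T) :
    -- uniform boundedness
    (∃ M : ℝ, ∀ h : ℝ, 0 < h → ∀ x : RN N, ∀ t ∈ Icc 0 T,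
      |MinMov.discreteSol J ψ g f u₀ h x t| ≤ M) ∧
    -- asymptotic equicontinuity
    (∀ ε : ℝ, 0 < ε → ∃ δ : ℝ, 0 < δ ∧ ∃ h₀ : ℝ, 0 < h₀ ∧ ∀ h : ℝ, 0 < h → h ≤ h₀ →
      ∀ x y : RN N, ∀ t ∈ Icc 0 T, ∀ s ∈ Icc 0 T, dist x y ≤ δ → |t - s| ≤ δ →
        |MinMov.discreteSol J ψ g f u₀ h x t - MinMov.discreteSol J ψ g f u₀ h y s| ≤ ε) ∧
    -- uniform convergence up to subsequences
    (∀ hs : ℕ → ℝ, (∀ n, 0 < hs n) → Tendsto hs atTop (𝓝 0) →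
      ∃ (φ : ℕ → ℕ) (u : RN N × ℝ → ℝ), StrictMono φ ∧
        TendstoUniformlyOn (fun n z => MinMov.discreteSol J ψ g f u₀ (hs (φ n)) z.1 z.2) u atTop
          (univ ×ˢ Icc 0 T) ∧
        UniformContinuousOn u (univ ×ˢ Icc 0 T) ∧
        (∃ M : ℝ, ∀ z ∈ (univ : Set (RN N)) ×ˢ Icc 0 T, |u z| ≤ M) ∧
        ∃ (c : ℝ) (K : Set (RN N)), IsCompact K ∧
          ∀ x, x ∉ K → ∀ t ∈ Icc 0 T, u (x, t) = c) := by
  obtain ⟨C₀, hψ'⟩ := hψ.isNormLike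
  have hg' := hg.isNonlin hGm hG0 hG
  obtain ⟨Cf, hCf⟩ := hfb
  obtain ⟨K, H, H'⟩ := MinMov.exists_flowData hJ hκ hκC hκD hψ' hg'
    ((abs_nonneg _).trans (hCf 0))
  obtain ⟨c, K₀, hK₀, hc⟩ := hu₀K
  obtain ⟨R, M, hadm, huc⟩ := MinMov.exists_isAdmissibleFun hu₀ hK₀ hc
  have hev : ∀ h : ℝ, 0 < h → MinMov.IsEvolution J (MinMov.potential ψ g) Cf h u₀
      (MinMov.iterate J ψ g f u₀ h) :=
    fun h hh => MinMov.isEvolution_iterate hψ' hg' H hh hCf u₀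
  obtain ⟨C, hC, hall⟩ := H.evolution_admissible H'
  have hU : ∀ h : ℝ, 0 < h → ∀ k : ℕ,
      MinMov.IsAdmissibleFun (MinMov.iterate J ψ g f u₀ h k) c (R + k * (C * h)) M :=
    fun h hh k => (hall h u₀ _ c R M hh (hev h hh) hadm huc k).1
  have heq : ∀ ε : ℝ, 0 < ε → ∃ δ : ℝ, 0 < δ ∧ ∃ h₀ : ℝ, 0 < h₀ ∧ ∀ h : ℝ, 0 < h → h ≤ h₀ →
      ∀ x y : RN N, ∀ t ∈ Icc 0 T, ∀ s ∈ Icc 0 T, dist x y ≤ δ → |t - s| ≤ δ →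
        |MinMov.discreteSol J ψ g f u₀ h x t - MinMov.discreteSol J ψ g f u₀ h y s| ≤ ε := by
    intro ε hε
    obtain ⟨δ, hδ, h₀, hh₀, he⟩ := H.evolution_equicontinuous H' hadm huc hε
    exact ⟨δ, hδ, h₀, hh₀, fun h hh hhh₀ x y t ht s hs hxy hts =>
      he h _ hh hhh₀ (hev h hh) x y t s ht.1 hs.1 hxy hts⟩
  refine ⟨⟨M, fun h hh x t _ => (hU h hh _).bound x⟩, heq, fun hs hs0 hlim => ?_⟩
  set F : ℕ → RN N × ℝ → ℝ := fun n z => MinMov.discreteSol J ψ g f u₀ (hs n) z.1 z.2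
  have hequi : ∀ ε > 0, ∃ δ > 0, ∀ᶠ n in atTop, ∀ x ∈ (univ : Set (RN N)) ×ˢ Icc 0 T,
      ∀ y ∈ (univ : Set (RN N)) ×ˢ Icc 0 T, dist x y ≤ δ → |F n x - F n y| ≤ ε := by
    intro ε hε
    obtain ⟨δ, hδ, h₀, hh₀, he⟩ := heq ε hε
    refine ⟨δ, hδ, ?_⟩
    filter_upwards [hlim.eventually (gt_mem_nhds hh₀)] with n hn x hx y hy hxy
    rw [Prod.dist_eq, max_le_iff] at hxy
    exact he (hs n) (hs0 n) hn.le x.1 y.1 x.2 hx.2 y.2 hy.2 hxy.1 hxy.2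
  have hfar : ∀ n, ∀ z ∈ (univ ×ˢ Icc 0 T) \ (Metric.closedBall (0 : RN N) (R + C * T) ×ˢ Icc 0 T),
      F n z = c := by
    intro n z hz
    refine (hU _ (hs0 n) _).const z.1 ?_
    -- The number of steps up to time T is at most T/h, so the ball outside which `u_h` is constant
    -- has radius at most R + C T, independently of h.
    have h1 : (⌊z.2 / hs n⌋₊ : ℝ) * hs n ≤ T := by
      have := Nat.floor_le (div_nonneg hz.1.2.1 (hs0 n).le)
      rw [le_div_iff₀ (hs0 n)] at this
      exact this.trans hz.1.2.2
    have h2 : R + C * T < ‖z.1‖ := by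
      by_contra! h
      exact hz.2 ⟨mem_closedBall_zero_iff.2 h, hz.1.2⟩
    have h3 := mul_le_mul_of_nonneg_left h1 hC.le
    linarith
  obtain ⟨φ, u, hφ, hunif, hcont, hbound, hconst⟩ := MinMov.exists_subseq_tendstoUniformlyOn
    (S := univ ×ˢ Icc 0 T) (Kc := Metric.closedBall (0 : RN N) (R + C * T) ×ˢ Icc 0 T)
    ((isCompact_closedBall _ _).prod isCompact_Icc) (prod_mono_left (subset_univ _))
    (f := F) (M := M) (c := c)
    (fun n z _ => (hU _ (hs0 n) _).bound z.1) hequi hfar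
  refine ⟨φ, u, hφ, hunif, hcont, ⟨M, hbound⟩, c, Metric.closedBall 0 (R + C * T),
    isCompact_closedBall _ _, fun x hx t ht => hconst (x, t) ⟨⟨mem_univ _, ht⟩, fun h => hx h.1⟩⟩
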